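/- Let $n\ge 1$ and $\ell\in\{1,\dots,n\}$. Let $\Omega\subset\mathbb R^n$ be a bounded domain that is star shaped with respect to an open ball $B\subset\Omega$, i.e. for every $y\in\Omega$ the convex hull of $B\cup\{y\}$ is contained in $\Omega$. Set $R=\operatorname{diam}(\Omega)$ and $\rho=\operatorname{diam}(B)$. Let $\theta\in C_0^\infty(B)$ satisfy $\int\theta\,dx=1$ and, for all multi-indices $\alpha$, $$\|\partial^\alpha\theta\|_{L^1}\le \frac{K_\alpha}{\rho^{|\alpha|}},\qquad \|\partial^\alpha\theta\|_{L^\infty}\le\frac{K_\alpha}{\rho^{n+|\alpha|}},$$ where the constants $K_\alpha=K(n,\alpha)$ are fixed once and for all, independently of $\Omega$ and $B$. For $m\in\{1,\dots,n\}$ and $f\in L^2(\mathbb R^n)$ with $\operatorname{supp} f\subset\overline\Omega$ let $$P_\ell f(x)=\int_0^1 s^{\ell-1}\int_{\mathbb R^n}\theta\Big(x+\frac{y-x}{1-s}\Big)\frac{x_m-y_m}{1-s}\,f(y)\,dy\,\frac{ds}{(1-s)^n}.$$ Then this double integral converges absolutely for almost every $x\in\Omega$, $P_\ell f\in H^1(\Omega)$,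 and $$|P_\ell f|_{H^1(\Omega)}=\Big(\sum_{j=1}^n\|\partial_j P_\ell f\|_{L^2(\Omega)}^2\Big)^{1/2}\le C\,\frac R\rho\,\kappa\,\|f\|_{L^2(\Omega)},$$ where $C=C(n,\ell)$ depends only on $n$ and $\ell$ (and on the fixed constants $K(n,\alpha)$), and 1. if $2\ell>n$, then $\kappa=1$; 2. if $2\ell=n-1$ or $2\ell=n$, then $$\kappa=1+\Big(\frac{|\Omega|}{|B|}\Big)^{\frac{n-2\ell}{2(n-\ell)}}\Big(\log\frac{|\Omega|}{|B|}\Big)^{\frac{n}{2(n-\ell)}};$$ 3. if $2\ell\le n-2$, then $$\kappa=1+\Big(\frac{|\Omega|}{|B|}\Big)^{\frac{n-2\ell}{2(n-\ell)}}\Big(\log\frac{|\Omega|}{|B|}\Big)^{\frac{n}{2(n-\ell-1)}}.$$ -/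

import Mathlib

open MeasureTheory
open scoped ContDiff

/-- `∂_j g`. -/
noncomputable def partialD {n : ℕ} (j : Fin n) (g : EuclideanSpace ℝ (Fin n) → ℝ) :
    EuclideanSpace ℝ (Fin n) → ℝ :=
  fun x => fderiv ℝ g x (EuclideanSpace.single j 1)

/-- The iterated partial derivative `∂_{j₁} ⋯ ∂_{jₖ} g` for the list `J = [j₁, …, jₖ]`. For smooth
`g` this is `∂^α g` with the multi-index `α = e_{j₁} + ⋯ + e_{jₖ}`, so `|α| = J.length`. -/
noncomputable def iteratedPartialD {n : ℕ} (J : List (Fin n))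
    (g : EuclideanSpace ℝ (Fin n) → ℝ) : EuclideanSpace ℝ (Fin n) → ℝ :=
  J.foldr partialD g

/-- `Ω` is star shaped with respect to `B ⊆ Ω`: the convex hull of `B ∪ {y}` is contained in `Ω`
for every `y ∈ Ω`. -/
def IsStarShapedWrt {n : ℕ} (Ω B : Set (EuclideanSpace ℝ (Fin n))) : Prop :=
  B ⊆ Ω ∧ ∀ y ∈ Ω, convexHull ℝ (B ∪ {y}) ⊆ Ω

/-- `θ ∈ C_0^∞(B)` has integral one and
`‖∂^α θ‖_{L¹} ≤ K_α / diam(B)^{|α|}`, `‖∂^α θ‖_{L^∞} ≤ K_α / diam(B)^{n + |α|}` for all `α`. -/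
structure IsScaledBump {n : ℕ} (K : List (Fin n) → ℝ) (B : Set (EuclideanSpace ℝ (Fin n)))
    (θ : EuclideanSpace ℝ (Fin n) → ℝ) : Prop where
  contDiff : ContDiff ℝ ∞ θ
  hasCompactSupport : HasCompactSupport θ
  tsupport_subset : tsupport θ ⊆ B
  integral_eq_one : ∫ x, θ x = 1
  l1_bound : ∀ J : List (Fin n),
    ∫ x, |iteratedPartialD J θ x| ≤ K J / Metric.diam B ^ J.length
  linfty_bound : ∀ (J : List (Fin n)) (x : EuclideanSpace ℝ (Fin n)),
    |iteratedPartialD J θ x| ≤ K J / Metric.diam B ^ (n + J.length)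

/-- The integrand `θ(x + (y - x)/(1 - s)) (x_m - y_m)/(1 - s) f(y)`. -/
noncomputable def poincareIntegrand {n : ℕ} (m : Fin n) (θ f : EuclideanSpace ℝ (Fin n) → ℝ)
    (x : EuclideanSpace ℝ (Fin n)) (s : ℝ) (y : EuclideanSpace ℝ (Fin n)) : ℝ :=
  θ (x + (1 - s)⁻¹ • (y - x)) * ((x m - y m) / (1 - s)) * f y

/-- The reduced Poincaré-type operator
`P_ℓ f(x) = ∫_0^1 s^{ℓ-1} ∫ θ(x + (y-x)/(1-s)) (x_m - y_m)/(1-s) f(y) dy ds/(1-s)^n`. -/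
noncomputable def reducedPoincare {n : ℕ} (ℓ : ℕ) (m : Fin n)
    (θ f : EuclideanSpace ℝ (Fin n) → ℝ) (x : EuclideanSpace ℝ (Fin n)) : ℝ :=
  ∫ s in Set.Ioo (0 : ℝ) 1,
    s ^ (ℓ - 1) * (∫ y, poincareIntegrand m θ f x s y) * (1 / (1 - s) ^ n)

/-- The double integral defining `P_ℓ f(x)` converges absolutely. -/
def ReducedPoincareConverges {n : ℕ} (ℓ : ℕ) (m : Fin n)
    (θ f : EuclideanSpace ℝ (Fin n) → ℝ) (x : EuclideanSpace ℝ (Fin n)) : Prop :=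
  Integrable (fun p : ℝ × EuclideanSpace ℝ (Fin n) =>
      p.1 ^ (ℓ - 1) * poincareIntegrand m θ f x p.1 p.2 * (1 / (1 - p.1) ^ n))
    ((volume.restrict (Set.Ioo (0 : ℝ) 1)).prod volume)

/-- `g` is the weak partial derivative `∂_j u` on the open set `Ω`. -/
def HasWeakPartialD {n : ℕ} (Ω : Set (EuclideanSpace ℝ (Fin n))) (j : Fin n)
    (u g : EuclideanSpace ℝ (Fin n) → ℝ) : Prop :=
  LocallyIntegrableOn u Ω ∧ LocallyIntegrableOn g Ω ∧
    ∀ φ : EuclideanSpace ℝ (Fin n) → ℝ, ContDiff ℝ ∞ φ → HasCompactSupport φ → tsupport φ ⊆ Ω →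
      ∫ x in Ω, u x * partialD j φ x = -∫ x in Ω, g x * φ x

/-- `u ∈ H¹(Ω)` with weak gradient `g`: `u` and all `g j = ∂_j u` are in `L²(Ω)`. -/
def IsH1WithGradient {n : ℕ} (Ω : Set (EuclideanSpace ℝ (Fin n)))
    (u : EuclideanSpace ℝ (Fin n) → ℝ) (g : Fin n → EuclideanSpace ℝ (Fin n) → ℝ) : Prop :=
  MemLp u 2 (volume.restrict Ω) ∧
    ∀ j, MemLp (g j) 2 (volume.restrict Ω) ∧ HasWeakPartialD Ω j u (g j)

/-- `‖u‖_{L²(Ω)}` (for `u ∈ L²(Ω)`). -/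
noncomputable def l2Norm {n : ℕ} (Ω : Set (EuclideanSpace ℝ (Fin n)))
    (u : EuclideanSpace ℝ (Fin n) → ℝ) : ℝ :=
  (eLpNorm u 2 (volume.restrict Ω)).toReal

/-- The factor `κ`, as a function of `V = |Ω| / |B|`. -/
noncomputable def kappa (n ℓ : ℕ) (V : ℝ) : ℝ :=
  if n < 2 * ℓ then 1
  else if 2 * ℓ + 1 = n ∨ 2 * ℓ = n then
    1 + V ^ (((n : ℝ) - 2 * ℓ) / (2 * ((n : ℝ) - ℓ))) *
      Real.log V ^ ((n : ℝ) / (2 * ((n : ℝ) - ℓ)))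
  else
    1 + V ^ (((n : ℝ) - 2 * ℓ) / (2 * ((n : ℝ) - ℓ))) *
      Real.log V ^ ((n : ℝ) / (2 * ((n : ℝ) - ℓ - 1)))

/-! The weak gradient is obtained by duality: it suffices to bound `∫_Ω P f ∂_jφ` by a multiple of
`‖f‖ ‖φ‖` for test functions `φ` on `Ω`, and the Riesz theorem then supplies the derivative
(`exists_hasWeakPartialD`). Write `w = x + (y - x)/(1 - s)`, so that `y = s x + (1 - s) w` and `(x_m
- y_m)/(1 - s) = x_m - w_m`. Integrating by parts in `x` for fixed `s` and `y` moves `∂_j` onto the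
kernel. Its derivative is `δ_jm θ(w)` plus `s/(1 - s)` times `∂_j((w_m - c_m)θ)(w) - (x_m - c_m)
∂_jθ(w)`, where `c` is the centre of the ball (`partialD_kernel`). The singular factor therefore
only meets bumps of vanishing integral. The factor `x_m - c_m` is at most `R` on `Ω` while `∂_jθ`
has `L¹` norm of order `1/ρ`, which produces `R/ρ`.

Everything is thus reduced to the forms `segForm s ψ F φ`, estimated in two ranges of `s`.

Near `s = 1` the vanishing integral must compensate `1/(1 - s)`. On the Fourier side the form is the
integral of `F̂(ξ) ψ̌((1-s)ξ) φ̌(sξ)`. Cancellation at low frequencies and one derivative at high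
frequencies give `|ψ̌(η)| ≲ A ρ|η|/(1 + (ρ|η|)²)`. After division by `1 - s` this bound has an
integral in `s` that is bounded uniformly in `ξ`, so a weighted Cauchy–Schwarz inequality and
Plancherel finish (`IsMeanZeroBump.setLIntegral_enorm_segForm_le`).

Away from `s = 1` the Schur test is used. Integration in `y` costs `‖ψ‖₁`; integration in `x` over
`Ω` costs either `s⁻ⁿ ‖ψ‖₁` or `‖ψ‖_∞ |Ω| (1 - s)⁻ⁿ`. Interpolating with a parameter `l` gives the
bound `s^{-nl/2} V^{(1-l)/2}` with `V = |Ω|/|B|`, up to constants. Its integral against `s^{ℓ-1}`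
converges for `nl < 2ℓ`, and a suitable `l` yields `κ` (`exists_interpolation_exponent`). -/

open scoped ENNReal

/-! ### Weighted Cauchy–Schwarz and the Schur test -/

section Schur

variable {X Y : Type*} [MeasurableSpace X] [MeasurableSpace Y]

/-- Cauchy–Schwarz with a weight. -/
theorem lintegral_weight_mul_mul_le {μ : Measure X} {k F G : X → ℝ≥0∞} (hk : AEMeasurable k μ)
    (hF : AEMeasurable F μ) (hG : AEMeasurable G μ) :
    ∫⁻ x, k x * (F x * G x) ∂μ ≤
      (∫⁻ x, k x * F x ^ 2 ∂μ) ^ (1 / 2 : ℝ) * (∫⁻ x, k x * G x ^ 2 ∂μ) ^ (1 / 2 : ℝ) := by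
  refine le_trans (le_of_eq ?_) (ENNReal.lintegral_mul_norm_pow_le (μ := μ)
    (hk.mul (hF.pow_const 2)) (hk.mul (hG.pow_const 2)) (by norm_num : (0 : ℝ) ≤ 1 / 2)
    (by norm_num) (by norm_num))
  refine lintegral_congr fun x => ?_
  have h2 : ∀ a : ℝ≥0∞, (a ^ 2) ^ (1 / 2 : ℝ) = a := fun a => by
    rw [← ENNReal.rpow_natCast, ← ENNReal.rpow_mul]; norm_num
  have h3 : ∀ a : ℝ≥0∞, a ^ (1 / 2 : ℝ) * a ^ (1 / 2 : ℝ) = a := fun a => by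
    rw [← ENNReal.rpow_add_of_nonneg _ _ (by norm_num) (by norm_num)]; norm_num
  simp only [Pi.mul_apply]
  rw [ENNReal.mul_rpow_of_nonneg _ _ (by norm_num), ENNReal.mul_rpow_of_nonneg _ _ (by norm_num),
    h2, h2]
  calc k x * (F x * G x) = (k x ^ (1 / 2 : ℝ) * k x ^ (1 / 2 : ℝ)) * (F x * G x) := by rw [h3]
    _ = _ := by ring

theorem lintegral_mul_sq_le {μ : Measure X} {k F : X → ℝ≥0∞} (hk : AEMeasurable k μ)
    (hF : AEMeasurable F μ) :
    (∫⁻ x, k x * F x ∂μ) ^ 2 ≤ (∫⁻ x, k x ∂μ) * ∫⁻ x, k x * F x ^ 2 ∂μ := by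
  have h := lintegral_weight_mul_mul_le hk hF (G := fun _ => 1) aemeasurable_const
  simp only [mul_one, one_pow] at h
  calc _ ≤ _ := pow_le_pow_left' h 2
    _ = _ := by
      rw [mul_pow, ← ENNReal.rpow_natCast, ← ENNReal.rpow_natCast, ← ENNReal.rpow_mul,
        ← ENNReal.rpow_mul]
      norm_num
      rw [mul_comm]

/-- The Schur test. -/
theorem lintegral_sq_lintegral_mul_le {μ : Measure X} {ν : Measure Y} [SFinite μ] [SFinite ν]
    {k : X → Y → ℝ≥0∞} (hk : Measurable (Function.uncurry k)) {F : Y → ℝ≥0∞} (hF : Measurable F)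
    {A B : ℝ≥0∞} (hA : ∀ᵐ x ∂μ, ∫⁻ y, k x y ∂ν ≤ A) (hB : ∀ᵐ y ∂ν, ∫⁻ x, k x y ∂μ ≤ B) :
    ∫⁻ x, (∫⁻ y, k x y * F y ∂ν) ^ 2 ∂μ ≤ A * (B * ∫⁻ y, F y ^ 2 ∂ν) := by
  have hkx : ∀ x, Measurable (k x) := fun x => hk.comp measurable_prodMk_left
  have hm : Measurable fun p : X × Y => k p.1 p.2 * F p.2 ^ 2 :=
    hk.mul ((hF.comp measurable_snd).pow_const 2)
  calc _ ≤ ∫⁻ x, A * ∫⁻ y, k x y * F y ^ 2 ∂ν ∂μ := by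
        refine lintegral_mono_ae ?_
        filter_upwards [hA] with x hx
        refine (lintegral_mul_sq_le (hkx x).aemeasurable hF.aemeasurable).trans ?_
        gcongr
    _ = A * ∫⁻ y, ∫⁻ x, k x y * F y ^ 2 ∂μ ∂ν := by
        rw [lintegral_const_mul _ hm.lintegral_prod_right', lintegral_lintegral_swap hm.aemeasurable]
    _ ≤ A * ∫⁻ y, B * F y ^ 2 ∂ν := by
        gcongr A * ?_
        refine lintegral_mono_ae ?_
        filter_upwards [hB] with y hy
        have hky : Measurable fun x => k x y := hk.comp measurable_prodMk_right
        rw [lintegral_mul_const _ hky]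
        gcongr
    _ = _ := by rw [lintegral_const_mul _ (hF.pow_const 2)]

/-- The bilinear form of the Schur test. -/
theorem lintegral_lintegral_mul_mul_le {μ : Measure X} {ν : Measure Y} [SFinite μ] [SFinite ν]
    {k : X → Y → ℝ≥0∞} (hk : Measurable (Function.uncurry k)) {φ : X → ℝ≥0∞} (hφ : Measurable φ)
    {F : Y → ℝ≥0∞} (hF : Measurable F)
    {A B : ℝ≥0∞} (hA : ∀ᵐ x ∂μ, ∫⁻ y, k x y ∂ν ≤ A) (hB : ∀ᵐ y ∂ν, ∫⁻ x, k x y ∂μ ≤ B) :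
    ∫⁻ x, φ x * ∫⁻ y, k x y * F y ∂ν ∂μ ≤
      (A * B) ^ (1 / 2 : ℝ) *
        ((∫⁻ y, F y ^ 2 ∂ν) ^ (1 / 2 : ℝ) * (∫⁻ x, φ x ^ 2 ∂μ) ^ (1 / 2 : ℝ)) := by
  have hm : Measurable fun x => ∫⁻ y, k x y * F y ∂ν :=
    (hk.mul (hF.comp measurable_snd)).lintegral_prod_right'
  have h := lintegral_weight_mul_mul_le (μ := μ) (k := fun _ => 1) aemeasurable_const
    hφ.aemeasurable hm.aemeasurable
  simp only [one_mul] at h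
  refine h.trans ?_
  have h2 := ENNReal.rpow_le_rpow (lintegral_sq_lintegral_mul_le hk hF hA hB)
    (by norm_num : (0 : ℝ) ≤ 1 / 2)
  rw [← mul_assoc, ENNReal.mul_rpow_of_nonneg (A * B) _ (by norm_num)] at h2
  rw [← mul_assoc, mul_comm]
  gcongr

theorem eLpNorm_two_eq {V : Type*} [NormedAddCommGroup V] (μ : Measure X) (f : X → V) :
    eLpNorm f 2 μ = (∫⁻ x, ‖f x‖ₑ ^ 2 ∂μ) ^ (1 / 2 : ℝ) := by
  rw [eLpNorm_eq_lintegral_rpow_enorm_toReal (by norm_num) (by norm_num)]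
  simp

end Schur

/-! ### The change of variables between `y`, `x` and the end point `w` -/

section Affine

variable {n : ℕ}

theorem lintegral_comp_add_smul (f : EuclideanSpace ℝ (Fin n) → ℝ≥0∞)
    (a : EuclideanSpace ℝ (Fin n)) {r : ℝ} (hr : r ≠ 0) :
    ∫⁻ x, f (a + r • x) = ENNReal.ofReal (|r|⁻¹ ^ n) * ∫⁻ x, f x := by
  have e : ∫⁻ x, f (a + r • x) =
      ∫⁻ y, f (a + y) ∂(Measure.map (fun x => r • x) (volume : Measure (EuclideanSpace ℝ (Fin n)))) :=
    ((Homeomorph.smul (Units.mk0 r hr)).toMeasurableEquiv.measurableEmbedding.lintegral_map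
      (μ := volume) (fun y => f (a + y))).symm
  rw [e, Measure.map_addHaar_smul volume hr, lintegral_smul_measure, lintegral_add_left_eq_self]
  simp [abs_inv, abs_pow]

/-- The point `w` with `y = s x + (1 - s) w`. -/
noncomputable def segEnd (x : EuclideanSpace ℝ (Fin n)) (s : ℝ) (y : EuclideanSpace ℝ (Fin n)) :
    EuclideanSpace ℝ (Fin n) :=
  x + (1 - s)⁻¹ • (y - x)

theorem segEnd_eq_left (x : EuclideanSpace ℝ (Fin n)) (s : ℝ) (y : EuclideanSpace ℝ (Fin n)) :
    segEnd x s y = (x - (1 - s)⁻¹ • x) + (1 - s)⁻¹ • y := by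
  rw [segEnd, smul_sub]; abel

/-- As a function of `x` alone the end point is a dilation of ratio `-s/(1 - s)`. This is the source
of the `s⁻ⁿ` growth of column integrals and of the factor `s/(1 - s)` in the derivative. -/
theorem segEnd_eq_right (x : EuclideanSpace ℝ (Fin n)) {s : ℝ} (hs : s < 1)
    (y : EuclideanSpace ℝ (Fin n)) :
    segEnd x s y = (1 - s)⁻¹ • y + (-(s * (1 - s)⁻¹)) • x := by
  have h : 1 - s ≠ 0 := by linarith
  have : -(s * (1 - s)⁻¹) = 1 - (1 - s)⁻¹ := by field_simp; ring
  rw [this, segEnd, smul_sub, sub_smul, one_smul]; abel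

theorem smul_add_smul_segEnd (x : EuclideanSpace ℝ (Fin n)) {s : ℝ} (hs : s < 1)
    (y : EuclideanSpace ℝ (Fin n)) : s • x + (1 - s) • segEnd x s y = y := by
  have h : 1 - s ≠ 0 := by linarith
  rw [segEnd, smul_add, smul_smul, mul_inv_cancel₀ h, sub_smul, one_smul, one_smul]; abel

theorem measurable_segEnd :
    Measurable fun p : EuclideanSpace ℝ (Fin n) × ℝ × EuclideanSpace ℝ (Fin n) =>
      segEnd p.1 p.2.1 p.2.2 := by
  unfold segEnd; fun_prop

theorem continuous_segEnd (s : ℝ) :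
    Continuous fun p : EuclideanSpace ℝ (Fin n) × EuclideanSpace ℝ (Fin n) =>
      segEnd p.1 s p.2 := by
  unfold segEnd; fun_prop

/-- The kernel `|ψ(x + (y - x)/(1 - s))| / (1 - s)^n`. -/
noncomputable def segKernel (ψ : EuclideanSpace ℝ (Fin n) → ℝ) (s : ℝ)
    (x y : EuclideanSpace ℝ (Fin n)) : ℝ≥0∞ :=
  ‖ψ (segEnd x s y)‖ₑ * ENNReal.ofReal (1 / (1 - s) ^ n)

theorem measurable_segKernel {ψ : EuclideanSpace ℝ (Fin n) → ℝ} (hψ : Measurable ψ) :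
    Measurable fun p : EuclideanSpace ℝ (Fin n) × ℝ × EuclideanSpace ℝ (Fin n) =>
      segKernel ψ p.2.1 p.1 p.2.2 := by
  unfold segKernel
  exact (hψ.comp measurable_segEnd).enorm.mul (by fun_prop)

theorem measurable_segKernel_fixed {ψ : EuclideanSpace ℝ (Fin n) → ℝ} (hψ : Measurable ψ) (s : ℝ) :
    Measurable (Function.uncurry (segKernel ψ s)) := by
  unfold segKernel Function.uncurry
  exact (hψ.comp (continuous_segEnd s).measurable).enorm.mul_const _

/-- The Jacobian of `y ↦ w` is cancelled exactly by the normalisation `(1 - s)⁻ⁿ`, so rows are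
bounded uniformly in `s`. -/
theorem lintegral_segKernel_right (ψ : EuclideanSpace ℝ (Fin n) → ℝ) {s : ℝ} (hs : s < 1)
    (x : EuclideanSpace ℝ (Fin n)) : ∫⁻ y, segKernel ψ s x y = ∫⁻ w, ‖ψ w‖ₑ := by
  have h : 0 < 1 - s := by linarith
  unfold segKernel
  rw [lintegral_mul_const' _ _ ENNReal.ofReal_ne_top]
  simp_rw [segEnd_eq_left]
  rw [lintegral_comp_add_smul (fun w => ‖ψ w‖ₑ) _ (inv_ne_zero h.ne'), mul_right_comm,
    ← ENNReal.ofReal_mul (by positivity), abs_of_pos (by positivity), inv_inv]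
  rw [mul_one_div_cancel (by positivity)]
  simp

/-- Here the Jacobian is `((1 - s)/s)ⁿ`, and the normalisation leaves `s⁻ⁿ`, harmless near `s = 1`
but not near `s = 0`. -/
theorem lintegral_segKernel_left (ψ : EuclideanSpace ℝ (Fin n) → ℝ) {s : ℝ} (h0 : 0 < s)
    (hs : s < 1) (y : EuclideanSpace ℝ (Fin n)) :
    ∫⁻ x, segKernel ψ s x y = ENNReal.ofReal (s⁻¹ ^ n) * ∫⁻ w, ‖ψ w‖ₑ := by
  have h : 0 < 1 - s := by linarith
  unfold segKernel
  rw [lintegral_mul_const' _ _ ENNReal.ofReal_ne_top]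
  simp_rw [segEnd_eq_right _ hs]
  rw [lintegral_comp_add_smul (fun w => ‖ψ w‖ₑ) _ (neg_ne_zero.2 (by positivity)), mul_right_comm,
    ← ENNReal.ofReal_mul (by positivity), abs_neg, abs_of_pos (by positivity)]
  congr 3
  rw [mul_inv, inv_inv, mul_pow, mul_assoc, mul_one_div_cancel (by positivity), mul_one]

/-- The substitute for the `s⁻ⁿ` bound when `s` is small: it uses only the sup norm and the volume
of `Ω`. -/
theorem setLIntegral_segKernel_left_le {ψ : EuclideanSpace ℝ (Fin n) → ℝ} {M : ℝ}
    (hM : ∀ w, |ψ w| ≤ M) (Ω : Set (EuclideanSpace ℝ (Fin n))) (s : ℝ)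
    (y : EuclideanSpace ℝ (Fin n)) :
    ∫⁻ x in Ω, segKernel ψ s x y ≤
      ENNReal.ofReal M * ENNReal.ofReal (1 / (1 - s) ^ n) * volume Ω := by
  rw [← setLIntegral_const]
  refine lintegral_mono fun x => ?_
  unfold segKernel
  gcongr
  rw [Real.enorm_eq_ofReal_abs]
  exact ENNReal.ofReal_le_ofReal (hM _)

end Affine

/-! ### The bilinear form at fixed `s`: Schur bound, continuity, interpolation -/

section Form

variable {n : ℕ}

theorem integral_comp_segEnd {V : Type*} [NormedAddCommGroup V] [NormedSpace ℝ V]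
    (g : EuclideanSpace ℝ (Fin n) → V) (x : EuclideanSpace ℝ (Fin n)) {s : ℝ} (hs : s < 1) :
    ∫ y, g (segEnd x s y) = (1 - s) ^ n • ∫ w, g w := by
  have h : 0 < 1 - s := by linarith
  simp_rw [segEnd_eq_left]
  rw [Measure.integral_comp_smul volume (fun y => g (x - (1 - s)⁻¹ • x + y)) (1 - s)⁻¹,
    integral_add_left_eq_self g, finrank_euclideanSpace_fin, abs_of_pos (by positivity), inv_pow,
    inv_inv]

/-- The bilinear form `∫ φ(x) ψ(x + (y - x)/(1 - s)) F(y) dx dy / (1 - s)^n`. -/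
noncomputable def segForm (s : ℝ) (ψ F φ : EuclideanSpace ℝ (Fin n) → ℝ) : ℝ :=
  ∫ p : EuclideanSpace ℝ (Fin n) × EuclideanSpace ℝ (Fin n),
    φ p.1 * (ψ (segEnd p.1 s p.2) * F p.2 * (1 / (1 - s) ^ n))

theorem measurable_segForm_integrand {ψ F φ : EuclideanSpace ℝ (Fin n) → ℝ} (hψ : Measurable ψ)
    (hF : Measurable F) (hφ : Measurable φ) (s : ℝ) :
    Measurable fun p : EuclideanSpace ℝ (Fin n) × EuclideanSpace ℝ (Fin n) =>
      φ p.1 * (ψ (segEnd p.1 s p.2) * F p.2 * (1 / (1 - s) ^ n)) :=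
  (hφ.comp measurable_fst).mul (((hψ.comp (continuous_segEnd s).measurable).mul
    (hF.comp measurable_snd)).mul_const _)

theorem lintegral_enorm_segForm_integrand {ψ F φ : EuclideanSpace ℝ (Fin n) → ℝ}
    (hψ : Measurable ψ) (hF : Measurable F) (hφ : Measurable φ) {s : ℝ} (hs : s < 1) :
    ∫⁻ p : EuclideanSpace ℝ (Fin n) × EuclideanSpace ℝ (Fin n),
      ‖φ p.1 * (ψ (segEnd p.1 s p.2) * F p.2 * (1 / (1 - s) ^ n))‖ₑ =
    ∫⁻ x, ‖φ x‖ₑ * ∫⁻ y, segKernel ψ s x y * ‖F y‖ₑ := by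
  have h : 0 < 1 - s := by linarith
  rw [Measure.volume_eq_prod, lintegral_prod _
    (measurable_segForm_integrand hψ hF hφ s).enorm.aemeasurable]
  refine lintegral_congr fun x => ?_
  rw [← lintegral_const_mul' _ _ enorm_ne_top]
  refine lintegral_congr fun y => ?_
  rw [enorm_mul, enorm_mul, enorm_mul, segKernel,
    Real.enorm_of_nonneg (show (0 : ℝ) ≤ 1 / (1 - s) ^ n by positivity)]
  ring

/-- The support of `φ` restricts the `x` integration to `Ω`, so the Schur test may use whichever of
the two column bounds is smaller. -/
theorem lintegral_segKernel_form_le {ψ F φ : EuclideanSpace ℝ (Fin n) → ℝ} (hψ : Measurable ψ)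
    (hF : Measurable F) (hφ : Measurable φ) {Ω : Set (EuclideanSpace ℝ (Fin n))}
    (hΩ : MeasurableSet Ω) (hφΩ : ∀ x, x ∉ Ω → φ x = 0) {s : ℝ} (h0 : 0 < s) (hs : s < 1)
    {A M : ℝ} (hA : ∫⁻ w, ‖ψ w‖ₑ ≤ ENNReal.ofReal A) (hM : ∀ w, |ψ w| ≤ M) {B : ℝ≥0∞}
    (hB : min (ENNReal.ofReal (s⁻¹ ^ n) * ENNReal.ofReal A)
      (ENNReal.ofReal M * ENNReal.ofReal (1 / (1 - s) ^ n) * volume Ω) ≤ B) :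
    ∫⁻ x, ‖φ x‖ₑ * ∫⁻ y, segKernel ψ s x y * ‖F y‖ₑ ≤
      (ENNReal.ofReal A * B) ^ (1 / 2 : ℝ) * (eLpNorm F 2 volume * eLpNorm φ 2 volume) := by
  have e : ∫⁻ x, ‖φ x‖ₑ * ∫⁻ y, segKernel ψ s x y * ‖F y‖ₑ =
      ∫⁻ x in Ω, ‖φ x‖ₑ * ∫⁻ y, segKernel ψ s x y * ‖F y‖ₑ := by
    rw [← lintegral_indicator hΩ]
    refine lintegral_congr fun x => ?_
    by_cases hx : x ∈ Ω
    · simp [hx]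
    · simp [hx, hφΩ x hx]
  rw [e, eLpNorm_two_eq, eLpNorm_two_eq]
  refine (lintegral_lintegral_mul_mul_le (μ := volume.restrict Ω) (ν := volume)
    (measurable_segKernel_fixed hψ s) hφ.enorm hF.enorm (A := ENNReal.ofReal A) (B := B)
    (ae_of_all _ fun x => ?_) (ae_of_all _ fun y => ?_)).trans ?_
  · rw [lintegral_segKernel_right ψ hs]; exact hA
  · refine le_trans (le_min ?_ (setLIntegral_segKernel_left_le hM Ω s y)) hB
    refine (setLIntegral_le_lintegral _ _).trans ?_
    rw [lintegral_segKernel_left ψ h0 hs]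
    gcongr
  · gcongr
    exact Measure.restrict_le_self

theorem enorm_segForm_le {ψ F φ : EuclideanSpace ℝ (Fin n) → ℝ}
    (hψ : Measurable ψ) (hF : Measurable F) (hφ : Measurable φ) {s : ℝ} (hs : s < 1) :
    ‖segForm s ψ F φ‖ₑ ≤ ∫⁻ x, ‖φ x‖ₑ * ∫⁻ y, segKernel ψ s x y * ‖F y‖ₑ := by
  rw [← lintegral_enorm_segForm_integrand hψ hF hφ hs]
  exact enorm_integral_le_lintegral_enorm _

/-- A qualitative version for each fixed `s`, free of any support condition on `φ`; it serves
integrability and continuity in `F`. -/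
theorem lintegral_segKernel_form_le_univ {ψ F φ : EuclideanSpace ℝ (Fin n) → ℝ}
    (hψ : Measurable ψ) (hF : Measurable F) (hφ : Measurable φ) {s : ℝ} (h0 : 0 < s) (hs : s < 1)
    {A : ℝ} (hA : ∫⁻ w, ‖ψ w‖ₑ ≤ ENNReal.ofReal A) :
    ∫⁻ x, ‖φ x‖ₑ * ∫⁻ y, segKernel ψ s x y * ‖F y‖ₑ ≤
      (ENNReal.ofReal A * (ENNReal.ofReal (s⁻¹ ^ n) * ENNReal.ofReal A)) ^ (1 / 2 : ℝ) *
        (eLpNorm F 2 volume * eLpNorm φ 2 volume) := by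
  rw [eLpNorm_two_eq, eLpNorm_two_eq]
  refine lintegral_lintegral_mul_mul_le (μ := volume) (ν := volume)
    (measurable_segKernel_fixed hψ s) hφ.enorm hF.enorm (A := ENNReal.ofReal A)
    (ae_of_all _ fun x => ?_) (ae_of_all _ fun y => ?_)
  · rw [lintegral_segKernel_right ψ hs]; exact hA
  · rw [lintegral_segKernel_left ψ h0 hs]
    gcongr

theorem integrable_segForm_integrand {ψ F φ : EuclideanSpace ℝ (Fin n) → ℝ}
    (hψ : Measurable ψ) (hψi : Integrable ψ) (hF : Measurable F) (hF2 : MemLp F 2 volume)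
    (hφ : Measurable φ) (hφ2 : MemLp φ 2 volume) {s : ℝ} (h0 : 0 < s) (hs : s < 1) :
    Integrable fun p : EuclideanSpace ℝ (Fin n) × EuclideanSpace ℝ (Fin n) =>
      φ p.1 * (ψ (segEnd p.1 s p.2) * F p.2 * (1 / (1 - s) ^ n)) := by
  refine ⟨(measurable_segForm_integrand hψ hF hφ s).aestronglyMeasurable, ?_⟩
  rw [hasFiniteIntegral_iff_enorm, lintegral_enorm_segForm_integrand hψ hF hφ hs]
  refine (lintegral_segKernel_form_le_univ hψ hF hφ h0 hs
    (A := (∫⁻ w, ‖ψ w‖ₑ).toReal) (ENNReal.ofReal_toReal hψi.2.ne).ge).trans_lt ?_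
  refine ENNReal.mul_lt_top (ENNReal.rpow_lt_top_of_nonneg (by norm_num) ?_)
    (ENNReal.mul_lt_top hF2.2 hφ2.2)
  finiteness

/-- The substitution `y = s x + (1 - s) w` at fixed `x` turns the form into an average of `F` over
dilates, the shape needed for the Fourier transform. -/
theorem segForm_eq_iterated {ψ F φ : EuclideanSpace ℝ (Fin n) → ℝ}
    (hψ : Measurable ψ) (hψi : Integrable ψ) (hF : Measurable F) (hF2 : MemLp F 2 volume)
    (hφ : Measurable φ) (hφ2 : MemLp φ 2 volume) {s : ℝ} (h0 : 0 < s) (hs : s < 1) :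
    segForm s ψ F φ = ∫ x, φ x * ∫ w, ψ w * F (s • x + (1 - s) • w) := by
  have h : 0 < 1 - s := by linarith
  have hi := integrable_segForm_integrand hψ hψi hF hF2 hφ hφ2 h0 hs
  rw [segForm]
  rw [Measure.volume_eq_prod] at hi ⊢
  rw [integral_prod _ hi]
  refine integral_congr_ae (ae_of_all _ fun x => ?_)
  have h2 := integral_comp_segEnd (fun w => ψ w * F (s • x + (1 - s) • w)) x hs
  simp only [smul_add_smul_segEnd x hs, smul_eq_mul] at h2
  simp only
  rw [integral_const_mul, integral_mul_const, h2]
  field_simp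

theorem segForm_sub {ψ F G φ : EuclideanSpace ℝ (Fin n) → ℝ}
    (hψ : Measurable ψ) (hψi : Integrable ψ) (hF : Measurable F) (hF2 : MemLp F 2 volume)
    (hG : Measurable G) (hG2 : MemLp G 2 volume)
    (hφ : Measurable φ) (hφ2 : MemLp φ 2 volume) {s : ℝ} (h0 : 0 < s) (hs : s < 1) :
    segForm s ψ (F - G) φ = segForm s ψ F φ - segForm s ψ G φ := by
  rw [segForm, segForm, segForm, ← integral_sub
    (integrable_segForm_integrand hψ hψi hF hF2 hφ hφ2 h0 hs)
    (integrable_segForm_integrand hψ hψi hG hG2 hφ hφ2 h0 hs)]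
  refine integral_congr_ae (ae_of_all _ fun p => ?_)
  simp only [Pi.sub_apply]
  ring

theorem tendsto_segForm {ψ F φ : EuclideanSpace ℝ (Fin n) → ℝ}
    {G : ℕ → EuclideanSpace ℝ (Fin n) → ℝ}
    (hψ : Measurable ψ) (hψi : Integrable ψ) (hF : Measurable F) (hF2 : MemLp F 2 volume)
    (hG : ∀ k, Measurable (G k)) (hG2 : ∀ k, MemLp (G k) 2 volume)
    (hφ : Measurable φ) (hφ2 : MemLp φ 2 volume) {s : ℝ} (h0 : 0 < s) (hs : s < 1)
    (hlim : Filter.Tendsto (fun k => eLpNorm (F - G k) 2 volume) Filter.atTop (nhds 0)) :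
    Filter.Tendsto (fun k => segForm s ψ (G k) φ) Filter.atTop (nhds (segForm s ψ F φ)) := by
  set A : ℝ := (∫⁻ w, ‖ψ w‖ₑ).toReal
  set K := (ENNReal.ofReal A * (ENNReal.ofReal (s⁻¹ ^ n) * ENNReal.ofReal A)) ^ (1 / 2 : ℝ)
  have hK : K ≠ ⊤ := (ENNReal.rpow_lt_top_of_nonneg (by norm_num) (by finiteness)).ne
  have hb : ∀ k, edist (segForm s ψ (G k) φ) (segForm s ψ F φ) ≤
      K * (eLpNorm (F - G k) 2 volume * eLpNorm φ 2 volume) := fun k => by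
    rw [edist_comm, edist_eq_enorm_sub, ← segForm_sub hψ hψi hF hF2 (hG k) (hG2 k) hφ hφ2 h0 hs]
    exact (enorm_segForm_le hψ (hF.sub (hG k)) hφ hs).trans
      (lintegral_segKernel_form_le_univ hψ (hF.sub (hG k)) hφ h0 hs
        (ENNReal.ofReal_toReal hψi.2.ne).ge)
  rw [tendsto_iff_edist_tendsto_0]
  refine tendsto_of_tendsto_of_tendsto_of_le_of_le tendsto_const_nhds ?_ (fun _ => zero_le) hb
  have h1 := ENNReal.Tendsto.mul_const (b := eLpNorm φ 2 volume) hlim (Or.inr hφ2.2.ne)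
  have h2 := ENNReal.Tendsto.const_mul (a := K) h1 (Or.inr hK)
  simpa using h2

/-- For `s ≤ 1/2` the factor `(1 - s)⁻ⁿ` is at most `2ⁿ`, and a minimum is bounded by a weighted
geometric mean. For `s > 1/2` already `s⁻ⁿ ≤ 2ⁿ`, while both factors on the right are at least one.
-/
theorem interpolation_min_le {s W l : ℝ} (h0 : 0 < s) (hs : s < 1) (hW : 1 ≤ W) (hl0 : 0 ≤ l)
    (hl1 : l ≤ 1) :
    min (s⁻¹ ^ n) (1 / (1 - s) ^ n * W) ≤ 2 ^ n * ((s⁻¹ ^ n) ^ l * W ^ (1 - l)) := by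
  have hx : (1 : ℝ) ≤ s⁻¹ ^ n := one_le_pow₀ ((one_le_inv₀ h0).2 hs.le)
  have h1 : 1 ≤ (s⁻¹ ^ n) ^ l := Real.one_le_rpow hx hl0
  have h2 : 1 ≤ W ^ (1 - l) := Real.one_le_rpow hW (by linarith)
  have h12 : 1 ≤ (s⁻¹ ^ n) ^ l * W ^ (1 - l) := by nlinarith
  have hsplit : ∀ a : ℝ, 0 < a → a = a ^ l * a ^ (1 - l) := fun a ha => by
    rw [← Real.rpow_add ha]; simp
  by_cases h : s ≤ 1 / 2
  · have h3 : (1 / (1 - s) ^ n : ℝ) ≤ 2 ^ n := by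
      rw [← one_div_pow]
      refine pow_le_pow_left₀ (by positivity) ?_ n
      rw [div_le_iff₀ (by linarith)]; linarith
    rcases le_total (s⁻¹ ^ n) W with h4 | h4
    · refine (min_le_left _ _).trans ?_
      have : s⁻¹ ^ n ≤ (s⁻¹ ^ n) ^ l * W ^ (1 - l) := by
        conv_lhs => rw [hsplit (s⁻¹ ^ n) (by positivity)]
        gcongr
      exact this.trans (le_mul_of_one_le_left (by positivity) (one_le_pow₀ (by norm_num)))
    · refine (min_le_right _ _).trans ?_
      have : W ≤ (s⁻¹ ^ n) ^ l * W ^ (1 - l) := by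
        conv_lhs => rw [hsplit W (by positivity)]
        gcongr
      gcongr
  · refine (min_le_left _ _).trans ?_
    have : s⁻¹ ^ n ≤ (2 : ℝ) ^ n := by
      refine pow_le_pow_left₀ (by positivity) ?_ n
      rw [inv_le_comm₀ h0 (by norm_num)]; linarith
    exact this.trans (le_mul_of_one_le_right (by positivity) h12)

/-- The column bound is `A` times the interpolated minimum; the square root in the Schur test halves
the exponents `l` and `1 - l`. -/
theorem enorm_segForm_le_interpolation {ψ F φ : EuclideanSpace ℝ (Fin n) → ℝ} (hψ : Measurable ψ)
    (hF : Measurable F) (hφ : Measurable φ) {Ω : Set (EuclideanSpace ℝ (Fin n))}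
    (hΩ : MeasurableSet Ω) (hφΩ : ∀ x, x ∉ Ω → φ x = 0) {s : ℝ} (h0 : 0 < s) (hs : s < 1)
    {A D W l : ℝ} (hA0 : 0 ≤ A) (hA : ∫⁻ w, ‖ψ w‖ₑ ≤ ENNReal.ofReal A)
    (hD : ∀ w, |ψ w| ≤ A * D) (hW : 1 ≤ W) (hDW : ENNReal.ofReal D * volume Ω ≤ ENNReal.ofReal W)
    (hl0 : 0 ≤ l) (hl1 : l ≤ 1) :
    ‖segForm s ψ F φ‖ₑ ≤
      ENNReal.ofReal (A * (2 ^ n * ((s⁻¹ ^ n) ^ (l / 2) * W ^ ((1 - l) / 2)))) *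
        (eLpNorm F 2 volume * eLpNorm φ 2 volume) := by
  have h : 0 < 1 - s := by linarith
  have hW0 : 0 < W := by linarith
  refine (enorm_segForm_le hψ hF hφ hs).trans ?_
  refine (lintegral_segKernel_form_le hψ hF hφ hΩ hφΩ h0 hs hA hD
    (B := ENNReal.ofReal A * ENNReal.ofReal (2 ^ n * ((s⁻¹ ^ n) ^ l * W ^ (1 - l)))) ?_).trans ?_
  · have e : ENNReal.ofReal (A * D) * ENNReal.ofReal (1 / (1 - s) ^ n) * volume Ω ≤
        ENNReal.ofReal A * ENNReal.ofReal (1 / (1 - s) ^ n * W) := by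
      rw [ENNReal.ofReal_mul hA0, ENNReal.ofReal_mul (by positivity)]
      calc _ = ENNReal.ofReal A * (ENNReal.ofReal (1 / (1 - s) ^ n) *
            (ENNReal.ofReal D * volume Ω)) := by ring
        _ ≤ _ := by gcongr
    refine (min_le_min (le_of_eq (mul_comm _ _)) e).trans ?_
    rcases min_le_iff.1 (interpolation_min_le (n := n) h0 hs hW hl0 hl1) with h1 | h1
    · exact (min_le_left _ _).trans (by gcongr)
    · exact (min_le_right _ _).trans (by gcongr)
  · gcongr
    rw [← ENNReal.ofReal_mul hA0, ← ENNReal.ofReal_mul hA0,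
      ENNReal.ofReal_rpow_of_nonneg (by positivity) (by norm_num)]
    refine ENNReal.ofReal_le_ofReal ?_
    rw [← Real.sqrt_eq_rpow]
    refine Real.sqrt_le_iff.2 ⟨by positivity, ?_⟩
    have e1 : ∀ a : ℝ, 0 ≤ a → ∀ b : ℝ, (a ^ (b / 2)) ^ 2 = a ^ b := fun a ha b => by
      rw [← Real.rpow_natCast, ← Real.rpow_mul ha]; norm_num
    rw [mul_pow, mul_pow, mul_pow, e1 _ (by positivity), e1 _ hW0.le]
    -- The square root would give `2^{n/2}`; the weaker `2ⁿ` avoids a fractional power.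
    have h2 : (2 : ℝ) ^ n ≤ (2 ^ n) ^ 2 := le_self_pow₀ (one_le_pow₀ (by norm_num)) (by norm_num)
    calc _ = A ^ 2 * (2 ^ n * ((s⁻¹ ^ n) ^ l * W ^ (1 - l))) := by ring
      _ ≤ _ := by gcongr

end Form

/-! ### Fourier decay of mean-zero bumps and the Fourier form of the averages -/

section FourierBounds

open FourierTransform SchwartzMap
open scoped FourierTransform SchwartzMap

variable {n : ℕ}

theorem norm_fourierChar_sub_le (a b : ℝ) :
    ‖((Real.fourierChar a : Circle) : ℂ) - (Real.fourierChar b : Circle)‖ ≤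
      2 * Real.pi * |a - b| := by
  rw [Real.fourierChar_apply, Real.fourierChar_apply]
  have e : Complex.exp (((2 * Real.pi * a : ℝ) : ℂ) * Complex.I) -
      Complex.exp (((2 * Real.pi * b : ℝ) : ℂ) * Complex.I) =
      Complex.exp (((2 * Real.pi * b : ℝ) : ℂ) * Complex.I) *
        (Complex.exp (Complex.I * ((2 * Real.pi * (a - b) : ℝ) : ℂ)) - 1) := by
    rw [mul_sub, ← Complex.exp_add, mul_one]
    congr 2
    push_cast
    ring
  rw [e, norm_mul, Complex.norm_exp_ofReal_mul_I, one_mul]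
  refine Real.norm_exp_I_mul_ofReal_sub_one_le.trans ?_
  rw [Real.norm_eq_abs, abs_mul, abs_of_pos (by positivity)]

/-- A smooth function supported in the closed ball of radius `ρ` around `c`, with vanishing
integral, and with `L¹` bounds of the size `A`. -/
structure IsMeanZeroBump (c : EuclideanSpace ℝ (Fin n)) (ρ A : ℝ)
    (ψ : EuclideanSpace ℝ (Fin n) → ℝ) : Prop where
  contDiff : ContDiff ℝ ∞ ψ
  hasCompactSupport : HasCompactSupport ψ
  dist_le : ∀ w, ψ w ≠ 0 → ‖w - c‖ ≤ ρ
  integral_eq_zero : ∫ w, ψ w = 0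
  l1_bound : ∫ w, |ψ w| ≤ A
  l1_deriv_bound : ∀ k, ∫ w, |partialD k ψ w| ≤ A / ρ

/-- A real test function as a complex Schwartz function. -/
noncomputable def toComplexSchwartz {ψ : EuclideanSpace ℝ (Fin n) → ℝ} (h : ContDiff ℝ ∞ ψ)
    (hc : HasCompactSupport ψ) : 𝓢(EuclideanSpace ℝ (Fin n), ℂ) :=
  HasCompactSupport.toSchwartzMap (f := fun x => (ψ x : ℂ))
    (hc.comp_left (g := fun a : ℝ => (a : ℂ)) (by simp)) (Complex.ofRealCLM.contDiff.comp h)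

theorem toComplexSchwartz_apply {ψ : EuclideanSpace ℝ (Fin n) → ℝ} (h : ContDiff ℝ ∞ ψ)
    (hc : HasCompactSupport ψ) (x : EuclideanSpace ℝ (Fin n)) :
    toComplexSchwartz h hc x = (ψ x : ℂ) := rfl

theorem norm_fourierInv_le_integral_norm (f : 𝓢(EuclideanSpace ℝ (Fin n), ℂ))
    (ξ : EuclideanSpace ℝ (Fin n)) : ‖𝓕⁻ f ξ‖ ≤ ∫ w, ‖f w‖ := by
  rw [fourierInv_coe, Real.fourierInv_eq]
  refine (norm_integral_le_integral_norm _).trans (le_of_eq ?_)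
  simp only [Circle.norm_smul]

/-- Since `ψ` has integral zero, the character may be replaced by its difference from the value at
`c`; on the support this difference is at most `2π ρ ‖ξ‖`. -/
theorem IsMeanZeroBump.norm_fourierInv_le_mul {c : EuclideanSpace ℝ (Fin n)} {ρ A : ℝ}
    (hρ : 0 < ρ) {ψ : EuclideanSpace ℝ (Fin n) → ℝ} (h : IsMeanZeroBump c ρ A ψ)
    (ξ : EuclideanSpace ℝ (Fin n)) :
    ‖𝓕⁻ (toComplexSchwartz h.contDiff h.hasCompactSupport) ξ‖ ≤
      2 * Real.pi * A * (ρ * ‖ξ‖) := by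
  have hi : Integrable ψ := h.contDiff.continuous.integrable_of_hasCompactSupport
    h.hasCompactSupport
  have e : 𝓕⁻ (toComplexSchwartz h.contDiff h.hasCompactSupport) ξ =
      ∫ w, ((Real.fourierChar (inner ℝ w ξ) : Circle) - (Real.fourierChar (inner ℝ c ξ) : Circle)
        : ℂ) * (ψ w : ℂ) := by
    rw [fourierInv_coe, Real.fourierInv_eq]
    simp only [sub_mul, toComplexSchwartz_apply, Circle.smul_def, smul_eq_mul]
    have h0 : ∫ w, (ψ w : ℂ) = 0 := by
      have := integral_ofReal (𝕜 := ℂ) (f := ψ) (μ := volume)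
      rw [h.integral_eq_zero] at this
      simpa using this
    rw [integral_sub, integral_const_mul, h0, mul_zero, sub_zero]
    · refine hi.ofReal.bdd_mul (c := 1) (by fun_prop) (ae_of_all _ fun w => ?_)
      exact (Circle.norm_coe _).le
    · exact hi.ofReal.const_mul _
  rw [e]
  refine (norm_integral_le_integral_norm _).trans ?_
  calc ∫ w, ‖((Real.fourierChar (inner ℝ w ξ) : Circle) -
        (Real.fourierChar (inner ℝ c ξ) : Circle) : ℂ) * (ψ w : ℂ)‖
      ≤ ∫ w, 2 * Real.pi * (ρ * ‖ξ‖) * |ψ w| := by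
        refine integral_mono_of_nonneg (ae_of_all _ fun w => norm_nonneg _)
          (hi.abs.const_mul _) (ae_of_all _ fun w => ?_)
        simp only [norm_mul, Complex.norm_real, Real.norm_eq_abs]
        by_cases hw : ψ w = 0
        · simp [hw]
        gcongr
        refine (norm_fourierChar_sub_le _ _).trans ?_
        gcongr
        rw [← inner_sub_left]
        refine (abs_real_inner_le_norm _ _).trans ?_
        gcongr
        exact h.dist_le w hw
    _ = 2 * Real.pi * (ρ * ‖ξ‖) * ∫ w, |ψ w| := integral_const_mul _ _
    _ ≤ 2 * Real.pi * (ρ * ‖ξ‖) * A := by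
        gcongr
        exact h.l1_bound
    _ = _ := by ring

theorem EuclideanSpace.norm_le_sum_abs (ξ : EuclideanSpace ℝ (Fin n)) : ‖ξ‖ ≤ ∑ k, |ξ k| := by
  rw [EuclideanSpace.norm_eq]
  refine Real.sqrt_le_iff.2 ⟨by positivity, ?_⟩
  simpa using Finset.sum_sq_le_sq_sum_of_nonneg (s := Finset.univ) (f := fun k => |ξ k|)
    (fun _ _ => abs_nonneg _)

/-- High frequencies: the transform of `∂_kψ` is `2π |ξ_k|` times that of `ψ` in modulus, and it is
bounded by the `L¹` norm `A/ρ`. Summing over `k` dominates `‖ξ‖`. -/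
theorem IsMeanZeroBump.mul_norm_fourierInv_le {c : EuclideanSpace ℝ (Fin n)} {ρ A : ℝ}
    (hρ : 0 < ρ) {ψ : EuclideanSpace ℝ (Fin n) → ℝ} (h : IsMeanZeroBump c ρ A ψ)
    (ξ : EuclideanSpace ℝ (Fin n)) :
    ρ * ‖ξ‖ * ‖𝓕⁻ (toComplexSchwartz h.contDiff h.hasCompactSupport) ξ‖ ≤ n * A := by
  set f := toComplexSchwartz h.contDiff h.hasCompactSupport with hf
  have hk : ∀ k : Fin n, |ξ k| * ‖𝓕⁻ f ξ‖ ≤ A / ρ := fun k => by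
    have h1 := norm_fourierInv_le_integral_norm
      (LineDeriv.lineDerivOp (EuclideanSpace.single k (1 : ℝ)) f) ξ
    have htg : (fun x : EuclideanSpace ℝ (Fin n) =>
        inner ℝ x (EuclideanSpace.single k (1 : ℝ))).HasTemperateGrowth :=
      ((innerSL ℝ).flip (EuclideanSpace.single k (1 : ℝ))).hasTemperateGrowth
    rw [fourierInv_lineDerivOp_eq] at h1
    have e1 : ‖(-(2 * (Real.pi : ℂ) * Complex.I) • (smulLeftCLM ℂ fun x : EuclideanSpace ℝ (Fin n) =>
        inner ℝ x (EuclideanSpace.single k (1 : ℝ))) (𝓕⁻ f)) ξ‖ =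
        2 * Real.pi * (|ξ k| * ‖𝓕⁻ f ξ‖) := by
      rw [smul_apply, smulLeftCLM_apply_apply htg]
      simp [abs_of_pos Real.pi_pos, EuclideanSpace.inner_single_right]
    have e2 : ∀ w, ‖(LineDeriv.lineDerivOp (EuclideanSpace.single k (1 : ℝ)) f) w‖ =
        |partialD k ψ w| := fun w => by
      rw [lineDerivOp_apply_eq_fderiv, partialD]
      have hd : HasFDerivAt ψ (fderiv ℝ ψ w) w :=
        (h.contDiff.differentiable (by simp) w).hasFDerivAt
      have : HasFDerivAt (f : EuclideanSpace ℝ (Fin n) → ℂ)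
          (Complex.ofRealCLM.comp (fderiv ℝ ψ w)) w :=
        Complex.ofRealCLM.hasFDerivAt.comp w hd
      rw [this.fderiv]
      simp
    rw [e1] at h1
    simp_rw [e2] at h1
    have h2 : |ξ k| * ‖𝓕⁻ f ξ‖ ≤ 2 * Real.pi * (|ξ k| * ‖𝓕⁻ f ξ‖) :=
      le_mul_of_one_le_left (by positivity) (by nlinarith [Real.pi_gt_three])
    exact h2.trans (h1.trans (h.l1_deriv_bound k))
  calc ρ * ‖ξ‖ * ‖𝓕⁻ f ξ‖ ≤ ρ * (∑ k, |ξ k|) * ‖𝓕⁻ f ξ‖ := by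
        gcongr; exact EuclideanSpace.norm_le_sum_abs ξ
    _ = ρ * ∑ k, |ξ k| * ‖𝓕⁻ f ξ‖ := by rw [mul_assoc, Finset.sum_mul]
    _ ≤ ρ * ∑ _k : Fin n, A / ρ := by gcongr with k; exact hk k
    _ = n * A := by
        rw [Finset.sum_const, Finset.card_univ, Fintype.card_fin, nsmul_eq_mul]
        field_simp

/-- With `v = ρ‖ξ‖` and `M` the modulus of the transform, add `M ≤ 2πA v` to `v` times `v M ≤ nA`.
-/
theorem IsMeanZeroBump.norm_fourierInv_le {c : EuclideanSpace ℝ (Fin n)} {ρ A : ℝ}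
    (hρ : 0 < ρ) {ψ : EuclideanSpace ℝ (Fin n) → ℝ} (h : IsMeanZeroBump c ρ A ψ)
    (ξ : EuclideanSpace ℝ (Fin n)) :
    ‖𝓕⁻ (toComplexSchwartz h.contDiff h.hasCompactSupport) ξ‖ ≤
      (2 * Real.pi + n) * A * (ρ * ‖ξ‖ / (1 + (ρ * ‖ξ‖) ^ 2)) := by
  have h1 := h.norm_fourierInv_le_mul hρ ξ
  have h2 := h.mul_norm_fourierInv_le hρ ξ
  set M := ‖𝓕⁻ (toComplexSchwartz h.contDiff h.hasCompactSupport) ξ‖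
  have hv : 0 ≤ ρ * ‖ξ‖ := by positivity
  set v := ρ * ‖ξ‖
  rw [← mul_div_assoc, le_div_iff₀ (by positivity)]
  nlinarith [mul_le_mul_of_nonneg_left h2 hv]

/-- Fubini applies because the character is unimodular and `a(x) b(ξ)` is integrable on the product.
-/
theorem integral_mul_integral_fourierChar {a b : EuclideanSpace ℝ (Fin n) → ℂ}
    (ha : Integrable a) (hb : Integrable b) (r : ℝ) :
    ∫ x, a x * ∫ ξ, b ξ * (Real.fourierChar (r * inner ℝ x ξ) : Circle) =
      ∫ ξ, b ξ * ∫ x, (Real.fourierChar (r * inner ℝ x ξ) : Circle) * a x := by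
  have hi : Integrable (Function.uncurry fun x ξ : EuclideanSpace ℝ (Fin n) =>
      ((Real.fourierChar (r * inner ℝ x ξ) : Circle) : ℂ) * (a x * b ξ)) (volume.prod volume) := by
    refine (ha.mul_prod hb).bdd_mul (c := 1) ?_ (ae_of_all _ fun w => ?_)
    · have : Continuous fun p : EuclideanSpace ℝ (Fin n) × EuclideanSpace ℝ (Fin n) =>
          ((Real.fourierChar (r * inner ℝ p.1 p.2) : Circle) : ℂ) := by fun_prop
      exact this.aestronglyMeasurable
    · exact (Circle.norm_coe _).le
  calc _ = ∫ x, ∫ ξ, ((Real.fourierChar (r * inner ℝ x ξ) : Circle) : ℂ) * (a x * b ξ) := by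
        refine integral_congr_ae (ae_of_all _ fun x => ?_)
        simp only
        rw [← integral_const_mul]
        congr with ξ
        ring
    _ = ∫ ξ, ∫ x, ((Real.fourierChar (r * inner ℝ x ξ) : Circle) : ℂ) * (a x * b ξ) :=
        integral_integral_swap hi
    _ = _ := by
        refine integral_congr_ae (ae_of_all _ fun ξ => ?_)
        simp only
        rw [← integral_const_mul]
        congr with x
        ring

theorem fourierInv_smul_eq (f : 𝓢(EuclideanSpace ℝ (Fin n), ℂ)) (r : ℝ)
    (ξ : EuclideanSpace ℝ (Fin n)) :
    ∫ x, (Real.fourierChar (r * inner ℝ x ξ) : Circle) * f x = 𝓕⁻ f (r • ξ) := by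
  rw [fourierInv_coe, Real.fourierInv_eq]
  simp only [inner_smul_right, Circle.smul_def, smul_eq_mul]

/-- The averages over dilates become multiplications after a Fourier transform. -/
theorem integral_mul_integral_segment (F φ ψ : 𝓢(EuclideanSpace ℝ (Fin n), ℂ)) (s t : ℝ) :
    ∫ x, φ x * ∫ w, ψ w * F (s • x + t • w) =
      ∫ ξ, 𝓕 F ξ * 𝓕⁻ ψ (t • ξ) * 𝓕⁻ φ (s • ξ) := by
  have hFi : Integrable (⇑(𝓕 F : 𝓢(EuclideanSpace ℝ (Fin n), ℂ))) := (𝓕 F).integrable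
  have hF : ∀ z, F z = ∫ ξ, (Real.fourierChar (inner ℝ ξ z) : Circle) * 𝓕 F ξ := fun z => by
    have : F z = 𝓕⁻ (𝓕 F) z := by simp
    rw [this, fourierInv_coe, Real.fourierInv_eq]
    simp only [Circle.smul_def, smul_eq_mul]
  have h1 : ∀ x, ∫ w, ψ w * F (s • x + t • w) =
      ∫ ξ, (𝓕 F ξ * 𝓕⁻ ψ (t • ξ)) * (Real.fourierChar (s * inner ℝ x ξ) : Circle) := fun x => by
    have hb : Integrable fun ξ => 𝓕 F ξ * (Real.fourierChar (s * inner ℝ x ξ) : Circle) := by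
      refine hFi.mul_bdd (c := 1) ?_ (ae_of_all _ fun ξ => (Circle.norm_coe _).le)
      have : Continuous fun ξ : EuclideanSpace ℝ (Fin n) =>
          ((Real.fourierChar (s * inner ℝ x ξ) : Circle) : ℂ) := by fun_prop
      exact this.aestronglyMeasurable
    have h2 := integral_mul_integral_fourierChar ψ.integrable hb t
    refine Eq.trans ?_ (h2.trans ?_)
    · refine integral_congr_ae (ae_of_all _ fun w => ?_)
      simp only
      rw [hF]
      congr 1
      refine integral_congr_ae (ae_of_all _ fun ξ => ?_)
      simp only [inner_add_right, inner_smul_right, AddChar.map_add_eq_mul, Circle.coe_mul]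
      rw [real_inner_comm x ξ, real_inner_comm w ξ]
      ring
    · refine integral_congr_ae (ae_of_all _ fun ξ => ?_)
      simp only
      rw [fourierInv_smul_eq]
      ring
  simp_rw [h1]
  have hψb : Integrable fun ξ => 𝓕 F ξ * 𝓕⁻ ψ (t • ξ) := by
    refine hFi.mul_bdd (c := ∫ w, ‖ψ w‖) ?_
      (ae_of_all _ fun ξ => norm_fourierInv_le_integral_norm ψ _)
    exact ((𝓕⁻ ψ).continuous.comp (continuous_const_smul t)).aestronglyMeasurable
  rw [integral_mul_integral_fourierChar φ.integrable hψb s]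
  simp_rw [fourierInv_smul_eq]

theorem eLpNorm_fourier_eq (f : 𝓢(EuclideanSpace ℝ (Fin n), ℂ)) :
    eLpNorm (⇑(𝓕 f : 𝓢(EuclideanSpace ℝ (Fin n), ℂ))) 2 volume = eLpNorm f 2 volume := by
  have h1 : ‖(𝓕 f).toLp 2‖ = ‖f.toLp 2‖ := norm_fourier_toL2_eq f
  have e : ∀ g : 𝓢(EuclideanSpace ℝ (Fin n), ℂ), eLpNorm g 2 volume = ‖g.toLp 2‖ₑ := fun g => by
    rw [Lp.enorm_def, eLpNorm_congr_ae (coeFn_toLp g 2 volume)]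
  rw [e, e, ← ofReal_norm, ← ofReal_norm, h1]

theorem eLpNorm_fourierInv_eq (f : 𝓢(EuclideanSpace ℝ (Fin n), ℂ)) :
    eLpNorm (⇑(𝓕⁻ f : 𝓢(EuclideanSpace ℝ (Fin n), ℂ))) 2 volume = eLpNorm f 2 volume := by
  rw [← eLpNorm_fourier_eq (𝓕⁻ f)]
  simp

end FourierBounds

/-! ### The singular range `1/2 < s < 1`: square-function type bound in `s` -/

section NearDiagonal

open FourierTransform SchwartzMap
open scoped FourierTransform SchwartzMap

variable {n : ℕ}

/-- The substitution `u = b t` reduces this to the arctangent integral, hence the independence of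
`b`; here `b` stands for `ρ‖ξ‖`. -/
theorem lintegral_div_one_add_sq_le {b : ℝ} (hb : 0 ≤ b) :
    ∫⁻ t : ℝ, ENNReal.ofReal (b / (1 + (b * t) ^ 2)) ≤ ENNReal.ofReal Real.pi := by
  rcases hb.eq_or_lt with rfl | hb
  · simp
  have hi : Integrable fun t : ℝ => b * (1 + (b * t) ^ 2)⁻¹ :=
    (integrable_inv_one_add_sq.comp_mul_left' hb.ne').const_mul b
  simp only [div_eq_mul_inv]
  rw [← ofReal_integral_eq_lintegral_ofReal hi (ae_of_all _ fun t => by positivity),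
    integral_const_mul, Measure.integral_comp_mul_left (fun x : ℝ => (1 + x ^ 2)⁻¹),
    integral_univ_inv_one_add_sq, abs_of_pos (by positivity), smul_eq_mul,
    mul_inv_cancel_left₀ hb.ne']

/-- The weight of the Schur test on the Fourier side. -/
noncomputable def nearWeight (ρ s : ℝ) (ξ : EuclideanSpace ℝ (Fin n)) : ℝ≥0∞ :=
  ENNReal.ofReal (ρ * ‖ξ‖ / (1 + (ρ * ‖ξ‖ * (1 - s)) ^ 2))

theorem measurable_nearWeight (ρ : ℝ) :
    Measurable fun p : ℝ × EuclideanSpace ℝ (Fin n) => nearWeight ρ p.1 p.2 := by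
  unfold nearWeight
  refine ENNReal.measurable_ofReal.comp (Measurable.div ?_ ?_) <;> fun_prop

theorem setLIntegral_nearWeight_le {ρ : ℝ} (hρ : 0 ≤ ρ) (S : Set ℝ)
    (ξ : EuclideanSpace ℝ (Fin n)) :
    ∫⁻ s in S, nearWeight ρ s ξ ≤ ENNReal.ofReal Real.pi := by
  refine (setLIntegral_le_lintegral _ _).trans ?_
  have := lintegral_sub_left_eq_self (μ := (volume : Measure ℝ))
    (fun t => ENNReal.ofReal (ρ * ‖ξ‖ / (1 + (ρ * ‖ξ‖ * t) ^ 2))) 1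
  unfold nearWeight
  rw [this]
  exact lintegral_div_one_add_sq_le (by positivity)

/-- Passing to `s⁻¹ η` raises the numerator by at most two and only enlarges the denominator. -/
theorem nearWeight_inv_smul_le {ρ s : ℝ} (hρ : 0 ≤ ρ) (h0 : 1 / 2 < s) (h1 : s < 1)
    (η : EuclideanSpace ℝ (Fin n)) :
    nearWeight ρ s (s⁻¹ • η) ≤ 2 * nearWeight ρ s η := by
  have hs : 0 < s := by linarith
  unfold nearWeight
  refine (ENNReal.ofReal_le_ofReal (q := 2 * (ρ * ‖η‖ / (1 + (ρ * ‖η‖ * (1 - s)) ^ 2))) ?_).trans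
    (le_of_eq (by rw [ENNReal.ofReal_mul (by norm_num), ENNReal.ofReal_ofNat]))
  rw [norm_smul, norm_inv, Real.norm_of_nonneg hs.le]
  have hs1 : (1 : ℝ) ≤ s⁻¹ := (one_le_inv₀ hs).2 h1.le
  have hs2 : s⁻¹ ≤ 2 := by rw [inv_le_comm₀ hs (by norm_num)]; linarith
  have ha : 0 ≤ ρ * ‖η‖ := by positivity
  rw [mul_left_comm]
  generalize ρ * ‖η‖ = a at ha ⊢
  rw [← mul_div_assoc]
  have h3 : 1 + (a * (1 - s)) ^ 2 ≤ 1 + (s⁻¹ * a * (1 - s)) ^ 2 := by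
    have : a * (1 - s) ≤ s⁻¹ * a * (1 - s) := by
      rw [mul_assoc]
      exact le_mul_of_one_le_left (mul_nonneg ha (by linarith : (0 : ℝ) ≤ 1 - s)) hs1
    have h4 : 0 ≤ a * (1 - s) := mul_nonneg ha (by linarith : (0 : ℝ) ≤ 1 - s)
    gcongr
  gcongr

/-- The constant in the bound near the diagonal. -/
noncomputable def nearConst (n : ℕ) : ℝ := (2 * Real.pi + n) * (Real.pi * 2 ^ (n + 1))

theorem nearConst_pos (n : ℕ) : 0 < nearConst n := by
  unfold nearConst; positivity

theorem lintegral_nearWeight_mul_sq_le {ρ : ℝ} (hρ : 0 ≤ ρ)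
    {G : EuclideanSpace ℝ (Fin n) → ℝ≥0∞} (hG : Measurable G) :
    ∫⁻ s in Set.Ioo (1 / 2 : ℝ) 1, ∫⁻ ξ : EuclideanSpace ℝ (Fin n),
      nearWeight ρ s ξ * G ξ ^ 2 ≤ ENNReal.ofReal Real.pi * ∫⁻ ξ, G ξ ^ 2 := by
  have hm : Measurable fun p : ℝ × EuclideanSpace ℝ (Fin n) => nearWeight ρ p.1 p.2 * G p.2 ^ 2 :=
    (measurable_nearWeight ρ).mul ((hG.comp measurable_snd).pow_const 2)
  have hw : ∀ ξ : EuclideanSpace ℝ (Fin n), Measurable fun s : ℝ => nearWeight ρ s ξ := fun ξ => by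
    unfold nearWeight
    refine ENNReal.measurable_ofReal.comp (Measurable.div ?_ ?_) <;> fun_prop
  calc _ = ∫⁻ ξ : EuclideanSpace ℝ (Fin n), ∫⁻ s in Set.Ioo (1 / 2 : ℝ) 1,
        nearWeight ρ s ξ * G ξ ^ 2 := lintegral_lintegral_swap hm.aemeasurable
    _ = ∫⁻ ξ : EuclideanSpace ℝ (Fin n), (∫⁻ s in Set.Ioo (1 / 2 : ℝ) 1, nearWeight ρ s ξ) *
        G ξ ^ 2 := lintegral_congr fun ξ => lintegral_mul_const _ (hw ξ)
    _ ≤ ∫⁻ ξ : EuclideanSpace ℝ (Fin n), ENNReal.ofReal Real.pi * G ξ ^ 2 :=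
        lintegral_mono fun ξ => mul_le_mul' (setLIntegral_nearWeight_le hρ _ ξ) le_rfl
    _ = _ := lintegral_const_mul _ (hG.pow_const 2)

/-- After `η = s ξ` the Jacobian `s⁻ⁿ` costs `2ⁿ` and the rescaled weight costs two more, which
explains `2^{n+1}`. -/
theorem lintegral_nearWeight_mul_dilate_sq_le {ρ : ℝ} (hρ : 0 ≤ ρ)
    {G : EuclideanSpace ℝ (Fin n) → ℝ≥0∞} (hG : Measurable G) :
    ∫⁻ s in Set.Ioo (1 / 2 : ℝ) 1, ∫⁻ ξ : EuclideanSpace ℝ (Fin n),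
      nearWeight ρ s ξ * G (s • ξ) ^ 2 ≤
      ENNReal.ofReal (Real.pi * 2 ^ (n + 1)) * ∫⁻ ξ, G ξ ^ 2 := by
  calc _ ≤ ∫⁻ s in Set.Ioo (1 / 2 : ℝ) 1, ENNReal.ofReal (2 ^ (n + 1)) *
        ∫⁻ ξ : EuclideanSpace ℝ (Fin n), nearWeight ρ s ξ * G ξ ^ 2 := by
        refine setLIntegral_mono' measurableSet_Ioo fun s hs => ?_
        have hs0 : 0 < s := by linarith [hs.1]
        have h1 := lintegral_comp_add_smul
          (fun η : EuclideanSpace ℝ (Fin n) => nearWeight ρ s (s⁻¹ • η) * G η ^ 2) 0 hs0.ne'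
        simp only [zero_add, inv_smul_smul₀ hs0.ne'] at h1
        rw [h1, abs_of_pos hs0, pow_succ, ENNReal.ofReal_mul (by positivity), mul_assoc]
        gcongr
        · rw [inv_le_comm₀ hs0 (by norm_num)]; linarith [hs.1]
        · rw [← lintegral_const_mul' _ _ ENNReal.ofReal_ne_top]
          refine lintegral_mono fun η => ?_
          simp only
          rw [← mul_assoc]
          gcongr
          simpa using nearWeight_inv_smul_le hρ hs.1 hs.2 η
    _ = ENNReal.ofReal (2 ^ (n + 1)) * ∫⁻ s in Set.Ioo (1 / 2 : ℝ) 1,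
          ∫⁻ ξ : EuclideanSpace ℝ (Fin n), nearWeight ρ s ξ * G ξ ^ 2 :=
        lintegral_const_mul' _ _ ENNReal.ofReal_ne_top
    _ ≤ ENNReal.ofReal (2 ^ (n + 1)) * (ENNReal.ofReal Real.pi * ∫⁻ ξ, G ξ ^ 2) := by
        gcongr
        exact lintegral_nearWeight_mul_sq_le hρ hG
    _ = _ := by
        rw [← mul_assoc, ← ENNReal.ofReal_mul (by positivity), mul_comm (_ ^ _)]

theorem lintegral_nearWeight_mul_mul_le {ρ : ℝ} (hρ : 0 ≤ ρ)
    {G P : EuclideanSpace ℝ (Fin n) → ℝ≥0∞} (hG : Measurable G) (hP : Measurable P) :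
    ∫⁻ s in Set.Ioo (1 / 2 : ℝ) 1, ∫⁻ ξ : EuclideanSpace ℝ (Fin n),
      nearWeight ρ s ξ * (G ξ * P (s • ξ)) ≤
      ENNReal.ofReal (Real.pi * 2 ^ (n + 1)) *
        ((∫⁻ ξ, G ξ ^ 2) ^ (1 / 2 : ℝ) * (∫⁻ ξ, P ξ ^ 2) ^ (1 / 2 : ℝ)) := by
  have hk := measurable_nearWeight (n := n) ρ
  have hG' : Measurable fun p : ℝ × EuclideanSpace ℝ (Fin n) => G p.2 := hG.comp measurable_snd
  have hP' : Measurable fun p : ℝ × EuclideanSpace ℝ (Fin n) => P (p.1 • p.2) :=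
    hP.comp (by fun_prop)
  have h := lintegral_weight_mul_mul_le
    (μ := (volume.restrict (Set.Ioo (1 / 2 : ℝ) 1)).prod
      (volume : Measure (EuclideanSpace ℝ (Fin n)))) hk.aemeasurable hG'.aemeasurable
      hP'.aemeasurable
  have m1 : Measurable fun p : ℝ × EuclideanSpace ℝ (Fin n) =>
      nearWeight ρ p.1 p.2 * (G p.2 * P (p.1 • p.2)) := hk.mul (hG'.mul hP')
  have m2 : Measurable fun p : ℝ × EuclideanSpace ℝ (Fin n) =>
      nearWeight ρ p.1 p.2 * G p.2 ^ 2 := hk.mul (hG'.pow_const 2)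
  have m3 : Measurable fun p : ℝ × EuclideanSpace ℝ (Fin n) =>
      nearWeight ρ p.1 p.2 * P (p.1 • p.2) ^ 2 := hk.mul (hP'.pow_const 2)
  rw [lintegral_prod _ m1.aemeasurable, lintegral_prod _ m2.aemeasurable,
    lintegral_prod _ m3.aemeasurable] at h
  refine h.trans ?_
  set c := ENNReal.ofReal (Real.pi * 2 ^ (n + 1))
  have hc : c = c ^ (1 / 2 : ℝ) * c ^ (1 / 2 : ℝ) := by
    rw [← ENNReal.rpow_add_of_nonneg _ _ (by norm_num) (by norm_num)]; norm_num
  rw [hc, mul_mul_mul_comm, ← ENNReal.mul_rpow_of_nonneg c _ (by norm_num),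
    ← ENNReal.mul_rpow_of_nonneg c _ (by norm_num)]
  refine mul_le_mul' (ENNReal.rpow_le_rpow ?_ (by norm_num : (0 : ℝ) ≤ 1 / 2))
    (ENNReal.rpow_le_rpow ?_ (by norm_num : (0 : ℝ) ≤ 1 / 2))
  · refine (lintegral_nearWeight_mul_sq_le hρ hG).trans ?_
    exact mul_le_mul' (ENNReal.ofReal_le_ofReal (le_mul_of_one_le_right Real.pi_pos.le
      (one_le_pow₀ (by norm_num)))) le_rfl
  · exact lintegral_nearWeight_mul_dilate_sq_le hρ hP

theorem eLpNorm_toComplexSchwartz {ψ : EuclideanSpace ℝ (Fin n) → ℝ} (h : ContDiff ℝ ∞ ψ)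
    (hc : HasCompactSupport ψ) : eLpNorm (toComplexSchwartz h hc) 2 volume = eLpNorm ψ 2 volume :=
  eLpNorm_congr_norm_ae (ae_of_all _ fun x => by rw [toComplexSchwartz_apply, Complex.norm_real])

theorem ofReal_segForm_eq {ψ F φ : EuclideanSpace ℝ (Fin n) → ℝ}
    (hψ : ContDiff ℝ ∞ ψ) (hψc : HasCompactSupport ψ) (hF : ContDiff ℝ ∞ F)
    (hFc : HasCompactSupport F) (hφ : ContDiff ℝ ∞ φ) (hφc : HasCompactSupport φ)
    {s : ℝ} (h0 : 0 < s) (hs : s < 1) :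
    ((segForm s ψ F φ : ℝ) : ℂ) =
      ∫ ξ, 𝓕 (toComplexSchwartz hF hFc) ξ * 𝓕⁻ (toComplexSchwartz hψ hψc) ((1 - s) • ξ) *
        𝓕⁻ (toComplexSchwartz hφ hφc) (s • ξ) := by
  rw [← integral_mul_integral_segment, segForm_eq_iterated hψ.continuous.measurable
    (hψ.continuous.integrable_of_hasCompactSupport hψc) hF.continuous.measurable
    (hF.continuous.memLp_of_hasCompactSupport hFc) hφ.continuous.measurable
    (hφ.continuous.memLp_of_hasCompactSupport hφc) h0 hs, ← integral_complex_ofReal]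
  simp only [Complex.ofReal_mul, ← integral_complex_ofReal, toComplexSchwartz_apply]

/-- Smoothness of `F` makes all three functions Schwartz, so the Fourier identity holds pointwise in
`s`. The decay of `ψ̌((1-s)ξ)` absorbs `1/(1 - s)` into `nearWeight`. -/
theorem IsMeanZeroBump.setLIntegral_enorm_segForm_le_of_contDiff
    {c : EuclideanSpace ℝ (Fin n)} {ρ A : ℝ} (hρ : 0 < ρ)
    {ψ F φ : EuclideanSpace ℝ (Fin n) → ℝ} (h : IsMeanZeroBump c ρ A ψ) (hA : 0 ≤ A)
    (hF : ContDiff ℝ ∞ F) (hFc : HasCompactSupport F) (hφ : ContDiff ℝ ∞ φ)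
    (hφc : HasCompactSupport φ) :
    ∫⁻ s in Set.Ioo (1 / 2 : ℝ) 1, ENNReal.ofReal (1 / (1 - s)) * ‖segForm s ψ F φ‖ₑ ≤
      ENNReal.ofReal (nearConst n * A) * (eLpNorm F 2 volume * eLpNorm φ 2 volume) := by
  set Fh : 𝓢(EuclideanSpace ℝ (Fin n), ℂ) := 𝓕 (toComplexSchwartz hF hFc) with hFh
  set φh : 𝓢(EuclideanSpace ℝ (Fin n), ℂ) := 𝓕⁻ (toComplexSchwartz hφ hφc) with hφh
  set ψh : 𝓢(EuclideanSpace ℝ (Fin n), ℂ) :=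
    𝓕⁻ (toComplexSchwartz h.contDiff h.hasCompactSupport) with hψh
  calc _ ≤ ∫⁻ s in Set.Ioo (1 / 2 : ℝ) 1, ENNReal.ofReal ((2 * Real.pi + n) * A) *
        ∫⁻ ξ : EuclideanSpace ℝ (Fin n), nearWeight ρ s ξ * (‖Fh ξ‖ₑ * ‖φh (s • ξ)‖ₑ) := by
        refine setLIntegral_mono' measurableSet_Ioo fun s hs => ?_
        have hs0 : 0 < s := by linarith [hs.1]
        have ht : 0 < 1 - s := by linarith [hs.2]
        have e : ‖segForm s ψ F φ‖ₑ ≤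
            ∫⁻ ξ, ‖Fh ξ * ψh ((1 - s) • ξ) * φh (s • ξ)‖ₑ := by
          have e0 : ‖segForm s ψ F φ‖ₑ = ‖((segForm s ψ F φ : ℝ) : ℂ)‖ₑ := by
            rw [← ofReal_norm, ← ofReal_norm, Complex.norm_real]
          rw [e0, ofReal_segForm_eq h.contDiff h.hasCompactSupport hF hFc hφ hφc
            hs0 hs.2]
          exact enorm_integral_le_lintegral_enorm _
        refine (mul_le_mul_right e _).trans ?_
        rw [← lintegral_const_mul' _ _ ENNReal.ofReal_ne_top,
          ← lintegral_const_mul' _ _ ENNReal.ofReal_ne_top]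
        refine lintegral_mono fun ξ => ?_
        simp only [enorm_mul]
        have hb : ENNReal.ofReal (1 / (1 - s)) * ‖ψh ((1 - s) • ξ)‖ₑ ≤
            ENNReal.ofReal ((2 * Real.pi + n) * A) * nearWeight ρ s ξ := by
          rw [← ofReal_norm, nearWeight, ← ENNReal.ofReal_mul (by positivity),
            ← ENNReal.ofReal_mul (by positivity)]
          refine ENNReal.ofReal_le_ofReal ?_
          have h1 := h.norm_fourierInv_le hρ ((1 - s) • ξ)
          rw [norm_smul, Real.norm_of_nonneg ht.le] at h1
          refine (mul_le_mul_of_nonneg_left h1 (by positivity)).trans (le_of_eq ?_)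
          have e3 : ρ * ((1 - s) * ‖ξ‖) = ρ * ‖ξ‖ * (1 - s) := by ring
          rw [e3]
          field_simp
        calc _ = (ENNReal.ofReal (1 / (1 - s)) * ‖ψh ((1 - s) • ξ)‖ₑ) *
              (‖Fh ξ‖ₑ * ‖φh (s • ξ)‖ₑ) := by ring
          _ ≤ _ := by
            rw [← mul_assoc (ENNReal.ofReal ((2 * Real.pi + n) * A))]
            gcongr
    _ ≤ ENNReal.ofReal ((2 * Real.pi + n) * A) * (ENNReal.ofReal (Real.pi * 2 ^ (n + 1)) *
        ((∫⁻ ξ, ‖Fh ξ‖ₑ ^ 2) ^ (1 / 2 : ℝ) * (∫⁻ ξ, ‖φh ξ‖ₑ ^ 2) ^ (1 / 2 : ℝ))) := by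
        rw [lintegral_const_mul' _ _ ENNReal.ofReal_ne_top]
        gcongr
        exact lintegral_nearWeight_mul_mul_le hρ.le Fh.continuous.measurable.enorm
          φh.continuous.measurable.enorm
    _ = _ := by
        rw [← eLpNorm_two_eq, ← eLpNorm_two_eq, hFh, hφh, eLpNorm_fourier_eq,
          eLpNorm_fourierInv_eq, eLpNorm_toComplexSchwartz, eLpNorm_toComplexSchwartz, ← mul_assoc,
          ← ENNReal.ofReal_mul (by positivity), nearConst]
        congr 2
        ring

theorem measurable_segForm {ψ F φ : EuclideanSpace ℝ (Fin n) → ℝ} (hψ : Measurable ψ)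
    (hF : Measurable F) (hφ : Measurable φ) : Measurable fun s => segForm s ψ F φ := by
  unfold segForm
  refine (StronglyMeasurable.integral_prod_right
    (f := fun (s : ℝ) (p : EuclideanSpace ℝ (Fin n) × EuclideanSpace ℝ (Fin n)) =>
      φ p.1 * (ψ (segEnd p.1 s p.2) * F p.2 * (1 / (1 - s) ^ n))) ?_).measurable
  refine Measurable.stronglyMeasurable ?_
  have h1 : Measurable fun q : ℝ × EuclideanSpace ℝ (Fin n) × EuclideanSpace ℝ (Fin n) =>
      segEnd q.2.1 q.1 q.2.2 := by unfold segEnd; fun_prop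
  exact (hφ.comp (measurable_fst.comp measurable_snd)).mul (((hψ.comp h1).mul
    (hF.comp (measurable_snd.comp measurable_snd))).mul (by fun_prop))

/-- Density of test functions in `L²`: for each `s` the form is continuous in `F`, and Fatou's lemma
in `s` carries the uniform bound to the limit. -/
theorem IsMeanZeroBump.setLIntegral_enorm_segForm_le
    {c : EuclideanSpace ℝ (Fin n)} {ρ A : ℝ} (hρ : 0 < ρ)
    {ψ F φ : EuclideanSpace ℝ (Fin n) → ℝ} (h : IsMeanZeroBump c ρ A ψ) (hA : 0 ≤ A)
    (hF : Measurable F) (hF2 : MemLp F 2 volume) (hφ : ContDiff ℝ ∞ φ)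
    (hφc : HasCompactSupport φ) :
    ∫⁻ s in Set.Ioo (1 / 2 : ℝ) 1, ENNReal.ofReal (1 / (1 - s)) * ‖segForm s ψ F φ‖ₑ ≤
      ENNReal.ofReal (nearConst n * A) * (eLpNorm F 2 volume * eLpNorm φ 2 volume) := by
  have hex : ∀ k : ℕ, ∃ g : EuclideanSpace ℝ (Fin n) → ℝ, HasCompactSupport g ∧ ContDiff ℝ ∞ g ∧
      eLpNorm (F - g) 2 volume ≤ ENNReal.ofReal (1 / ((k : ℝ) + 1)) := fun k =>
    MemLp.exist_eLpNorm_sub_le (by norm_num) (by norm_num) hF2 (by positivity)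
  choose G hGc hG hGF using hex
  have hG2 : ∀ k, MemLp (G k) 2 volume := fun k =>
    (hG k).continuous.memLp_of_hasCompactSupport (hGc k)
  have hε : Filter.Tendsto (fun k : ℕ => ENNReal.ofReal (1 / ((k : ℝ) + 1))) Filter.atTop
      (nhds 0) := by
    simpa using ENNReal.tendsto_ofReal tendsto_one_div_add_atTop_nhds_zero_nat
  have hlim : Filter.Tendsto (fun k => eLpNorm (F - G k) 2 volume) Filter.atTop (nhds 0) :=
    tendsto_of_tendsto_of_tendsto_of_le_of_le tendsto_const_nhds hε (fun _ => zero_le) hGF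
  have hnorm : ∀ k, eLpNorm (G k) 2 volume ≤
      eLpNorm F 2 volume + ENNReal.ofReal (1 / ((k : ℝ) + 1)) := fun k => by
    have e : G k = F - (F - G k) := by simp
    calc eLpNorm (G k) 2 volume = eLpNorm (F - (F - G k)) 2 volume := by rw [← e]
      _ ≤ eLpNorm F 2 volume + eLpNorm (F - G k) 2 volume :=
        eLpNorm_sub_le hF2.1 (hF2.1.sub (hG2 k).1) (by norm_num)
      _ ≤ _ := by gcongr; exact hGF k
  have hψi := h.contDiff.continuous.integrable_of_hasCompactSupport h.hasCompactSupport
    (μ := volume)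
  have hφ2 : MemLp φ 2 volume := hφ.continuous.memLp_of_hasCompactSupport hφc
  calc _ ≤ ∫⁻ s in Set.Ioo (1 / 2 : ℝ) 1, Filter.liminf (fun k =>
        ENNReal.ofReal (1 / (1 - s)) * ‖segForm s ψ (G k) φ‖ₑ) Filter.atTop := by
        refine setLIntegral_mono' measurableSet_Ioo fun s hs => ?_
        have hs0 : 0 < s := by linarith [hs.1]
        have h1 := tendsto_segForm h.contDiff.continuous.measurable hψi hF hF2
          (fun k => (hG k).continuous.measurable) hG2 hφ.continuous.measurable hφ2 hs0 hs.2 hlim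
        have h2 := ENNReal.Tendsto.const_mul (a := ENNReal.ofReal (1 / (1 - s))) h1.enorm
          (Or.inr ENNReal.ofReal_ne_top)
        exact h2.liminf_eq.ge
    _ ≤ Filter.liminf (fun k => ∫⁻ s in Set.Ioo (1 / 2 : ℝ) 1,
        ENNReal.ofReal (1 / (1 - s)) * ‖segForm s ψ (G k) φ‖ₑ) Filter.atTop := by
        refine lintegral_liminf_le fun k => ?_
        exact Measurable.mul (by fun_prop) (measurable_segForm h.contDiff.continuous.measurable
          (hG k).continuous.measurable hφ.continuous.measurable).enorm
    _ ≤ Filter.liminf (fun k : ℕ => ENNReal.ofReal (nearConst n * A) *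
        ((eLpNorm F 2 volume + ENNReal.ofReal (1 / ((k : ℝ) + 1))) * eLpNorm φ 2 volume))
        Filter.atTop := by
        refine Filter.liminf_le_liminf (Filter.Eventually.of_forall fun k => ?_)
        refine (h.setLIntegral_enorm_segForm_le_of_contDiff hρ hA (hG k) (hGc k) hφ hφc).trans ?_
        gcongr
        exact hnorm k
    _ = _ := by
        refine Filter.Tendsto.liminf_eq ?_
        have h1 := hε.const_add (eLpNorm F 2 volume)
        rw [add_zero] at h1
        exact ENNReal.Tendsto.const_mul (ENNReal.Tendsto.mul_const h1 (Or.inr hφ2.2.ne))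
          (Or.inr ENNReal.ofReal_ne_top)

end NearDiagonal

/-! ### Weak derivatives by duality -/

section WeakDerivative

variable {n : ℕ}

/-- The test functions on `Ω`. -/
def testSpace (Ω : Set (EuclideanSpace ℝ (Fin n))) :
    Submodule ℝ (EuclideanSpace ℝ (Fin n) → ℝ) where
  carrier := {φ | ContDiff ℝ ∞ φ ∧ HasCompactSupport φ ∧ tsupport φ ⊆ Ω}
  add_mem' := fun {a b} ha hb => ⟨ha.1.add hb.1, ha.2.1.add hb.2.1,
    (tsupport_add a b).trans (Set.union_subset ha.2.2 hb.2.2)⟩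
  zero_mem' := ⟨contDiff_const, HasCompactSupport.zero, by simp [tsupport]⟩
  smul_mem' := fun c φ h => ⟨contDiff_const.smul h.1, h.2.1.smul_left (f := fun _ => c),
    (tsupport_smul_subset_right (fun _ => c) φ).trans h.2.2⟩

theorem partialD_add {φ ψ : EuclideanSpace ℝ (Fin n) → ℝ} (hφ : Differentiable ℝ φ)
    (hψ : Differentiable ℝ ψ) (j : Fin n) :
    partialD j (φ + ψ) = partialD j φ + partialD j ψ := by
  ext x
  simp [partialD, fderiv_add (hφ x) (hψ x)]

theorem partialD_smul {φ : EuclideanSpace ℝ (Fin n) → ℝ} (hφ : Differentiable ℝ φ) (c : ℝ)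
    (j : Fin n) : partialD j (c • φ) = c • partialD j φ := by
  ext x
  simp [partialD, fderiv_const_smul (hφ x)]

theorem contDiff_partialD {φ : EuclideanSpace ℝ (Fin n) → ℝ} (hφ : ContDiff ℝ ∞ φ) (j : Fin n) :
    ContDiff ℝ ∞ (partialD j φ) := by
  unfold partialD
  exact (hφ.fderiv_right (by simp)).clm_apply contDiff_const

theorem hasCompactSupport_partialD {φ : EuclideanSpace ℝ (Fin n) → ℝ} (hφ : HasCompactSupport φ)
    (j : Fin n) : HasCompactSupport (partialD j φ) :=
  (hφ.fderiv ℝ).comp_left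
    (g := fun L : EuclideanSpace ℝ (Fin n) →L[ℝ] ℝ => L (EuclideanSpace.single j 1)) (by simp)

theorem support_partialD_subset (φ : EuclideanSpace ℝ (Fin n) → ℝ) (j : Fin n) :
    Function.support (partialD j φ) ⊆ tsupport φ := fun x hx => by
  by_contra h
  refine hx ?_
  have : fderiv ℝ φ x = 0 := by
    have := mt (fun hy => support_fderiv_subset ℝ (f := φ) hy) h
    simpa using this
  simp [partialD, this]

/-- The pairing with `∂_jφ` is an `L²`-bounded functional of `φ`; Hahn–Banach extends it to all of
`L²(Ω)`, and Riesz represents it with norm at most `M`. -/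
theorem exists_hasWeakPartialD {Ω : Set (EuclideanSpace ℝ (Fin n))}
    (hfin : volume Ω < ⊤) (j : Fin n) {u : EuclideanSpace ℝ (Fin n) → ℝ}
    (hu : MemLp u 2 (volume.restrict Ω)) {M : ℝ} (hM : 0 ≤ M)
    (h : ∀ φ : EuclideanSpace ℝ (Fin n) → ℝ, ContDiff ℝ ∞ φ → HasCompactSupport φ →
      tsupport φ ⊆ Ω → |∫ x in Ω, u x * partialD j φ x| ≤ M * l2Norm Ω φ) :
    ∃ g : EuclideanSpace ℝ (Fin n) → ℝ, MemLp g 2 (volume.restrict Ω) ∧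
      HasWeakPartialD Ω j u g ∧ l2Norm Ω g ≤ M := by
  have : IsFiniteMeasure (volume.restrict Ω) := ⟨by simpa using hfin⟩
  have hmem : ∀ φ : testSpace Ω, MemLp (φ : EuclideanSpace ℝ (Fin n) → ℝ) 2 (volume.restrict Ω) :=
    fun φ => φ.2.1.continuous.memLp_of_hasCompactSupport φ.2.2.1
  have hint : ∀ φ : testSpace Ω, Integrable
      (fun x => u x * partialD j (φ : EuclideanSpace ℝ (Fin n) → ℝ) x) (volume.restrict Ω) :=
    fun φ => hu.integrable_mul (q := 2) ((contDiff_partialD φ.2.1 j).continuous.memLp_of_hasCompactSupport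
      (hasCompactSupport_partialD φ.2.2.1 j))
  have hdiff : ∀ φ : testSpace Ω, Differentiable ℝ (φ : EuclideanSpace ℝ (Fin n) → ℝ) :=
    fun φ => φ.2.1.differentiable (by simp)
  let ι : testSpace Ω →ₗ[ℝ] Lp ℝ 2 (volume.restrict Ω) :=
    { toFun := fun φ => (hmem φ).toLp _
      map_add' := fun φ ψ => MemLp.toLp_add (hmem φ) (hmem ψ)
      map_smul' := fun c φ => MemLp.toLp_const_smul c (hmem φ) }
  let Λ : testSpace Ω →ₗ[ℝ] ℝ :=
    { toFun := fun φ => ∫ x in Ω, u x * partialD j (φ : EuclideanSpace ℝ (Fin n) → ℝ) x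
      map_add' := fun φ ψ => by
        rw [← integral_add (hint φ) (hint ψ)]
        refine integral_congr_ae (ae_of_all _ fun x => ?_)
        simp only [Submodule.coe_add, partialD_add (hdiff φ) (hdiff ψ), Pi.add_apply, mul_add]
      map_smul' := fun c φ => by
        rw [RingHom.id_apply, smul_eq_mul, ← integral_const_mul]
        refine integral_congr_ae (ae_of_all _ fun x => ?_)
        simp only [Submodule.coe_smul, partialD_smul (hdiff φ), Pi.smul_apply, smul_eq_mul]
        ring }
  have hΛ : ∀ φ, |Λ φ| ≤ M * ‖ι φ‖ := fun φ => by
    have h1 := h φ φ.2.1 φ.2.2.1 φ.2.2.2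
    have h2 : ‖ι φ‖ = l2Norm Ω φ := Lp.norm_toLp _ (hmem φ)
    rw [h2]
    exact h1
  have : Module.Free ℝ (LinearMap.range ι) := Module.Free.of_divisionRing ℝ _
  have : Module.Projective ℝ (LinearMap.range ι) := Module.Projective.of_free
  -- Instead of proving `ι` injective, a linear section of `ι` defines the functional on its range.
  -- The bound `hΛ` forces `Λ` to vanish on the kernel of `ι`, so the section chosen is immaterial.
  obtain ⟨σ, hσ⟩ := ι.rangeRestrict.exists_rightInverse_of_surjective ι.range_rangeRestrict
  have hσ' : ∀ v, ι (σ v) = v := fun v => congrArg Subtype.val (LinearMap.congr_fun hσ v)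
  let L : LinearMap.range ι →L[ℝ] ℝ := (Λ ∘ₗ σ).mkContinuous M fun v => by
    have := hΛ (σ v)
    rw [hσ'] at this
    exact this
  have hL : ‖L‖ ≤ M := LinearMap.mkContinuous_norm_le _ hM _
  obtain ⟨T, hT, hTn⟩ := _root_.exists_extension_norm_eq (LinearMap.range ι) L
  have hTι : ∀ φ, T (ι φ) = Λ φ := fun φ => by
    have e1 : T (ι φ) = L ⟨ι φ, φ, rfl⟩ := hT ⟨ι φ, φ, rfl⟩
    rw [e1]
    change Λ (σ ⟨ι φ, φ, rfl⟩) = Λ φ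
    have h1 := hΛ (σ ⟨ι φ, φ, rfl⟩ - φ)
    rw [map_sub, map_sub, hσ', sub_self, norm_zero, mul_zero] at h1
    exact sub_eq_zero.1 (abs_nonpos_iff.1 h1)
  set G := (InnerProductSpace.toDual ℝ (Lp ℝ 2 (volume.restrict Ω))).symm T with hG
  have hGn : ‖G‖ ≤ M := by rw [hG, LinearIsometryEquiv.norm_map, hTn]; exact hL
  have hGmem : MemLp G 2 (volume.restrict Ω) := Lp.memLp G
  -- The sign comes from the integration by parts in the definition of a weak derivative.
  refine ⟨fun x => -G x, hGmem.neg, ⟨?_, ?_, fun φ hφ hφc hφΩ => ?_⟩, ?_⟩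
  · exact IntegrableOn.locallyIntegrableOn (hu.integrable (by norm_num))
  · exact IntegrableOn.locallyIntegrableOn (hGmem.neg.integrable (by norm_num))
  · have h1 := hTι ⟨φ, hφ, hφc, hφΩ⟩
    have h2 : inner ℝ G (ι ⟨φ, hφ, hφc, hφΩ⟩) = T (ι ⟨φ, hφ, hφc, hφΩ⟩) :=
      InnerProductSpace.toDual_symm_apply
    rw [h1, L2.inner_def] at h2
    change _ = ∫ x in Ω, u x * partialD j φ x at h2
    rw [← h2, ← integral_neg]
    refine integral_congr_ae ?_
    filter_upwards [(hmem ⟨φ, hφ, hφc, hφΩ⟩).coeFn_toLp] with x hx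
    change inner ℝ (G x) ((hmem ⟨φ, hφ, hφc, hφΩ⟩).toLp _ x) = _
    rw [hx]
    simp [mul_comm]
  · have : l2Norm Ω (fun x => -G x) = ‖G‖ := by
      rw [l2Norm, Lp.norm_def]
      congr 1
      exact eLpNorm_neg G 2 _
    rw [this]
    exact hGn

end WeakDerivative

/-! ### Choice of the interpolation exponent and the factor `κ` -/

section Kappa

theorem lintegral_rpow_Ioo {a : ℝ} (ha : 0 < a) :
    ∫⁻ s in Set.Ioo (0 : ℝ) 1, ENNReal.ofReal (s ^ (a - 1)) = ENNReal.ofReal (1 / a) := by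
  have hi : IntervalIntegrable (fun s : ℝ => s ^ (a - 1)) volume 0 1 :=
    intervalIntegral.intervalIntegrable_rpow' (by linarith)
  rw [intervalIntegrable_iff_integrableOn_Ioo_of_le zero_le_one] at hi
  rw [← ofReal_integral_eq_lintegral_ofReal hi]
  · rw [← integral_Ioc_eq_integral_Ioo, ← intervalIntegral.integral_of_le zero_le_one,
      integral_rpow (Or.inl (by linarith))]
    simp [ha.ne']
  · exact (ae_restrict_iff' measurableSet_Ioo).2
      (ae_of_all _ fun s hs => Real.rpow_nonneg hs.1.le _)

theorem lintegral_pow_mul_rpow {n ℓ : ℕ} (hℓ : 1 ≤ ℓ) {V l : ℝ} (hV : 1 ≤ V)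
    (h : 0 < (ℓ : ℝ) - n * (l / 2)) :
    ∫⁻ s in Set.Ioo (0 : ℝ) 1,
      ENNReal.ofReal (s ^ (ℓ - 1) * ((s⁻¹ ^ n) ^ (l / 2) * V ^ ((1 - l) / 2))) =
      ENNReal.ofReal (1 / (ℓ - n * (l / 2)) * V ^ ((1 - l) / 2)) := by
  have hV0 : 0 < V := by linarith
  rw [ENNReal.ofReal_mul (by positivity), ← lintegral_rpow_Ioo h, ← lintegral_mul_const' _ _
    ENNReal.ofReal_ne_top]
  refine setLIntegral_congr_fun measurableSet_Ioo fun s hs => ?_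
  have hs0 : 0 < s := hs.1
  rw [← mul_assoc, ENNReal.ofReal_mul (by positivity)]
  congr 2
  rw [← Real.rpow_natCast s⁻¹ n, ← Real.rpow_mul (by positivity), Real.inv_rpow hs0.le,
    ← Real.rpow_neg hs0.le, ← Real.rpow_natCast s, ← Real.rpow_add hs0, Nat.cast_sub hℓ]
  congr 1
  push_cast
  ring

theorem one_le_kappa (n ℓ : ℕ) {V : ℝ} (hV : 1 ≤ V) : 1 ≤ kappa n ℓ V := by
  have h1 := Real.log_nonneg hV
  have h0 : 0 ≤ V := by linarith
  unfold kappa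
  split_ifs
  · exact le_rfl
  · exact le_add_of_nonneg_right (by positivity)
  · exact le_add_of_nonneg_right (by positivity)

/-- The integral equals `V^{(1-l)/2}/(ℓ - nl/2)` whenever the denominator is positive. Increasing
`l` lowers the power of `V` but brings the denominator closer to zero; `l` may depend on `V`. -/
theorem exists_interpolation_exponent {n ℓ : ℕ} (hℓ : 1 ≤ ℓ) :
    ∃ C : ℝ, 0 < C ∧ ∀ V : ℝ, 1 ≤ V → ∃ l : ℝ, 0 ≤ l ∧ l ≤ 1 ∧
      ∫⁻ s in Set.Ioo (0 : ℝ) 1,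
        ENNReal.ofReal (s ^ (ℓ - 1) * ((s⁻¹ ^ n) ^ (l / 2) * V ^ ((1 - l) / 2))) ≤
      ENNReal.ofReal (C * kappa n ℓ V) := by
  have hℓ1 : (1 : ℝ) ≤ ℓ := by exact_mod_cast hℓ
  have hℓ0 : (0 : ℝ) < ℓ := by linarith
  rcases lt_trichotomy n (2 * ℓ) with hn | hn | hn
  · have hn' : (n : ℝ) < 2 * ℓ := by exact_mod_cast hn
    have hp : 0 < (ℓ : ℝ) - n * (1 / 2) := by linarith
    -- When `2ℓ > n` the choice `l = 1` is admissible and removes `V` altogether.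
    refine ⟨1 / (ℓ - n * (1 / 2)), by positivity, fun V hV => ⟨1, zero_le_one, le_rfl, ?_⟩⟩
    rw [lintegral_pow_mul_rpow hℓ hV hp, kappa, if_pos hn]
    simp
  · have hn' : (n : ℝ) = 2 * ℓ := by exact_mod_cast hn
    refine ⟨Real.exp 1, Real.exp_pos 1, fun V hV => ?_⟩
    have hV0 : 0 < V := by linarith
    have hlog := Real.log_nonneg hV
    have hL : 0 < 1 + Real.log V := by linarith
    have hinv : (1 + Real.log V)⁻¹ ≤ 1 := inv_le_one_of_one_le₀ (by linarith)
    -- In the critical case `l = 1` just fails. Backing off by `1/(1 + log V)` keeps the power of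
    -- `V` below `e` and costs one factor `1 + log V`.
    refine ⟨1 - (1 + Real.log V)⁻¹, by linarith, sub_le_self _ (by positivity), ?_⟩
    have e : (ℓ : ℝ) - n * ((1 - (1 + Real.log V)⁻¹) / 2) = ℓ * (1 + Real.log V)⁻¹ := by
      rw [hn']; ring
    rw [lintegral_pow_mul_rpow hℓ hV (by rw [e]; positivity), e]
    refine ENNReal.ofReal_le_ofReal ?_
    have hk : kappa n ℓ V = 1 + Real.log V := by
      have e2 : (n : ℝ) / (2 * ((n : ℝ) - ℓ)) = 1 := by rw [hn']; field_simp; ring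
      rw [kappa, if_neg (by omega), if_pos (Or.inr hn.symm), e2, hn']
      simp
    rw [hk]
    have h1 : V ^ ((1 - (1 - (1 + Real.log V)⁻¹)) / 2) ≤ Real.exp 1 := by
      rw [Real.rpow_def_of_pos hV0, Real.exp_le_exp, sub_sub_cancel]
      have : Real.log V * (1 + Real.log V)⁻¹ ≤ 1 := by
        rw [← div_eq_mul_inv, div_le_one hL]; linarith
      linarith
    have h2 : 1 / ((ℓ : ℝ) * (1 + Real.log V)⁻¹) ≤ 1 + Real.log V := by
      rw [one_div, mul_inv, inv_inv]
      exact mul_le_of_le_one_left hL.le (inv_le_one_of_one_le₀ hℓ1)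
    rw [mul_comm]
    gcongr
  · have hn' : 2 * (ℓ : ℝ) < n := by exact_mod_cast hn
    have hnl : 0 < (n : ℝ) - ℓ := by linarith
    set a : ℝ := ((n : ℝ) - 2 * ℓ) / (2 * ((n : ℝ) - ℓ)) with ha
    have ha0 : 0 < a := div_pos (by linarith) (by linarith)
    have ha1 : a ≤ 1 := by rw [ha, div_le_one (by linarith)]; linarith
    refine ⟨Real.exp 1 * (1 / (ℓ * a)), by positivity, fun V hV => ?_⟩
    have hV0 : 0 < V := by linarith
    have hlog := Real.log_nonneg hV
    have hl1 : (ℓ : ℝ) / (n - ℓ) ≤ 1 := by rw [div_le_one hnl]; linarith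
    -- This `l` lies strictly below the critical `2ℓ/n` and makes `(1 - l)/2` exactly the power `a`
    -- of `V` occurring in `κ`; no logarithm arises.
    refine ⟨ℓ / (n - ℓ), by positivity, hl1, ?_⟩
    have e1 : (1 - (ℓ : ℝ) / (n - ℓ)) / 2 = a := by rw [ha]; field_simp; ring
    have e2 : (ℓ : ℝ) - n * ((ℓ : ℝ) / (n - ℓ) / 2) = ℓ * a := by rw [ha]; field_simp; ring
    rw [lintegral_pow_mul_rpow hℓ hV (by rw [e2]; positivity), e1, e2]
    refine ENNReal.ofReal_le_ofReal ?_
    -- A logarithmic factor is free if `log V ≥ 1`; otherwise `V ≤ e` and the summand one in `κ`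
    -- suffices. The powers of `log V` in both remaining cases are covered at once.
    have key : ∀ b : ℝ, 0 ≤ b → V ^ a ≤ Real.exp 1 * (1 + V ^ a * Real.log V ^ b) := fun b hb => by
      have hVa : 0 ≤ V ^ a := by positivity
      have hexp : 1 ≤ Real.exp 1 := Real.one_le_exp zero_le_one
      rcases le_total 1 (Real.log V) with h1 | h1
      · have h2 : 1 ≤ Real.log V ^ b := Real.one_le_rpow h1 hb
        calc V ^ a ≤ V ^ a * Real.log V ^ b := le_mul_of_one_le_right hVa h2
          _ ≤ 1 + V ^ a * Real.log V ^ b := by linarith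
          _ ≤ _ := le_mul_of_one_le_left (by positivity) hexp
      · have h2 : V ≤ Real.exp 1 := (Real.log_le_iff_le_exp hV0).1 h1
        calc V ^ a ≤ V ^ (1 : ℝ) := Real.rpow_le_rpow_of_exponent_le hV ha1
          _ = V := Real.rpow_one V
          _ ≤ Real.exp 1 := h2
          _ ≤ _ := le_mul_of_one_le_right (Real.exp_pos 1).le
            (le_add_of_nonneg_right (by positivity))
    have hk : V ^ a ≤ Real.exp 1 * kappa n ℓ V := by
      rw [kappa, if_neg (by omega)]
      split_ifs with h3
      · exact key _ (by positivity)
      · refine key _ (div_nonneg (by positivity) ?_)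
        have : ((ℓ : ℝ) + 1) ≤ n := by exact_mod_cast (by omega : ℓ + 1 ≤ n)
        linarith
    calc 1 / ((ℓ : ℝ) * a) * V ^ a ≤ 1 / ((ℓ : ℝ) * a) * (Real.exp 1 * kappa n ℓ V) := by gcongr
      _ = _ := by ring

end Kappa

/-! ### Size and cancellation of the bumps derived from `θ` -/

section Bumps

variable {n : ℕ}

theorem integral_partialD_eq_zero {g : EuclideanSpace ℝ (Fin n) → ℝ} (hg : ContDiff ℝ ∞ g)
    (hc : HasCompactSupport g) (j : Fin n) : ∫ x, partialD j g x = 0 := by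
  have hi : Integrable (partialD j g) := (contDiff_partialD hg j).continuous.integrable_of_hasCompactSupport
    (hasCompactSupport_partialD hc j)
  have hgi : Integrable g := hg.continuous.integrable_of_hasCompactSupport hc
  have h := integral_mul_fderiv_eq_neg_fderiv_mul_of_integrable (𝕜 := ℝ) (μ := volume)
    (f := fun _ : EuclideanSpace ℝ (Fin n) => (1 : ℝ)) (g := g)
    (v := EuclideanSpace.single j (1 : ℝ)) (by simp)
    (by simp only [one_mul]; exact hi) (by simpa using hgi) (fun x _ => by fun_prop)
    (fun x _ => hg.differentiable (by simp) x)
  simpa [partialD] using h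

theorem hasFDerivAt_coord_sub (m : Fin n) (a : ℝ) (x : EuclideanSpace ℝ (Fin n)) :
    HasFDerivAt (fun w : EuclideanSpace ℝ (Fin n) => w m - a)
      (EuclideanSpace.proj m : EuclideanSpace ℝ (Fin n) →L[ℝ] ℝ) x :=
  (EuclideanSpace.proj m : EuclideanSpace ℝ (Fin n) →L[ℝ] ℝ).hasFDerivAt.sub_const a

theorem contDiff_coord_sub_mul {g : EuclideanSpace ℝ (Fin n) → ℝ} (hg : ContDiff ℝ ∞ g)
    (m : Fin n) (a : ℝ) : ContDiff ℝ ∞ fun w : EuclideanSpace ℝ (Fin n) => (w m - a) * g w :=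
  (((EuclideanSpace.proj m : EuclideanSpace ℝ (Fin n) →L[ℝ] ℝ).contDiff).sub contDiff_const).mul hg

theorem hasCompactSupport_coord_sub_mul {g : EuclideanSpace ℝ (Fin n) → ℝ}
    (hg : HasCompactSupport g) (m : Fin n) (a : ℝ) :
    HasCompactSupport fun w : EuclideanSpace ℝ (Fin n) => (w m - a) * g w :=
  hg.mul_left (f := fun w : EuclideanSpace ℝ (Fin n) => w m - a)

theorem partialD_coord_sub_mul {g : EuclideanSpace ℝ (Fin n) → ℝ} (hg : Differentiable ℝ g)
    (k m : Fin n) (a : ℝ) (x : EuclideanSpace ℝ (Fin n)) :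
    partialD k (fun w : EuclideanSpace ℝ (Fin n) => (w m - a) * g w) x =
      (if k = m then 1 else 0) * g x + (x m - a) * partialD k g x := by
  have h : HasFDerivAt (fun w : EuclideanSpace ℝ (Fin n) => (w m - a) * g w) _ x :=
    (hasFDerivAt_coord_sub m a x).mul (hg x).hasFDerivAt
  rw [partialD, h.fderiv, partialD]
  by_cases hkm : k = m
  · subst hkm
    simp [add_comm]
  · simp [hkm, Ne.symm hkm]

theorem abs_coord_sub_le (x y : EuclideanSpace ℝ (Fin n)) (m : Fin n) : |x m - y m| ≤ ‖x - y‖ := by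
  simpa using PiLp.norm_apply_le (x - y) m

/-- An explicit majorant of the derivatives of order at most two. -/
noncomputable def bumpConst (K : List (Fin n) → ℝ) : ℝ :=
  3 * (1 + |K []| + ∑ k, |K [k]| + ∑ k, ∑ l, |K [k, l]|)

theorem bumpConst_pos (K : List (Fin n) → ℝ) : 0 < bumpConst K := by
  unfold bumpConst; positivity

theorem abs_le_bumpConst_zero (K : List (Fin n) → ℝ) : |K []| ≤ bumpConst K / 3 := by
  have h1 : 0 ≤ ∑ k, |K [k]| := by positivity
  have h2 : 0 ≤ ∑ k, ∑ l, |K [k, l]| := by positivity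
  unfold bumpConst; linarith

theorem abs_le_bumpConst_one (K : List (Fin n) → ℝ) (k : Fin n) : |K [k]| ≤ bumpConst K / 3 := by
  have h1 : |K [k]| ≤ ∑ k, |K [k]| :=
    Finset.single_le_sum (f := fun k => |K [k]|) (fun _ _ => abs_nonneg _) (Finset.mem_univ k)
  have h2 : 0 ≤ ∑ k, ∑ l, |K [k, l]| := by positivity
  have := abs_nonneg (K [])
  unfold bumpConst; linarith

theorem abs_le_bumpConst_two (K : List (Fin n) → ℝ) (k l : Fin n) :
    |K [k, l]| ≤ bumpConst K / 3 := by
  have h1 : 0 ≤ ∑ k, |K [k]| := by positivity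
  have h2 : |K [k, l]| ≤ ∑ l, |K [k, l]| :=
    Finset.single_le_sum (f := fun l => |K [k, l]|) (fun _ _ => abs_nonneg _) (Finset.mem_univ l)
  have h3 : ∑ l, |K [k, l]| ≤ ∑ k, ∑ l, |K [k, l]| :=
    Finset.single_le_sum (f := fun k => ∑ l, |K [k, l]|)
      (fun _ _ => Finset.sum_nonneg fun _ _ => abs_nonneg _) (Finset.mem_univ k)
  have := abs_nonneg (K [])
  unfold bumpConst; linarith

variable {K : List (Fin n) → ℝ} {c : EuclideanSpace ℝ (Fin n)} {r : ℝ}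
  {θ : EuclideanSpace ℝ (Fin n) → ℝ}

/-- The index `j` witnesses that the dimension is positive; in dimension zero the ball has diameter
zero. -/
theorem diam_ball_pos (hr : 0 < r) (j : Fin n) : 0 < Metric.diam (Metric.ball c r) := by
  have : Nonempty (Fin n) := ⟨j⟩
  rw [Metric.diam_ball_eq c hr.le]; positivity

theorem norm_sub_le_diam_ball (hr : 0 < r) {w : EuclideanSpace ℝ (Fin n)}
    (hw : w ∈ Metric.ball c r) : ‖w - c‖ ≤ Metric.diam (Metric.ball c r) := by
  rw [← dist_eq_norm]
  exact Metric.dist_le_diam_of_mem Metric.isBounded_ball hw (Metric.mem_ball_self hr)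

theorem IsScaledBump.mem_of_ne_zero (h : IsScaledBump K (Metric.ball c r) θ)
    {w : EuclideanSpace ℝ (Fin n)} (hw : θ w ≠ 0) : w ∈ Metric.ball c r :=
  h.tsupport_subset (subset_tsupport _ hw)

theorem IsScaledBump.mem_of_partialD_ne_zero (h : IsScaledBump K (Metric.ball c r) θ) {j : Fin n}
    {w : EuclideanSpace ℝ (Fin n)} (hw : partialD j θ w ≠ 0) : w ∈ Metric.ball c r :=
  h.tsupport_subset (support_partialD_subset θ j hw)

theorem IsScaledBump.mem_of_partialD_partialD_ne_zero (h : IsScaledBump K (Metric.ball c r) θ)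
    {j k : Fin n} {w : EuclideanSpace ℝ (Fin n)} (hw : partialD k (partialD j θ) w ≠ 0) :
    w ∈ Metric.ball c r :=
  h.tsupport_subset (closure_minimal (support_partialD_subset θ j) (isClosed_tsupport θ)
    (support_partialD_subset (partialD j θ) k hw))

theorem IsScaledBump.integral_abs_le (h : IsScaledBump K (Metric.ball c r) θ) :
    ∫ x, |θ x| ≤ bumpConst K / 3 := by
  have := h.l1_bound []
  simp only [iteratedPartialD, List.foldr_nil, List.length_nil, pow_zero, div_one] at this
  exact this.trans ((le_abs_self _).trans (abs_le_bumpConst_zero K))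

theorem IsScaledBump.abs_le (h : IsScaledBump K (Metric.ball c r) θ)
    (x : EuclideanSpace ℝ (Fin n)) :
    |θ x| ≤ bumpConst K / 3 * (1 / Metric.diam (Metric.ball c r) ^ n) := by
  have := h.linfty_bound [] x
  simp only [iteratedPartialD, List.foldr_nil, List.length_nil, add_zero] at this
  rw [mul_one_div]
  exact this.trans (div_le_div_of_nonneg_right ((le_abs_self _).trans (abs_le_bumpConst_zero K))
    (pow_nonneg Metric.diam_nonneg _))

theorem IsScaledBump.integral_abs_partialD_le (h : IsScaledBump K (Metric.ball c r) θ)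
    (j : Fin n) : ∫ x, |partialD j θ x| ≤ bumpConst K / 3 / Metric.diam (Metric.ball c r) := by
  have := h.l1_bound [j]
  simp only [iteratedPartialD, List.foldr_nil, List.foldr_cons, List.length_cons, List.length_nil,
    zero_add, pow_one] at this
  exact this.trans (div_le_div_of_nonneg_right ((le_abs_self _).trans (abs_le_bumpConst_one K j))
    Metric.diam_nonneg)

theorem IsScaledBump.abs_partialD_le (h : IsScaledBump K (Metric.ball c r) θ)
    (j : Fin n) (x : EuclideanSpace ℝ (Fin n)) :
    |partialD j θ x| ≤ bumpConst K / 3 / Metric.diam (Metric.ball c r) *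
      (1 / Metric.diam (Metric.ball c r) ^ n) := by
  have := h.linfty_bound [j] x
  simp only [iteratedPartialD, List.foldr_nil, List.foldr_cons, List.length_cons, List.length_nil,
    zero_add] at this
  rw [mul_one_div, div_div, ← pow_succ']
  exact this.trans (div_le_div_of_nonneg_right ((le_abs_self _).trans (abs_le_bumpConst_one K j))
    (pow_nonneg Metric.diam_nonneg _))

theorem IsScaledBump.integral_abs_partialD_partialD_le (h : IsScaledBump K (Metric.ball c r) θ)
    (k j : Fin n) : ∫ x, |partialD k (partialD j θ) x| ≤
      bumpConst K / 3 / Metric.diam (Metric.ball c r) / Metric.diam (Metric.ball c r) := by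
  have := h.l1_bound [k, j]
  simp only [iteratedPartialD, List.foldr_nil, List.foldr_cons, List.length_cons, List.length_nil,
    zero_add] at this
  rw [div_div, ← sq]
  exact this.trans (div_le_div_of_nonneg_right ((le_abs_self _).trans (abs_le_bumpConst_two K k j))
    (pow_nonneg Metric.diam_nonneg _))

/-- The length scale is the diameter rather than the radius, matching the normalisation of `θ`; one
derivative makes the size `1/ρ`. -/
theorem IsScaledBump.isMeanZeroBump_partialD (h : IsScaledBump K (Metric.ball c r) θ) (hr : 0 < r)
    (j : Fin n) :
    IsMeanZeroBump c (Metric.diam (Metric.ball c r))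
      (bumpConst K / Metric.diam (Metric.ball c r)) (partialD j θ) where
  contDiff := contDiff_partialD h.contDiff j
  hasCompactSupport := hasCompactSupport_partialD h.hasCompactSupport j
  dist_le := fun _ hw => norm_sub_le_diam_ball hr (h.mem_of_partialD_ne_zero hw)
  integral_eq_zero := integral_partialD_eq_zero h.contDiff h.hasCompactSupport j
  l1_bound := (h.integral_abs_partialD_le j).trans (by
    have := bumpConst_pos K
    have := diam_ball_pos (c := c) hr j
    gcongr; linarith)
  l1_deriv_bound := fun k => (h.integral_abs_partialD_partialD_le k j).trans (by
    have := bumpConst_pos K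
    have := diam_ball_pos (c := c) hr j
    gcongr; linarith)

theorem integral_abs_coord_mul_le (hr : 0 < r) {g : EuclideanSpace ℝ (Fin n) → ℝ}
    (hgi : Integrable g) (hg : ∀ w, g w ≠ 0 → w ∈ Metric.ball c r) (m : Fin n) :
    ∫ w, |(w m - c m) * g w| ≤ Metric.diam (Metric.ball c r) * ∫ w, |g w| := by
  rw [← integral_const_mul]
  refine integral_mono_of_nonneg (ae_of_all _ fun w => abs_nonneg _) (hgi.abs.const_mul _)
    (ae_of_all _ fun w => ?_)
  simp only [abs_mul]
  by_cases hw : g w = 0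
  · simp [hw]
  gcongr
  exact (abs_coord_sub_le w c m).trans (norm_sub_le_diam_ball hr (hg w hw))

/-- The factor `w_m - c_m`, at most `ρ` on the support, offsets one derivative, so the size carries
no `1/ρ`. The derivative of this bump has three terms, each of size `bumpConst K / 3 / ρ`, which is
the reason for the factor three in `bumpConst`. -/
theorem IsScaledBump.isMeanZeroBump_partialD_coord_mul (h : IsScaledBump K (Metric.ball c r) θ)
    (hr : 0 < r) (j m : Fin n) :
    IsMeanZeroBump c (Metric.diam (Metric.ball c r)) (bumpConst K)
      (partialD j fun w => (w m - c m) * θ w) where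
  contDiff := contDiff_partialD (contDiff_coord_sub_mul h.contDiff m _) j
  hasCompactSupport :=
    hasCompactSupport_partialD (hasCompactSupport_coord_sub_mul h.hasCompactSupport m _) j
  dist_le := fun w hw => by
    refine norm_sub_le_diam_ball hr ?_
    rw [partialD_coord_sub_mul (h.contDiff.differentiable (by simp))] at hw
    by_contra hB
    have h1 : θ w = 0 := not_not.1 fun h' => hB (h.mem_of_ne_zero h')
    have h2 : partialD j θ w = 0 := not_not.1 fun h' => hB (h.mem_of_partialD_ne_zero h')
    exact hw (by rw [h1, h2]; simp)
  integral_eq_zero := integral_partialD_eq_zero (contDiff_coord_sub_mul h.contDiff m _)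
    (hasCompactSupport_coord_sub_mul h.hasCompactSupport m _) j
  l1_bound := by
    have hρ := diam_ball_pos (c := c) hr j
    have hA := bumpConst_pos K
    have i0 : Integrable θ := h.contDiff.continuous.integrable_of_hasCompactSupport
      h.hasCompactSupport
    have d1 := contDiff_partialD h.contDiff j
    have i1 : Integrable (partialD j θ) := d1.continuous.integrable_of_hasCompactSupport
      (hasCompactSupport_partialD h.hasCompactSupport j)
    have i1' : Integrable fun w : EuclideanSpace ℝ (Fin n) => (w m - c m) * partialD j θ w :=
      (contDiff_coord_sub_mul d1 m _).continuous.integrable_of_hasCompactSupport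
        (hasCompactSupport_coord_sub_mul (hasCompactSupport_partialD h.hasCompactSupport j) m _)
    calc ∫ w, |partialD j (fun w => (w m - c m) * θ w) w|
        ≤ ∫ w, (|θ w| + |(w m - c m) * partialD j θ w|) := by
          refine integral_mono_of_nonneg (ae_of_all _ fun w => abs_nonneg _)
            (i0.abs.add i1'.abs) (ae_of_all _ fun w => ?_)
          simp only
          rw [partialD_coord_sub_mul (h.contDiff.differentiable (by simp))]
          refine (abs_add_le _ _).trans (add_le_add ?_ le_rfl)
          split_ifs <;> simp
      _ = (∫ w, |θ w|) + ∫ w, |(w m - c m) * partialD j θ w| := integral_add i0.abs i1'.abs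
      _ ≤ bumpConst K / 3 + Metric.diam (Metric.ball c r) *
          (bumpConst K / 3 / Metric.diam (Metric.ball c r)) := by
          refine add_le_add h.integral_abs_le ((integral_abs_coord_mul_le hr i1
            (fun w hw => h.mem_of_partialD_ne_zero hw) m).trans ?_)
          gcongr
          exact h.integral_abs_partialD_le j
      _ ≤ bumpConst K := by rw [mul_div_cancel₀ _ hρ.ne']; linarith
  l1_deriv_bound := fun k => by
    have hρ := diam_ball_pos (c := c) hr j
    have hA := bumpConst_pos K
    have d0 : Differentiable ℝ θ := h.contDiff.differentiable (by simp)
    have d1 := contDiff_partialD h.contDiff j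
    have c1 := hasCompactSupport_partialD h.hasCompactSupport j
    have d2 := contDiff_partialD d1 k
    have c2 := hasCompactSupport_partialD c1 k
    have i0 : ∀ k, Integrable (partialD k θ) := fun k =>
      (contDiff_partialD h.contDiff k).continuous.integrable_of_hasCompactSupport
        (hasCompactSupport_partialD h.hasCompactSupport k)
    have i2 : Integrable (partialD k (partialD j θ)) :=
      d2.continuous.integrable_of_hasCompactSupport c2
    have i2' : Integrable fun w : EuclideanSpace ℝ (Fin n) =>
        (w m - c m) * partialD k (partialD j θ) w :=
      (contDiff_coord_sub_mul d2 m _).continuous.integrable_of_hasCompactSupport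
        (hasCompactSupport_coord_sub_mul c2 m _)
    have e : (partialD j fun w => (w m - c m) * θ w) =
        ((if j = m then 1 else 0 : ℝ) • θ) + fun w => (w m - c m) * partialD j θ w := by
      ext w
      rw [partialD_coord_sub_mul d0]
      rfl
    have e2 : ∀ w, partialD k (partialD j fun w => (w m - c m) * θ w) w =
        (if j = m then 1 else 0) * partialD k θ w + ((if k = m then 1 else 0) * partialD j θ w +
          (w m - c m) * partialD k (partialD j θ) w) := fun w => by
      rw [e, partialD_add (d0.const_smul _)
        ((contDiff_coord_sub_mul d1 m _).differentiable (by simp)), partialD_smul d0, Pi.add_apply,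
        partialD_coord_sub_mul (d1.differentiable (by simp))]
      rfl
    have hδ : ∀ (p : Prop) [Decidable p] (a : ℝ), |(if p then 1 else 0) * a| ≤ |a| := by
      intro p _ a
      split_ifs <;> simp
    calc ∫ w, |partialD k (partialD j fun w => (w m - c m) * θ w) w|
        ≤ ∫ w, (|partialD k θ w| + (|partialD j θ w| +
            |(w m - c m) * partialD k (partialD j θ) w|)) := by
          refine integral_mono_of_nonneg (ae_of_all _ fun w => abs_nonneg _)
            ((i0 k).abs.add ((i0 j).abs.add i2'.abs)) (ae_of_all _ fun w => ?_)
          simp only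
          rw [e2]
          exact (abs_add_le _ _).trans (add_le_add (hδ _ _)
            ((abs_add_le _ _).trans (add_le_add (hδ _ _) le_rfl)))
      _ = (∫ w, |partialD k θ w|) + ((∫ w, |partialD j θ w|) +
            ∫ w, |(w m - c m) * partialD k (partialD j θ) w|) := by
          have i3 : Integrable fun w => |partialD j θ w| +
              |(w m - c m) * partialD k (partialD j θ) w| := (i0 j).abs.add i2'.abs
          rw [integral_add (i0 k).abs i3, integral_add (i0 j).abs i2'.abs]
      _ ≤ bumpConst K / 3 / Metric.diam (Metric.ball c r) +
          (bumpConst K / 3 / Metric.diam (Metric.ball c r) + Metric.diam (Metric.ball c r) *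
          (bumpConst K / 3 / Metric.diam (Metric.ball c r) / Metric.diam (Metric.ball c r))) := by
          refine add_le_add (h.integral_abs_partialD_le k) (add_le_add
            (h.integral_abs_partialD_le j) ((integral_abs_coord_mul_le hr i2
            (fun w hw => h.mem_of_partialD_partialD_ne_zero hw) m).trans ?_))
          gcongr
          exact h.integral_abs_partialD_partialD_le k j
      _ = bumpConst K / Metric.diam (Metric.ball c r) := by
          rw [mul_div_cancel₀ _ hρ.ne']; ring

theorem IsScaledBump.abs_partialD_coord_mul_le (h : IsScaledBump K (Metric.ball c r) θ)
    (hr : 0 < r) (j m : Fin n) (x : EuclideanSpace ℝ (Fin n)) :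
    |partialD j (fun w => (w m - c m) * θ w) x| ≤
      bumpConst K * (1 / Metric.diam (Metric.ball c r) ^ n) := by
  have hρ := diam_ball_pos (c := c) hr j
  have hA := bumpConst_pos K
  rw [partialD_coord_sub_mul (h.contDiff.differentiable (by simp))]
  have h1 : |(if j = m then 1 else 0) * θ x| ≤ |θ x| := by split_ifs <;> simp
  have h2 : |(x m - c m) * partialD j θ x| ≤
      Metric.diam (Metric.ball c r) * |partialD j θ x| := by
    rw [abs_mul]
    by_cases hw : partialD j θ x = 0
    · simp [hw]
    gcongr
    exact (abs_coord_sub_le x c m).trans (norm_sub_le_diam_ball hr (h.mem_of_partialD_ne_zero hw))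
  have h3 := h.abs_le x
  have h4 : Metric.diam (Metric.ball c r) * |partialD j θ x| ≤
      bumpConst K / 3 * (1 / Metric.diam (Metric.ball c r) ^ n) := by
    refine (mul_le_mul_of_nonneg_left (h.abs_partialD_le j x) hρ.le).trans (le_of_eq ?_)
    field_simp
  have h5 : 0 ≤ bumpConst K * (1 / Metric.diam (Metric.ball c r) ^ n) := by positivity
  refine (abs_add_le _ _).trans ?_
  have : bumpConst K / 3 * (1 / Metric.diam (Metric.ball c r) ^ n) =
    bumpConst K * (1 / Metric.diam (Metric.ball c r) ^ n) / 3 := by ring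
  linarith

end Bumps

/-! ### Absolute convergence, square integrability and Fubini -/

section Convergence

variable {n : ℕ}

theorem IsStarShapedWrt.smul_add_smul_mem {Ω B : Set (EuclideanSpace ℝ (Fin n))}
    (h : IsStarShapedWrt Ω B) {x w : EuclideanSpace ℝ (Fin n)} (hx : x ∈ Ω) (hw : w ∈ B) {s : ℝ}
    (h0 : 0 ≤ s) (h1 : s ≤ 1) : s • x + (1 - s) • w ∈ Ω := by
  refine h.2 x hx ?_
  exact (convex_convexHull ℝ (B ∪ {x})) (subset_convexHull ℝ _ (Or.inr rfl))
    (subset_convexHull ℝ _ (Or.inl hw)) h0 (by linarith) (by ring)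

/-- The full integrand of the reduced Poincaré operator. -/
noncomputable def fullIntegrand (ℓ : ℕ) (m : Fin n) (θ F : EuclideanSpace ℝ (Fin n) → ℝ)
    (x : EuclideanSpace ℝ (Fin n)) (p : ℝ × EuclideanSpace ℝ (Fin n)) : ℝ :=
  p.1 ^ (ℓ - 1) * poincareIntegrand m θ F x p.1 p.2 * (1 / (1 - p.1) ^ n)

/-- If the kernel does not vanish then `w ∈ B`, and `y` lies on the segment from `x` to `w`, hence
in `Ω`. So only the values of `f` in `Ω` matter. -/
theorem poincareIntegrand_congr {m : Fin n} {θ F G : EuclideanSpace ℝ (Fin n) → ℝ}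
    {Ω B : Set (EuclideanSpace ℝ (Fin n))} (h : IsStarShapedWrt Ω B)
    (hθ : ∀ w, θ w ≠ 0 → w ∈ B) {x : EuclideanSpace ℝ (Fin n)} (hx : x ∈ Ω) {s : ℝ} (h0 : 0 < s)
    (h1 : s < 1) {y : EuclideanSpace ℝ (Fin n)} (hFG : y ∈ Ω → F y = G y) :
    poincareIntegrand m θ F x s y = poincareIntegrand m θ G x s y := by
  unfold poincareIntegrand
  by_cases hw : θ (segEnd x s y) = 0
  · have : θ (x + (1 - s)⁻¹ • (y - x)) = 0 := hw
    simp [this]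
  · have := h.smul_add_smul_mem hx (hθ _ hw) h0.le h1.le
    rw [smul_add_smul_segEnd x h1] at this
    rw [hFG this]

theorem coord_sub_div_eq (m : Fin n) (x : EuclideanSpace ℝ (Fin n)) {s : ℝ} (h1 : s < 1)
    (y : EuclideanSpace ℝ (Fin n)) : (x m - y m) / (1 - s) = x m - segEnd x s y m := by
  have h : 1 - s ≠ 0 := by linarith
  simp only [segEnd, PiLp.add_apply, PiLp.smul_apply, PiLp.sub_apply, smul_eq_mul]
  field_simp
  ring

/-- The quotient `(x_m - y_m)/(1 - s)` is `x_m - w_m` with both points in `Ω`, so the operator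
itself, unlike its derivative, has no singularity at `s = 1`. -/
theorem enorm_fullIntegrand_le {ℓ : ℕ} {m : Fin n} {θ F : EuclideanSpace ℝ (Fin n) → ℝ}
    {Ω B : Set (EuclideanSpace ℝ (Fin n))} (hΩ : Bornology.IsBounded Ω) (hB : B ⊆ Ω)
    (hθ : ∀ w, θ w ≠ 0 → w ∈ B) {x : EuclideanSpace ℝ (Fin n)} (hx : x ∈ Ω)
    {p : ℝ × EuclideanSpace ℝ (Fin n)} (h0 : 0 < p.1) (h1 : p.1 < 1) :
    ‖fullIntegrand ℓ m θ F x p‖ₑ ≤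
      ENNReal.ofReal (Metric.diam Ω) * (segKernel θ p.1 x p.2 * ‖F p.2‖ₑ) := by
  obtain ⟨s, y⟩ := p
  simp only at h0 h1 ⊢
  have ht : 0 < 1 - s := by linarith
  have e : fullIntegrand ℓ m θ F x (s, y) =
      (s ^ (ℓ - 1) * (x m - segEnd x s y m)) * (θ (segEnd x s y) * (1 / (1 - s) ^ n) * F y) := by
    rw [← coord_sub_div_eq m x h1]
    unfold fullIntegrand poincareIntegrand segEnd
    ring
  by_cases hw : θ (segEnd x s y) = 0
  · rw [e, hw]; simp
  rw [e, enorm_mul, enorm_mul (_ * _) (F y), enorm_mul (θ _), segKernel,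
    Real.enorm_of_nonneg (show (0 : ℝ) ≤ 1 / (1 - s) ^ n by positivity)]
  gcongr
  rw [Real.enorm_eq_ofReal_abs]
  refine ENNReal.ofReal_le_ofReal ?_
  rw [abs_mul, abs_of_nonneg (by positivity)]
  refine (mul_le_of_le_one_left (abs_nonneg _) (pow_le_one₀ h0.le h1.le)).trans ?_
  refine (abs_coord_sub_le _ _ m).trans ?_
  rw [← dist_eq_norm]
  exact Metric.dist_le_diam_of_mem hΩ hx (hB (hθ _ hw))

theorem measurable_fullIntegrand {ℓ : ℕ} {m : Fin n} {θ F : EuclideanSpace ℝ (Fin n) → ℝ}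
    (hθ : Measurable θ) (hF : Measurable F) :
    Measurable fun q : EuclideanSpace ℝ (Fin n) × ℝ × EuclideanSpace ℝ (Fin n) =>
      fullIntegrand ℓ m θ F q.1 q.2 := by
  unfold fullIntegrand poincareIntegrand
  have h1 : Measurable fun q : EuclideanSpace ℝ (Fin n) × ℝ × EuclideanSpace ℝ (Fin n) =>
      θ (q.1 + (1 - q.2.1)⁻¹ • (q.2.2 - q.1)) := hθ.comp measurable_segEnd
  have h2 : Measurable fun q : EuclideanSpace ℝ (Fin n) × ℝ × EuclideanSpace ℝ (Fin n) =>
      F q.2.2 := hF.comp (measurable_snd.comp measurable_snd)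
  exact (Measurable.mul (by fun_prop) ((h1.mul (by fun_prop)).mul h2)).mul (by fun_prop)

/-- The measure `ds dy` on `(0, 1) × ℝⁿ`. -/
noncomputable abbrev stripMeasure (n : ℕ) : Measure (ℝ × EuclideanSpace ℝ (Fin n)) :=
  (volume.restrict (Set.Ioo (0 : ℝ) 1)).prod volume

theorem ae_stripMeasure_fst (n : ℕ) : ∀ᵐ p ∂stripMeasure n, p.1 ∈ Set.Ioo (0 : ℝ) 1 :=
  Measure.quasiMeasurePreserving_fst.ae (ae_restrict_mem measurableSet_Ioo)

theorem lintegral_stripMeasure_snd {g : EuclideanSpace ℝ (Fin n) → ℝ≥0∞} (hg : Measurable g) :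
    ∫⁻ p, g p.2 ∂stripMeasure n = ∫⁻ y, g y := by
  have hm : Measurable fun p : ℝ × EuclideanSpace ℝ (Fin n) => g p.2 := hg.comp measurable_snd
  rw [lintegral_prod _ hm.aemeasurable]
  simp

theorem lintegral_stripMeasure_segKernel {θ : EuclideanSpace ℝ (Fin n) → ℝ} (hθ : Measurable θ)
    (x : EuclideanSpace ℝ (Fin n)) :
    ∫⁻ p, segKernel θ p.1 x p.2 ∂stripMeasure n = ∫⁻ w, ‖θ w‖ₑ := by
  have hm : Measurable fun p : ℝ × EuclideanSpace ℝ (Fin n) => segKernel θ p.1 x p.2 := by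
    have := (measurable_segKernel hθ).comp (measurable_const (a := x) |>.prodMk measurable_id)
    exact this
  rw [lintegral_prod _ hm.aemeasurable]
  calc _ = ∫⁻ _s in Set.Ioo (0 : ℝ) 1, ∫⁻ w, ‖θ w‖ₑ :=
        setLIntegral_congr_fun measurableSet_Ioo fun s hs => lintegral_segKernel_right θ hs.2 x
    _ = _ := by simp

/-- The sup bound is used for `s ≤ 1/2` and the `L¹` bound for `s ≥ 1/2`, each costing at most `2ⁿ`.
-/
theorem setLIntegral_segKernel_left_le_uniform {θ : EuclideanSpace ℝ (Fin n) → ℝ} {M : ℝ}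
    (hM : ∀ w, |θ w| ≤ M) (Ω : Set (EuclideanSpace ℝ (Fin n))) {s : ℝ} (h0 : 0 < s) (h1 : s < 1)
    (y : EuclideanSpace ℝ (Fin n)) :
    ∫⁻ x in Ω, segKernel θ s x y ≤
      ENNReal.ofReal (2 ^ n) * (ENNReal.ofReal M * volume Ω + ∫⁻ w, ‖θ w‖ₑ) := by
  rcases le_total s (1 / 2) with h | h
  · refine (setLIntegral_segKernel_left_le hM Ω s y).trans ?_
    rw [mul_comm (ENNReal.ofReal M), mul_assoc]
    gcongr
    · rw [← one_div_pow]
      refine pow_le_pow_left₀ (one_div_nonneg.2 (by linarith)) ?_ n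
      rw [div_le_iff₀ (by linarith)]; linarith
    · exact le_self_add
  · refine (setLIntegral_le_lintegral _ _).trans ?_
    rw [lintegral_segKernel_left θ h0 h1]
    gcongr
    · rw [inv_le_comm₀ h0 (by norm_num)]; linarith
    · exact le_add_self

variable {ℓ : ℕ} {m : Fin n} {θ F : EuclideanSpace ℝ (Fin n) → ℝ}
    {Ω : Set (EuclideanSpace ℝ (Fin n))}

/-- Finite row and column bounds for the kernel with `(s, y)` as a single variable; only finiteness
is used. -/
theorem schur_stripMeasure_bounds (hθc : Continuous θ) (hθi : Integrable θ)
    (hΩfin : volume Ω < ⊤) {M : ℝ} (hM : ∀ w, |θ w| ≤ M) :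
    ∃ A B : ℝ≥0∞, A ≠ ⊤ ∧ B ≠ ⊤ ∧
      (∀ᵐ x ∂(volume.restrict Ω), ∫⁻ p, segKernel θ p.1 x p.2 ∂stripMeasure n ≤ A) ∧
      (∀ᵐ p ∂stripMeasure n, ∫⁻ x in Ω, segKernel θ p.1 x p.2 ≤ B) := by
  have hfin : ∫⁻ w, ‖θ w‖ₑ ≠ ⊤ := hθi.2.ne
  refine ⟨∫⁻ w, ‖θ w‖ₑ, ENNReal.ofReal (2 ^ n) * (ENNReal.ofReal M * volume Ω + ∫⁻ w, ‖θ w‖ₑ),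
    hfin, ?_, ae_of_all _ fun x => (lintegral_stripMeasure_segKernel hθc.measurable x).le, ?_⟩
  · have := hΩfin.ne
    finiteness
  · filter_upwards [ae_stripMeasure_fst n] with p hp
    exact setLIntegral_segKernel_left_le_uniform hM Ω hp.1 hp.2 p.2

theorem measurable_segKernel_strip (hθ : Measurable θ) :
    Measurable (Function.uncurry fun (x : EuclideanSpace ℝ (Fin n))
      (p : ℝ × EuclideanSpace ℝ (Fin n)) => segKernel θ p.1 x p.2) := measurable_segKernel hθ

theorem lintegral_sq_segKernel_lt_top (hθc : Continuous θ) (hθi : Integrable θ)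
    (hΩfin : volume Ω < ⊤) {M : ℝ} (hM : ∀ w, |θ w| ≤ M) (hF : Measurable F)
    (hF2 : MemLp F 2 volume) :
    ∫⁻ x in Ω, (∫⁻ p, segKernel θ p.1 x p.2 * ‖F p.2‖ₑ ∂stripMeasure n) ^ 2 < ⊤ := by
  obtain ⟨A, B, hA, hB, h1, h2⟩ := schur_stripMeasure_bounds hθc hθi hΩfin hM
  refine (lintegral_sq_lintegral_mul_le (ν := stripMeasure n)
    (F := fun p => ‖F p.2‖ₑ) (measurable_segKernel_strip hθc.measurable)
    (hF.comp measurable_snd).enorm h1 h2).trans_lt ?_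
  have e : ∫⁻ p, ‖F p.2‖ₑ ^ 2 ∂stripMeasure n = ∫⁻ y, ‖F y‖ₑ ^ 2 :=
    lintegral_stripMeasure_snd (g := fun y => ‖F y‖ₑ ^ 2) (hF.enorm.pow_const 2)
  have hf : ∫⁻ y, ‖F y‖ₑ ^ 2 ≠ ⊤ := by
    have := hF2.2
    rw [eLpNorm_two_eq] at this
    exact (ENNReal.rpow_lt_top_iff_of_pos (by norm_num)).1 this |>.ne
  rw [e]
  finiteness

theorem ae_segKernel_lt_top (hθc : Continuous θ) (hθi : Integrable θ)
    (hΩfin : volume Ω < ⊤) {M : ℝ} (hM : ∀ w, |θ w| ≤ M) (hF : Measurable F)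
    (hF2 : MemLp F 2 volume) :
    ∀ᵐ x ∂(volume.restrict Ω), ∫⁻ p, segKernel θ p.1 x p.2 * ‖F p.2‖ₑ ∂stripMeasure n < ⊤ := by
  have hm : Measurable fun x => ∫⁻ p, segKernel θ p.1 x p.2 * ‖F p.2‖ₑ ∂stripMeasure n :=
    Measurable.lintegral_prod_right' (f := fun q : EuclideanSpace ℝ (Fin n) × ℝ ×
      EuclideanSpace ℝ (Fin n) => segKernel θ q.2.1 q.1 q.2.2 * ‖F q.2.2‖ₑ)
      ((measurable_segKernel hθc.measurable).mul
        (hF.comp (measurable_snd.comp measurable_snd)).enorm)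
  have := ae_lt_top (hm.pow_const 2) (lintegral_sq_segKernel_lt_top hθc hθi hΩfin hM hF hF2).ne
  filter_upwards [this] with x hx
  exact (ENNReal.pow_lt_top_iff.1 hx).resolve_right (by norm_num)

variable {B : Set (EuclideanSpace ℝ (Fin n))}

theorem lintegral_enorm_fullIntegrand_le (hΩb : Bornology.IsBounded Ω) (hB : B ⊆ Ω)
    (hθ : ∀ w, θ w ≠ 0 → w ∈ B) {x : EuclideanSpace ℝ (Fin n)} (hx : x ∈ Ω) :
    ∫⁻ p, ‖fullIntegrand ℓ m θ F x p‖ₑ ∂stripMeasure n ≤ ENNReal.ofReal (Metric.diam Ω) *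
      ∫⁻ p, segKernel θ p.1 x p.2 * ‖F p.2‖ₑ ∂stripMeasure n := by
  rw [← lintegral_const_mul' _ _ ENNReal.ofReal_ne_top]
  refine lintegral_mono_ae ?_
  filter_upwards [ae_stripMeasure_fst n] with p hp
  exact enorm_fullIntegrand_le hΩb hB hθ hx hp.1 hp.2

theorem ae_integrable_fullIntegrand (hΩ : MeasurableSet Ω) (hΩb : Bornology.IsBounded Ω)
    (hB : B ⊆ Ω) (hθ : ∀ w, θ w ≠ 0 → w ∈ B) (hθc : Continuous θ) (hθi : Integrable θ) {M : ℝ}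
    (hM : ∀ w, |θ w| ≤ M) (hF : Measurable F) (hF2 : MemLp F 2 volume) :
    ∀ᵐ x ∂(volume.restrict Ω), Integrable (fullIntegrand ℓ m θ F x) (stripMeasure n) := by
  filter_upwards [ae_segKernel_lt_top hθc hθi hΩb.measure_lt_top hM hF hF2,
    ae_restrict_mem hΩ] with x hx hxΩ
  refine ⟨?_, ?_⟩
  · have := (measurable_fullIntegrand (ℓ := ℓ) (m := m) hθc.measurable hF).comp
      (measurable_const (a := x) |>.prodMk measurable_id)
    exact Measurable.aestronglyMeasurable this
  · rw [hasFiniteIntegral_iff_enorm]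
    exact (lintegral_enorm_fullIntegrand_le hΩb hB hθ hxΩ).trans_lt
      (ENNReal.mul_lt_top ENNReal.ofReal_lt_top hx)

theorem reducedPoincare_eq_integral {x : EuclideanSpace ℝ (Fin n)}
    (h : Integrable (fullIntegrand ℓ m θ F x) (stripMeasure n)) :
    reducedPoincare ℓ m θ F x = ∫ p, fullIntegrand ℓ m θ F x p ∂stripMeasure n := by
  rw [integral_prod _ h, reducedPoincare]
  refine integral_congr_ae (ae_of_all _ fun s => ?_)
  simp only [fullIntegrand]
  rw [integral_mul_const, integral_const_mul]

theorem memLp_reducedPoincare (hΩ : MeasurableSet Ω) (hΩb : Bornology.IsBounded Ω)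
    (hB : B ⊆ Ω) (hθ : ∀ w, θ w ≠ 0 → w ∈ B) (hθc : Continuous θ) (hθi : Integrable θ) {M : ℝ}
    (hM : ∀ w, |θ w| ≤ M) (hF : Measurable F) (hF2 : MemLp F 2 volume) :
    MemLp (reducedPoincare ℓ m θ F) 2 (volume.restrict Ω) := by
  have hae := ae_integrable_fullIntegrand (ℓ := ℓ) (m := m) hΩ hΩb hB hθ hθc hθi hM hF hF2
  have he : (fun x => ∫ p, fullIntegrand ℓ m θ F x p ∂stripMeasure n) =ᵐ[volume.restrict Ω]
      reducedPoincare ℓ m θ F := by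
    filter_upwards [hae] with x hx
    exact (reducedPoincare_eq_integral hx).symm
  have hm : StronglyMeasurable fun x => ∫ p, fullIntegrand ℓ m θ F x p ∂stripMeasure n :=
    StronglyMeasurable.integral_prod_right (f := fullIntegrand ℓ m θ F)
      (measurable_fullIntegrand (ℓ := ℓ) (m := m) hθc.measurable hF).stronglyMeasurable
  refine MemLp.ae_eq he ⟨hm.aestronglyMeasurable, ?_⟩
  rw [eLpNorm_two_eq]
  refine ENNReal.rpow_lt_top_of_nonneg (by norm_num) (ne_of_lt ?_)
  calc _ ≤ ∫⁻ x in Ω, ENNReal.ofReal (Metric.diam Ω) ^ 2 *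
        (∫⁻ p, segKernel θ p.1 x p.2 * ‖F p.2‖ₑ ∂stripMeasure n) ^ 2 := by
        refine setLIntegral_mono' hΩ fun x hx => ?_
        rw [← mul_pow]
        gcongr
        exact (enorm_integral_le_lintegral_enorm _).trans
          (lintegral_enorm_fullIntegrand_le hΩb hB hθ hx)
    _ = ENNReal.ofReal (Metric.diam Ω) ^ 2 * ∫⁻ x in Ω,
        (∫⁻ p, segKernel θ p.1 x p.2 * ‖F p.2‖ₑ ∂stripMeasure n) ^ 2 :=
        lintegral_const_mul' _ _ (by finiteness)
    _ < ⊤ := ENNReal.mul_lt_top (by finiteness)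
        (lintegral_sq_segKernel_lt_top hθc hθi hΩb.measure_lt_top hM hF hF2)

/-- Joint integrability that allows the `x` integral to be moved inside before integrating by parts.
-/
theorem integrable_fullIntegrand_mul (hΩ : MeasurableSet Ω) (hΩb : Bornology.IsBounded Ω)
    (hB : B ⊆ Ω) (hθ : ∀ w, θ w ≠ 0 → w ∈ B) (hθc : Continuous θ) (hθi : Integrable θ) {M : ℝ}
    (hM : ∀ w, |θ w| ≤ M) (hF : Measurable F) (hF2 : MemLp F 2 volume)
    {φ : EuclideanSpace ℝ (Fin n) → ℝ} (hφ : Measurable φ)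
    (hφ2 : MemLp φ 2 (volume.restrict Ω)) :
    Integrable (fun q : EuclideanSpace ℝ (Fin n) × ℝ × EuclideanSpace ℝ (Fin n) =>
      fullIntegrand ℓ m θ F q.1 q.2 * φ q.1) ((volume.restrict Ω).prod (stripMeasure n)) := by
  have hm : Measurable fun q : EuclideanSpace ℝ (Fin n) × ℝ × EuclideanSpace ℝ (Fin n) =>
      fullIntegrand ℓ m θ F q.1 q.2 * φ q.1 :=
    (measurable_fullIntegrand (ℓ := ℓ) (m := m) hθc.measurable hF).mul (hφ.comp measurable_fst)
  refine ⟨hm.aestronglyMeasurable, ?_⟩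
  rw [hasFiniteIntegral_iff_enorm, lintegral_prod _ hm.enorm.aemeasurable]
  obtain ⟨A, B', hA, hB', h1, h2⟩ := schur_stripMeasure_bounds hθc hθi hΩb.measure_lt_top hM
  calc _ ≤ ∫⁻ x in Ω, ENNReal.ofReal (Metric.diam Ω) * (‖φ x‖ₑ *
        ∫⁻ p, segKernel θ p.1 x p.2 * ‖F p.2‖ₑ ∂stripMeasure n) := by
        refine setLIntegral_mono' hΩ fun x hx => ?_
        simp only [enorm_mul]
        rw [lintegral_mul_const' _ _ enorm_ne_top, mul_comm, mul_left_comm]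
        gcongr
        exact lintegral_enorm_fullIntegrand_le hΩb hB hθ hx
    _ = ENNReal.ofReal (Metric.diam Ω) * ∫⁻ x in Ω, (‖φ x‖ₑ *
        ∫⁻ p, segKernel θ p.1 x p.2 * ‖F p.2‖ₑ ∂stripMeasure n) :=
        lintegral_const_mul' _ _ ENNReal.ofReal_ne_top
    _ < ⊤ := by
        refine ENNReal.mul_lt_top ENNReal.ofReal_lt_top
          ((lintegral_lintegral_mul_mul_le (ν := stripMeasure n) (F := fun p => ‖F p.2‖ₑ)
            (measurable_segKernel_strip hθc.measurable) hφ.enorm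
            (hF.comp measurable_snd).enorm h1 h2).trans_lt ?_)
        have e : ∫⁻ p, ‖F p.2‖ₑ ^ 2 ∂stripMeasure n = ∫⁻ y, ‖F y‖ₑ ^ 2 :=
          lintegral_stripMeasure_snd (g := fun y => ‖F y‖ₑ ^ 2) (hF.enorm.pow_const 2)
        rw [e, ← eLpNorm_two_eq, ← eLpNorm_two_eq]
        exact ENNReal.mul_lt_top (ENNReal.rpow_lt_top_of_nonneg (by norm_num) (by finiteness))
          (ENNReal.mul_lt_top hF2.2 hφ2.2)

end Convergence

/-! ### Integration by parts and the form representing the derivative -/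

section Pairing

variable {n : ℕ}

theorem hasFDerivAt_segEnd (s : ℝ) (h1 : s < 1) (x y : EuclideanSpace ℝ (Fin n)) :
    HasFDerivAt (fun x => segEnd x s y)
      ((-(s * (1 - s)⁻¹)) • ContinuousLinearMap.id ℝ (EuclideanSpace ℝ (Fin n))) x := by
  simp_rw [segEnd_eq_right _ h1]
  exact ((hasFDerivAt_id x).const_smul (-(s * (1 - s)⁻¹))).const_add _

theorem contDiff_segEnd (s : ℝ) (y : EuclideanSpace ℝ (Fin n)) :
    ContDiff ℝ ∞ fun x : EuclideanSpace ℝ (Fin n) => segEnd x s y := by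
  unfold segEnd
  fun_prop

/-- The derivative in `x` of the kernel `θ(x + (y - x)/(1 - s)) (x_m - y_m)/(1 - s)`, split into a
regular part and parts with mean-zero bumps. -/
theorem partialD_kernel {θ : EuclideanSpace ℝ (Fin n) → ℝ} (hθ : Differentiable ℝ θ) (j m : Fin n)
    (a : ℝ) {s : ℝ} (h1 : s < 1) (x y : EuclideanSpace ℝ (Fin n)) :
    partialD j (fun x => θ (segEnd x s y) * ((x m - y m) / (1 - s))) x =
      (if j = m then 1 else 0) * θ (segEnd x s y) + s / (1 - s) *
        (partialD j (fun w => (w m - a) * θ w) (segEnd x s y) -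
          (x m - a) * partialD j θ (segEnd x s y)) := by
  have ht : 1 - s ≠ 0 := by linarith
  have d1 : HasFDerivAt (fun x => θ (segEnd x s y)) _ x :=
    ((hθ _).hasFDerivAt).comp x (hasFDerivAt_segEnd s h1 x y)
  have d2 : HasFDerivAt (fun x : EuclideanSpace ℝ (Fin n) => (x m - y m) / (1 - s)) _ x :=
    (hasFDerivAt_coord_sub m (y m) x).mul_const (1 - s)⁻¹
  have d : HasFDerivAt (fun x => θ (segEnd x s y) * ((x m - y m) / (1 - s))) _ x := d1.mul d2
  have e := coord_sub_div_eq m x h1 y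
  rw [partialD, d.fderiv, partialD_coord_sub_mul hθ, partialD]
  simp only [add_apply, smul_apply, ContinuousLinearMap.comp_apply, ContinuousLinearMap.id_apply, map_smul, smul_eq_mul, e]
  have hp : (EuclideanSpace.proj m : EuclideanSpace ℝ (Fin n) →L[ℝ] ℝ)
      (EuclideanSpace.single j 1) = if j = m then 1 else 0 := by
    by_cases hjm : j = m
    · subst hjm; simp
    · simp [hjm, Ne.symm hjm]
  rw [hp]
  -- With `w = segEnd x s y` this is `x_m - w_m = (x_m - a) - (w_m - a)` together with `1/(1 - s) =
  -- 1 + s/(1 - s)`.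
  field_simp
  ring

/-- The value at `s` of the form that represents the weak derivative. -/
noncomputable def derivForm (j m : Fin n) (a : ℝ) (θ F φ : EuclideanSpace ℝ (Fin n) → ℝ) (s : ℝ) :
    ℝ :=
  (if j = m then 1 else 0) * segForm s θ F φ + s / (1 - s) *
    (segForm s (partialD j fun w => (w m - a) * θ w) F φ -
      segForm s (partialD j θ) F fun x => (x m - a) * φ x)

variable {θ F φ : EuclideanSpace ℝ (Fin n) → ℝ}

theorem integral_kernel_mul_partialD (hθ : ContDiff ℝ ∞ θ) (hφ : ContDiff ℝ ∞ φ)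
    (hφc : HasCompactSupport φ) (j m : Fin n) (s : ℝ) (y : EuclideanSpace ℝ (Fin n)) :
    ∫ x, θ (segEnd x s y) * ((x m - y m) / (1 - s)) * partialD j φ x =
      -∫ x, partialD j (fun x => θ (segEnd x s y) * ((x m - y m) / (1 - s))) x * φ x := by
  have hq : ContDiff ℝ ∞ fun x : EuclideanSpace ℝ (Fin n) =>
      θ (segEnd x s y) * ((x m - y m) / (1 - s)) :=
    (hθ.comp (contDiff_segEnd s y)).mul (((EuclideanSpace.proj m : EuclideanSpace ℝ (Fin n) →L[ℝ]
      ℝ).contDiff.sub contDiff_const).div_const _)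
  refine integral_mul_fderiv_eq_neg_fderiv_mul_of_integrable (𝕜 := ℝ) (μ := volume) ?_ ?_ ?_
    (fun x _ => hq.differentiable (by simp) x) (fun x _ => hφ.differentiable (by simp) x)
  · exact ((contDiff_partialD hq j).continuous.mul hφ.continuous).integrable_of_hasCompactSupport
      hφc.mul_left
  · exact (hq.continuous.mul (contDiff_partialD hφ j).continuous).integrable_of_hasCompactSupport
      (hasCompactSupport_partialD hφc j).mul_left
  · exact (hq.continuous.mul hφ.continuous).integrable_of_hasCompactSupport hφc.mul_left

/-- The three forms recombine into the full derivative of the kernel under one double integral;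
Fubini and integration by parts in `x` return the derivative to `φ`. -/
theorem derivForm_eq (hθ : ContDiff ℝ ∞ θ) (hθc : HasCompactSupport θ) (hF : Measurable F)
    (hF2 : MemLp F 2 volume) (hφ : ContDiff ℝ ∞ φ) (hφc : HasCompactSupport φ) (j m : Fin n)
    (a : ℝ) {s : ℝ} (h0 : 0 < s) (h1 : s < 1) :
    derivForm j m a θ F φ s =
      -∫ y, F y * (1 / (1 - s) ^ n) *
        ∫ x, θ (segEnd x s y) * ((x m - y m) / (1 - s)) * partialD j φ x := by
  have s1 := contDiff_partialD hθ j
  have s2 := contDiff_partialD (contDiff_coord_sub_mul hθ m a) j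
  have s3 := contDiff_coord_sub_mul hφ m a
  have c3 := hasCompactSupport_coord_sub_mul hφc m a
  have i1 := integrable_segForm_integrand hθ.continuous.measurable
    (hθ.continuous.integrable_of_hasCompactSupport hθc) hF hF2 hφ.continuous.measurable
    (hφ.continuous.memLp_of_hasCompactSupport hφc) h0 h1
  have i2 := integrable_segForm_integrand s2.continuous.measurable
    (s2.continuous.integrable_of_hasCompactSupport
      (hasCompactSupport_partialD (hasCompactSupport_coord_sub_mul hθc m a) j)) hF hF2
    hφ.continuous.measurable (hφ.continuous.memLp_of_hasCompactSupport hφc) h0 h1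
  have i3 := integrable_segForm_integrand s1.continuous.measurable
    (s1.continuous.integrable_of_hasCompactSupport (hasCompactSupport_partialD hθc j)) hF hF2
    s3.continuous.measurable (s3.continuous.memLp_of_hasCompactSupport c3) h0 h1
  have hi := (i1.const_mul (if j = m then 1 else 0)).add ((i2.sub i3).const_mul (s / (1 - s)))
  have e : derivForm j m a θ F φ s =
      ∫ p : EuclideanSpace ℝ (Fin n) × EuclideanSpace ℝ (Fin n), F p.2 * (1 / (1 - s) ^ n) *
        (partialD j (fun x => θ (segEnd x s p.2) * ((x m - p.2 m) / (1 - s))) p.1 * φ p.1) := by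
    rw [derivForm, segForm, segForm, segForm, ← integral_sub i2 i3, ← integral_const_mul,
      ← integral_const_mul]
    refine (integral_add (i1.const_mul _) ((i2.sub i3).const_mul _)).symm.trans ?_
    refine integral_congr_ae (ae_of_all _ fun p => ?_)
    simp only
    rw [partialD_kernel (hθ.differentiable (by simp)) j m a h1]
    simp only [Pi.sub_apply]
    ring
  have hi' : Integrable (fun p : EuclideanSpace ℝ (Fin n) × EuclideanSpace ℝ (Fin n) =>
      F p.2 * (1 / (1 - s) ^ n) *
        (partialD j (fun x => θ (segEnd x s p.2) * ((x m - p.2 m) / (1 - s))) p.1 * φ p.1))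
      (volume.prod volume) := by
    refine hi.congr (ae_of_all _ fun p => ?_)
    simp only [Pi.add_apply, Pi.sub_apply]
    rw [partialD_kernel (hθ.differentiable (by simp)) j m a h1]
    ring
  rw [e, Measure.volume_eq_prod, integral_prod_symm _ hi', ← integral_neg]
  refine integral_congr_ae (ae_of_all _ fun y => ?_)
  simp only
  rw [integral_const_mul, integral_kernel_mul_partialD hθ hφ hφc]
  ring

variable {ℓ : ℕ} {m : Fin n} {Ω B : Set (EuclideanSpace ℝ (Fin n))}

theorem integral_reducedPoincare_mul_partialD (hΩ : MeasurableSet Ω)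
    (hΩb : Bornology.IsBounded Ω) (hB : B ⊆ Ω) (hθB : ∀ w, θ w ≠ 0 → w ∈ B)
    (hθ : ContDiff ℝ ∞ θ) (hθc : HasCompactSupport θ) {M : ℝ}
    (hM : ∀ w, |θ w| ≤ M) (hF : Measurable F) (hF2 : MemLp F 2 volume)
    (hφ : ContDiff ℝ ∞ φ) (hφc : HasCompactSupport φ) (hφΩ : tsupport φ ⊆ Ω) (j : Fin n) (a : ℝ) :
    ∫ x in Ω, reducedPoincare ℓ m θ F x * partialD j φ x =
      -∫ s in Set.Ioo (0 : ℝ) 1, s ^ (ℓ - 1) * derivForm j m a θ F φ s := by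
  have hθi : Integrable θ := hθ.continuous.integrable_of_hasCompactSupport hθc
  have sφ := contDiff_partialD hφ j
  have cφ := hasCompactSupport_partialD hφc j
  have hφΩ' : ∀ x, x ∉ Ω → partialD j φ x = 0 := fun x hx =>
    not_not.1 fun h => hx (hφΩ (support_partialD_subset φ j h))
  have hi := integrable_fullIntegrand_mul (ℓ := ℓ) (m := m) hΩ hΩb hB hθB hθ.continuous hθi hM hF
    hF2 sφ.continuous.measurable (sφ.continuous.memLp_of_hasCompactSupport cφ)
  have hae := ae_integrable_fullIntegrand (ℓ := ℓ) (m := m) hΩ hΩb hB hθB hθ.continuous hθi hM hF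
    hF2
  calc ∫ x in Ω, reducedPoincare ℓ m θ F x * partialD j φ x
      = ∫ x in Ω, ∫ p, fullIntegrand ℓ m θ F x p * partialD j φ x ∂stripMeasure n := by
        refine integral_congr_ae ?_
        filter_upwards [hae] with x hx
        rw [reducedPoincare_eq_integral hx, integral_mul_const]
    _ = ∫ p, (∫ x in Ω, fullIntegrand ℓ m θ F x p * partialD j φ x) ∂stripMeasure n :=
        integral_integral_swap hi
    _ = ∫ s in Set.Ioo (0 : ℝ) 1, ∫ y, ∫ x in Ω,
          fullIntegrand ℓ m θ F x (s, y) * partialD j φ x :=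
        integral_prod _ hi.integral_prod_right
    _ = ∫ s in Set.Ioo (0 : ℝ) 1, -(s ^ (ℓ - 1) * derivForm j m a θ F φ s) := by
        refine setIntegral_congr_fun measurableSet_Ioo fun s hs => ?_
        rw [derivForm_eq hθ hθc hF hF2 hφ hφc j m a hs.1 hs.2, mul_neg, neg_neg,
          ← integral_const_mul]
        refine integral_congr_ae (ae_of_all _ fun y => ?_)
        simp only
        -- The kernel does not vanish outside `Ω`, but `∂_jφ` does, so integration by parts can take
        -- place on the whole space.
        rw [setIntegral_eq_integral_of_forall_compl_eq_zero
          (fun x hx => by rw [hφΩ' x hx, mul_zero]), ← integral_const_mul, ← integral_const_mul]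
        refine integral_congr_ae (ae_of_all _ fun x => ?_)
        simp only [fullIntegrand, poincareIntegrand, segEnd]
        ring
    _ = _ := integral_neg _

end Pairing

/-! ### Integration of the bounds in `s` and the duality estimate -/

section Estimates

variable {n : ℕ} {ψ F φ : EuclideanSpace ℝ (Fin n) → ℝ} {Ω : Set (EuclideanSpace ℝ (Fin n))}

/-- The dimensional constant `υ` compares `|Ω|/ρⁿ` with `V`. As `υ ≥ 1` and `(1 - l)/2 ≤ 1`, it
leaves the power as a plain factor, and the constant stays independent of `l`. -/
theorem lintegral_pow_mul_segForm_le {ℓ : ℕ} (hψ : Measurable ψ) (hF : Measurable F)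
    (hφ : Measurable φ) (hΩ : MeasurableSet Ω) (hφΩ : ∀ x, x ∉ Ω → φ x = 0)
    {A D υ V l Q : ℝ} (hA0 : 0 ≤ A) (hA : ∫⁻ w, ‖ψ w‖ₑ ≤ ENNReal.ofReal A)
    (hD : ∀ w, |ψ w| ≤ A * D) (hυ : 1 ≤ υ) (hV : 1 ≤ V)
    (hDW : ENNReal.ofReal D * volume Ω ≤ ENNReal.ofReal (υ * V)) (hl0 : 0 ≤ l) (hl1 : l ≤ 1)
    (hQ : ∫⁻ s in Set.Ioo (0 : ℝ) 1,
      ENNReal.ofReal (s ^ (ℓ - 1) * ((s⁻¹ ^ n) ^ (l / 2) * V ^ ((1 - l) / 2))) ≤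
      ENNReal.ofReal Q) :
    ∫⁻ s in Set.Ioo (0 : ℝ) 1, ENNReal.ofReal (s ^ (ℓ - 1)) * ‖segForm s ψ F φ‖ₑ ≤
      ENNReal.ofReal (A * (2 ^ n * υ * Q)) * (eLpNorm F 2 volume * eLpNorm φ 2 volume) := by
  have hV0 : 0 < V := by linarith
  have hυ0 : 0 < υ := by linarith
  calc _ ≤ ∫⁻ s in Set.Ioo (0 : ℝ) 1,
        (ENNReal.ofReal (A * (2 ^ n * υ)) * (eLpNorm F 2 volume * eLpNorm φ 2 volume)) *
        ENNReal.ofReal (s ^ (ℓ - 1) * ((s⁻¹ ^ n) ^ (l / 2) * V ^ ((1 - l) / 2))) := by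
        refine setLIntegral_mono (by fun_prop) fun s hs => ?_
        have hs0 : 0 < s := hs.1
        refine (mul_le_mul_right (enorm_segForm_le_interpolation hψ hF hφ hΩ hφΩ hs.1 hs.2 hA0 hA hD
          (one_le_mul_of_one_le_of_one_le hυ hV) hDW hl0 hl1) _).trans ?_
        rw [← mul_assoc, mul_right_comm _ (_ * _ : ℝ≥0∞), ← ENNReal.ofReal_mul (by positivity),
          ← ENNReal.ofReal_mul (by positivity)]
        refine mul_le_mul' (ENNReal.ofReal_le_ofReal ?_) le_rfl
        have h1 : (υ * V) ^ ((1 - l) / 2) ≤ υ * V ^ ((1 - l) / 2) := by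
          rw [Real.mul_rpow hυ0.le hV0.le]
          gcongr
          calc υ ^ ((1 - l) / 2) ≤ υ ^ (1 : ℝ) :=
                Real.rpow_le_rpow_of_exponent_le hυ (by linarith)
            _ = υ := Real.rpow_one υ
        calc s ^ (ℓ - 1) * (A * (2 ^ n * ((s⁻¹ ^ n) ^ (l / 2) * (υ * V) ^ ((1 - l) / 2))))
            ≤ s ^ (ℓ - 1) * (A * (2 ^ n * ((s⁻¹ ^ n) ^ (l / 2) * (υ * V ^ ((1 - l) / 2))))) := by
              gcongr
          _ = _ := by ring
    _ = (ENNReal.ofReal (A * (2 ^ n * υ)) * (eLpNorm F 2 volume * eLpNorm φ 2 volume)) *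
        ∫⁻ s in Set.Ioo (0 : ℝ) 1,
          ENNReal.ofReal (s ^ (ℓ - 1) * ((s⁻¹ ^ n) ^ (l / 2) * V ^ ((1 - l) / 2))) :=
        lintegral_const_mul _ (by fun_prop)
    _ ≤ (ENNReal.ofReal (A * (2 ^ n * υ)) * (eLpNorm F 2 volume * eLpNorm φ 2 volume)) *
        ENNReal.ofReal Q := by gcongr
    _ = _ := by
        have e : A * (2 ^ n * υ * Q) = A * (2 ^ n * υ) * Q := by ring
        rw [e, ENNReal.ofReal_mul (p := A * (2 ^ n * υ)) (by positivity)]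
        ring

/-- Split at `s = 1/2`: below it `s/(1 - s) ≤ 1` and the interpolated Schur bound applies; above it
the powers of `s` are dropped and the Fourier bound controls `1/(1 - s)`. -/
theorem IsMeanZeroBump.lintegral_singular_segForm_le {ℓ : ℕ} {c : EuclideanSpace ℝ (Fin n)}
    {ρ A : ℝ} (hρ : 0 < ρ) (h : IsMeanZeroBump c ρ A ψ) (hF : Measurable F)
    (hF2 : MemLp F 2 volume) (hφ : ContDiff ℝ ∞ φ) (hφc : HasCompactSupport φ)
    (hΩ : MeasurableSet Ω) (hφΩ : ∀ x, x ∉ Ω → φ x = 0)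
    {D υ V l Q : ℝ} (hA0 : 0 ≤ A)
    (hD : ∀ w, |ψ w| ≤ A * D) (hυ : 1 ≤ υ) (hV : 1 ≤ V)
    (hDW : ENNReal.ofReal D * volume Ω ≤ ENNReal.ofReal (υ * V)) (hl0 : 0 ≤ l) (hl1 : l ≤ 1)
    (hQ0 : 0 ≤ Q) (hQ : ∫⁻ s in Set.Ioo (0 : ℝ) 1,
      ENNReal.ofReal (s ^ (ℓ - 1) * ((s⁻¹ ^ n) ^ (l / 2) * V ^ ((1 - l) / 2))) ≤
      ENNReal.ofReal Q) :
    ∫⁻ s in Set.Ioo (0 : ℝ) 1,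
      ENNReal.ofReal (s ^ (ℓ - 1) * (s / (1 - s))) * ‖segForm s ψ F φ‖ₑ ≤
      ENNReal.ofReal (A * (2 ^ n * υ * Q + nearConst n)) *
        (eLpNorm F 2 volume * eLpNorm φ 2 volume) := by
  have hψm := h.contDiff.continuous.measurable
  have hφm := hφ.continuous.measurable
  have hsm : Measurable fun s => ‖segForm s ψ F φ‖ₑ := (measurable_segForm hψm hF hφm).enorm
  have hl1' : ∫⁻ w, ‖ψ w‖ₑ ≤ ENNReal.ofReal A := by
    have hi : Integrable ψ := h.contDiff.continuous.integrable_of_hasCompactSupport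
      h.hasCompactSupport
    rw [← ofReal_integral_norm_eq_lintegral_enorm hi]
    exact ENNReal.ofReal_le_ofReal h.l1_bound
  have hfar := lintegral_pow_mul_segForm_le (ℓ := ℓ) hψm hF hφm hΩ hφΩ hA0 hl1' hD hυ hV hDW hl0
    hl1 hQ
  have hnear := h.setLIntegral_enorm_segForm_le hρ hA0 hF hF2 hφ hφc
  have hsub : Set.Ioo (0 : ℝ) 1 ⊆ Set.Ioo (0 : ℝ) 1 ∩ Set.Iic (1 / 2) ∪ Set.Ioo (1 / 2 : ℝ) 1 :=
    fun s hs => (le_or_gt s (1 / 2)).imp (fun h1 => ⟨hs, h1⟩) (fun h1 => ⟨h1, hs.2⟩)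
  calc _ ≤ _ := lintegral_mono_set hsub
    _ ≤ _ := lintegral_union_le _ _ _
    _ ≤ ENNReal.ofReal (A * (2 ^ n * υ * Q)) * (eLpNorm F 2 volume * eLpNorm φ 2 volume) +
        ENNReal.ofReal (nearConst n * A) * (eLpNorm F 2 volume * eLpNorm φ 2 volume) := by
        refine add_le_add (le_trans ?_ hfar) (le_trans ?_ hnear)
        · refine (setLIntegral_mono (by fun_prop) fun s hs => ?_).trans
            (lintegral_mono_set Set.inter_subset_left)
          have hs0 : 0 < s := hs.1.1
          have hs1 : s ≤ 1 / 2 := hs.2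
          gcongr
          refine mul_le_of_le_one_right (by positivity) ?_
          rw [div_le_one (by linarith)]
          linarith
        · refine setLIntegral_mono (by fun_prop) fun s hs => ?_
          have hs0 : 0 < s := by linarith [hs.1]
          have hs1 : 0 < 1 - s := by linarith [hs.2]
          gcongr
          rw [← mul_div_assoc]
          gcongr
          exact mul_le_one₀ (pow_le_one₀ hs0.le hs.2.le) hs0.le hs.2.le
    _ = _ := by
        have := nearConst_pos n
        rw [← add_mul, ← ENNReal.ofReal_add (by positivity) (by positivity)]
        congr 2
        ring

theorem eLpNorm_restrict_eq (hΩ : MeasurableSet Ω) (hφΩ : ∀ x, x ∉ Ω → φ x = 0) :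
    eLpNorm φ 2 (volume.restrict Ω) = eLpNorm φ 2 volume := by
  have e : Ω.indicator φ = φ := by
    ext x
    by_cases hx : x ∈ Ω
    · simp [hx]
    · simp [hx, hφΩ x hx]
  rw [← eLpNorm_indicator_eq_eLpNorm_restrict hΩ, e]

theorem eLpNorm_coord_mul_le {R : ℝ} (c : EuclideanSpace ℝ (Fin n)) (m : Fin n)
    (hφΩ : ∀ x, x ∉ Ω → φ x = 0) (hR : ∀ x ∈ Ω, ‖x - c‖ ≤ R) :
    eLpNorm (fun x => (x m - c m) * φ x) 2 volume ≤ ENNReal.ofReal R * eLpNorm φ 2 volume := by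
  refine eLpNorm_le_mul_eLpNorm_of_ae_le_mul (ae_of_all _ fun x => ?_) 2
  by_cases hx : x ∈ Ω
  · rw [norm_mul, Real.norm_eq_abs]
    gcongr
    exact (abs_coord_sub_le x c m).trans (hR x hx)
  · simp [hφΩ x hx]

theorem volume_ratio_bound {c : EuclideanSpace ℝ (Fin n)} {r : ℝ} (hr : 0 < r)
    (hB : Metric.ball c r ⊆ Ω) (hΩ : Bornology.IsBounded Ω) (j : Fin n) :
    1 ≤ (volume Ω).toReal / (volume (Metric.ball c r)).toReal ∧
    ENNReal.ofReal (1 / Metric.diam (Metric.ball c r) ^ n) * volume Ω ≤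
      ENNReal.ofReal (max 1 (volume (Metric.ball (0 : EuclideanSpace ℝ (Fin n)) 1)).toReal *
        ((volume Ω).toReal / (volume (Metric.ball c r)).toReal)) := by
  have hfin : volume Ω ≠ ⊤ := hΩ.measure_lt_top.ne
  have hbfin : volume (Metric.ball c r) ≠ ⊤ := Metric.isBounded_ball.measure_lt_top.ne
  have hb : 0 < (volume (Metric.ball c r)).toReal :=
    ENNReal.toReal_pos (Metric.measure_ball_pos volume c hr).ne' hbfin
  refine ⟨?_, ?_⟩
  · rw [one_le_div hb]
    exact ENNReal.toReal_mono hfin (measure_mono hB)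
  · have hne : Nonempty (Fin n) := ⟨j⟩
    have hvol : (volume (Metric.ball c r)).toReal =
        r ^ n * (volume (Metric.ball (0 : EuclideanSpace ℝ (Fin n)) 1)).toReal := by
      rw [Measure.addHaar_ball volume c hr.le, ENNReal.toReal_mul,
        ENNReal.toReal_ofReal (by positivity), finrank_euclideanSpace_fin]
    set υ := (volume (Metric.ball (0 : EuclideanSpace ℝ (Fin n)) 1)).toReal
    have hυ : 0 < υ := by
      rw [hvol] at hb
      exact (pos_iff_pos_of_mul_pos hb).1 (by positivity)
    rw [← ENNReal.ofReal_toReal hfin, ← ENNReal.ofReal_mul (by positivity),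
      ENNReal.toReal_ofReal ENNReal.toReal_nonneg]
    refine ENNReal.ofReal_le_ofReal ?_
    rw [hvol, Metric.diam_ball_eq c hr.le]
    have h1 : 1 / (2 * r) ^ n ≤ 1 / r ^ n := by
      gcongr
      linarith
    calc 1 / (2 * r) ^ n * (volume Ω).toReal ≤ 1 / r ^ n * (volume Ω).toReal := by gcongr
      _ = υ * ((volume Ω).toReal / (r ^ n * υ)) := by field_simp
      _ ≤ _ := by gcongr; exact le_max_right _ _

/-- The estimate of the weak derivative by duality. -/
theorem IsScaledBump.abs_integral_reducedPoincare_mul_partialD_le {ℓ : ℕ} {K : List (Fin n) → ℝ}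
    {c : EuclideanSpace ℝ (Fin n)} {r : ℝ} {θ : EuclideanSpace ℝ (Fin n) → ℝ}
    (h : IsScaledBump K (Metric.ball c r) θ) (hr : 0 < r) (hB : Metric.ball c r ⊆ Ω)
    (hΩ : MeasurableSet Ω) (hΩb : Bornology.IsBounded Ω) (hF : Measurable F)
    (hF2 : MemLp F 2 volume) (hφ : ContDiff ℝ ∞ φ) (hφc : HasCompactSupport φ)
    (hφΩ : tsupport φ ⊆ Ω) (j m : Fin n) {l Q : ℝ} (hl0 : 0 ≤ l) (hl1 : l ≤ 1) (hQ0 : 0 ≤ Q)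
    (hQ : ∫⁻ s in Set.Ioo (0 : ℝ) 1, ENNReal.ofReal (s ^ (ℓ - 1) * ((s⁻¹ ^ n) ^ (l / 2) *
        ((volume Ω).toReal / (volume (Metric.ball c r)).toReal) ^ ((1 - l) / 2))) ≤
      ENNReal.ofReal Q) :
    |∫ x in Ω, reducedPoincare ℓ m θ F x * partialD j φ x| ≤
      3 * bumpConst K * (2 ^ n * max 1 (volume (Metric.ball (0 : EuclideanSpace ℝ (Fin n)) 1)).toReal
        * Q + nearConst n) * (Metric.diam Ω / Metric.diam (Metric.ball c r)) *
        (eLpNorm F 2 volume).toReal * l2Norm Ω φ := by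
  obtain ⟨hV, hDW⟩ := volume_ratio_bound hr hB hΩb j
  set V := (volume Ω).toReal / (volume (Metric.ball c r)).toReal
  set υ := max 1 (volume (Metric.ball (0 : EuclideanSpace ℝ (Fin n)) 1)).toReal
  have hυ : 1 ≤ υ := le_max_left _ _
  have hυ0 : 0 < υ := by linarith
  have hρ := diam_ball_pos (c := c) hr j
  have hA := bumpConst_pos K
  have hN := nearConst_pos n
  set A := bumpConst K
  have hR1 : Metric.diam (Metric.ball c r) ≤ Metric.diam Ω := Metric.diam_mono hB hΩb
  set ρ := Metric.diam (Metric.ball c r)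
  set R := Metric.diam Ω
  have hR0 : 0 < R := by linarith
  have hφΩ' : ∀ x, x ∉ Ω → φ x = 0 := fun x hx => not_not.1 fun h' => hx (hφΩ (subset_tsupport φ h'))
  have hcΩ : c ∈ Ω := hB (Metric.mem_ball_self hr)
  have hRx : ∀ x ∈ Ω, ‖x - c‖ ≤ R := fun x hx => by
    rw [← dist_eq_norm]; exact Metric.dist_le_diam_of_mem hΩb hx hcΩ
  have hφ1Ω : ∀ x, x ∉ Ω → (x m - c m) * φ x = 0 := fun x hx => by rw [hφΩ' x hx, mul_zero]
  have hθm := h.contDiff.continuous.measurable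
  have hφ2 : MemLp φ 2 volume := hφ.continuous.memLp_of_hasCompactSupport hφc
  set N := eLpNorm F 2 volume * eLpNorm φ 2 volume with hNdef
  set q := 2 ^ n * υ * Q + nearConst n
  have hq0 : 0 ≤ q := by positivity
  have hq1 : 2 ^ n * υ * Q ≤ q := le_add_of_nonneg_right hN.le
  have hRρ : 1 ≤ R / ρ := (one_le_div hρ).2 hR1
  have hD0 : 0 ≤ 1 / ρ ^ n := by positivity
  have t1 : ∫⁻ s in Set.Ioo (0 : ℝ) 1, ENNReal.ofReal (s ^ (ℓ - 1)) * ‖segForm s θ F φ‖ₑ ≤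
      ENNReal.ofReal (A * q * (R / ρ)) * N := by
    have hl1' : ∫⁻ w, ‖θ w‖ₑ ≤ ENNReal.ofReal A := by
      have hi : Integrable θ := h.contDiff.continuous.integrable_of_hasCompactSupport
        h.hasCompactSupport
      rw [← ofReal_integral_norm_eq_lintegral_enorm hi]
      refine ENNReal.ofReal_le_ofReal (h.integral_abs_le.trans ?_)
      linarith
    refine (lintegral_pow_mul_segForm_le hθm hF hφ.continuous.measurable hΩ hφΩ' hA.le hl1'
      (fun w => (h.abs_le w).trans ?_) hυ hV hDW hl0 hl1 hQ).trans ?_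
    · exact mul_le_mul_of_nonneg_right (by linarith) hD0
    · refine mul_le_mul' (ENNReal.ofReal_le_ofReal ?_) le_rfl
      calc A * (2 ^ n * υ * Q) ≤ A * q := by gcongr
        _ ≤ _ := le_mul_of_one_le_right (by positivity) hRρ
  have t2 : ∫⁻ s in Set.Ioo (0 : ℝ) 1, ENNReal.ofReal (s ^ (ℓ - 1) * (s / (1 - s))) *
      ‖segForm s (partialD j fun w => (w m - c m) * θ w) F φ‖ₑ ≤
      ENNReal.ofReal (A * q * (R / ρ)) * N := by
    refine ((h.isMeanZeroBump_partialD_coord_mul hr j m).lintegral_singular_segForm_le hρ hF hF2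
      hφ hφc hΩ hφΩ' hA.le (h.abs_partialD_coord_mul_le hr j m) hυ hV hDW hl0 hl1 hQ0 hQ).trans ?_
    exact mul_le_mul' (ENNReal.ofReal_le_ofReal
      (le_mul_of_one_le_right (by positivity) hRρ)) le_rfl
  -- The only term that really needs `R/ρ`: the bump contributes `A/ρ` and the modified test
  -- function `R`. The other two terms are enlarged using `R/ρ ≥ 1`.
  have t3 : ∫⁻ s in Set.Ioo (0 : ℝ) 1, ENNReal.ofReal (s ^ (ℓ - 1) * (s / (1 - s))) *
      ‖segForm s (partialD j θ) F fun x => (x m - c m) * φ x‖ₑ ≤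
      ENNReal.ofReal (A * q * (R / ρ)) * N := by
    refine ((h.isMeanZeroBump_partialD hr j).lintegral_singular_segForm_le hρ hF hF2
      (contDiff_coord_sub_mul hφ m (c m)) (hasCompactSupport_coord_sub_mul hφc m (c m)) hΩ hφ1Ω
      (by positivity) (fun w => (h.abs_partialD_le j w).trans ?_) hυ hV hDW hl0 hl1 hQ0 hQ).trans ?_
    · refine mul_le_mul_of_nonneg_right ?_ hD0
      gcongr
      linarith
    · calc _ ≤ ENNReal.ofReal (A / ρ * q) * (eLpNorm F 2 volume *
            (ENNReal.ofReal R * eLpNorm φ 2 volume)) := by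
            gcongr
            exact eLpNorm_coord_mul_le c m hφΩ' hRx
        _ = ENNReal.ofReal (A / ρ * q) * ENNReal.ofReal R * N := by rw [hNdef]; ring
        _ = _ := by
            rw [← ENNReal.ofReal_mul (by positivity)]
            congr 2
            field_simp
  have m1 : ∀ ψ' φ' : EuclideanSpace ℝ (Fin n) → ℝ, ContDiff ℝ ∞ ψ' → ContDiff ℝ ∞ φ' →
      Measurable fun s => ‖segForm s ψ' F φ'‖ₑ := fun ψ' φ' h1 h2 =>
    (measurable_segForm h1.continuous.measurable hF h2.continuous.measurable).enorm
  have hm1 := m1 θ φ h.contDiff hφ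
  have hm2 := m1 _ φ (contDiff_partialD (contDiff_coord_sub_mul h.contDiff m (c m)) j) hφ
  have hm3 := m1 _ _ (contDiff_partialD h.contDiff j) (contDiff_coord_sub_mul hφ m (c m))
  have total : ‖∫ x in Ω, reducedPoincare ℓ m θ F x * partialD j φ x‖ₑ ≤
      ENNReal.ofReal (3 * A * q * (R / ρ)) * N := by
    rw [integral_reducedPoincare_mul_partialD hΩ hΩb hB (fun w hw => h.mem_of_ne_zero hw)
      h.contDiff h.hasCompactSupport h.abs_le hF hF2 hφ hφc hφΩ j (c m), enorm_neg]
    refine (enorm_integral_le_lintegral_enorm _).trans ?_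
    calc _ ≤ ∫⁻ s in Set.Ioo (0 : ℝ) 1, (ENNReal.ofReal (s ^ (ℓ - 1)) * ‖segForm s θ F φ‖ₑ +
          (ENNReal.ofReal (s ^ (ℓ - 1) * (s / (1 - s))) *
            ‖segForm s (partialD j fun w => (w m - c m) * θ w) F φ‖ₑ +
          ENNReal.ofReal (s ^ (ℓ - 1) * (s / (1 - s))) *
            ‖segForm s (partialD j θ) F fun x => (x m - c m) * φ x‖ₑ)) := by
          refine setLIntegral_mono (by fun_prop) fun s hs => ?_
          have hs0 : 0 < s := hs.1
          have hs1 : 0 < 1 - s := by linarith [hs.2]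
          have hst : 0 ≤ s / (1 - s) := by positivity
          rw [enorm_mul, Real.enorm_of_nonneg (by positivity), derivForm,
            ENNReal.ofReal_mul (by positivity), mul_assoc, mul_assoc, ← mul_add, ← mul_add,
            ← mul_add]
          gcongr
          refine (enorm_add_le _ _).trans (add_le_add ?_ ?_)
          · split_ifs <;> simp
          · rw [enorm_mul, Real.enorm_of_nonneg hst]
            gcongr
            exact enorm_sub_le
      _ ≤ ENNReal.ofReal (A * q * (R / ρ)) * N + (ENNReal.ofReal (A * q * (R / ρ)) * N +
          ENNReal.ofReal (A * q * (R / ρ)) * N) := by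
          rw [lintegral_add_left (by fun_prop), lintegral_add_left (by fun_prop)]
          exact add_le_add t1 (add_le_add t2 t3)
      _ = _ := by
          have e : 3 * A * q * (R / ρ) = 3 * (A * q * (R / ρ)) := by ring
          rw [e, ENNReal.ofReal_mul (p := 3) (by norm_num), ENNReal.ofReal_ofNat]
          ring
  have hNtop : ENNReal.ofReal (3 * A * q * (R / ρ)) * N ≠ ⊤ := by
    have := hF2.2.ne
    have := hφ2.2.ne
    rw [hNdef]
    finiteness
  have hfinal := ENNReal.toReal_mono hNtop total
  rw [toReal_enorm, Real.norm_eq_abs, ENNReal.toReal_mul,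
    ENNReal.toReal_ofReal (by positivity), hNdef, ENNReal.toReal_mul] at hfinal
  rw [l2Norm, eLpNorm_restrict_eq hΩ hφΩ', mul_assoc (_ * (R / ρ))]
  exact hfinal

end Estimates

/-! ### Reduction to data supported in `Ω` and conclusion -/

section Main

variable {n : ℕ}

theorem ae_poincareIntegrand_congr {m : Fin n} {θ f g : EuclideanSpace ℝ (Fin n) → ℝ}
    {Ω B : Set (EuclideanSpace ℝ (Fin n))} (h : IsStarShapedWrt Ω B)
    (hθ : ∀ w, θ w ≠ 0 → w ∈ B) (hfg : ∀ᵐ y, f y = g y) {x : EuclideanSpace ℝ (Fin n)}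
    (hx : x ∈ Ω) {s : ℝ} (h0 : 0 < s) (h1 : s < 1) :
    poincareIntegrand m θ f x s =ᵐ[volume] poincareIntegrand m θ (Ω.indicator g) x s := by
  filter_upwards [hfg] with y hy
  exact poincareIntegrand_congr h hθ hx h0 h1 fun hyΩ => by rw [Set.indicator_of_mem hyΩ, hy]

theorem reducedPoincare_congr {ℓ : ℕ} {m : Fin n} {θ f g : EuclideanSpace ℝ (Fin n) → ℝ}
    {Ω B : Set (EuclideanSpace ℝ (Fin n))} (h : IsStarShapedWrt Ω B)
    (hθ : ∀ w, θ w ≠ 0 → w ∈ B) (hfg : ∀ᵐ y, f y = g y) {x : EuclideanSpace ℝ (Fin n)}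
    (hx : x ∈ Ω) :
    reducedPoincare ℓ m θ f x = reducedPoincare ℓ m θ (Ω.indicator g) x := by
  refine setIntegral_congr_fun measurableSet_Ioo fun s hs => ?_
  rw [integral_congr_ae (ae_poincareIntegrand_congr h hθ hfg hx hs.1 hs.2)]

theorem reducedPoincareConverges_congr {ℓ : ℕ} {m : Fin n}
    {θ f g : EuclideanSpace ℝ (Fin n) → ℝ}
    {Ω B : Set (EuclideanSpace ℝ (Fin n))} (h : IsStarShapedWrt Ω B)
    (hθ : ∀ w, θ w ≠ 0 → w ∈ B) (hfg : ∀ᵐ y, f y = g y) {x : EuclideanSpace ℝ (Fin n)}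
    (hx : x ∈ Ω)
    (hi : Integrable (fullIntegrand ℓ m θ (Ω.indicator g) x) (stripMeasure n)) :
    ReducedPoincareConverges ℓ m θ f x := by
  refine hi.congr ?_
  have h2 : ∀ᵐ p ∂stripMeasure n, f p.2 = g p.2 := Measure.quasiMeasurePreserving_snd.ae hfg
  filter_upwards [ae_stripMeasure_fst n, h2] with p hp hfp
  rw [fullIntegrand, poincareIntegrand_congr (F := f) (G := Ω.indicator g) h hθ hx hp.1 hp.2
    fun hyΩ => by rw [Set.indicator_of_mem hyΩ, hfp]]

end Main

theorem mainTheorem7 (n ℓ : ℕ) (hℓ : 1 ≤ ℓ) (hℓn : ℓ ≤ n) (K : List (Fin n) → ℝ) :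
    ∃ C : ℝ, 0 < C ∧
      ∀ (Ω : Set (EuclideanSpace ℝ (Fin n))) (c : EuclideanSpace ℝ (Fin n)) (r : ℝ)
        (θ f : EuclideanSpace ℝ (Fin n) → ℝ) (m : Fin n),
        IsOpen Ω → Bornology.IsBounded Ω → 0 < r →
        IsStarShapedWrt Ω (Metric.ball c r) →
        IsScaledBump K (Metric.ball c r) θ →
        MemLp f 2 volume → (∀ᵐ y, y ∉ closure Ω → f y = 0) →
        (∀ᵐ x ∂(volume.restrict Ω), ReducedPoincareConverges ℓ m θ f x) ∧
        ∃ g : Fin n → EuclideanSpace ℝ (Fin n) → ℝ,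
          IsH1WithGradient Ω (reducedPoincare ℓ m θ f) g ∧
          Real.sqrt (∑ j, l2Norm Ω (g j) ^ 2) ≤
            C * (Metric.diam Ω / Metric.diam (Metric.ball c r)) *
              kappa n ℓ ((volume Ω).toReal / (volume (Metric.ball c r)).toReal) *
              l2Norm Ω f := by
  obtain ⟨C₀, hC₀, hint⟩ := exists_interpolation_exponent (n := n) hℓ
  set υ := max 1 (volume (Metric.ball (0 : EuclideanSpace ℝ (Fin n)) 1)).toReal
  have hυ : 0 < υ := lt_of_lt_of_le one_pos (le_max_left _ _)
  have hA := bumpConst_pos K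
  have hN := nearConst_pos n
  have hn : 1 ≤ n := hℓ.trans hℓn
  have hn1 : (1 : ℝ) ≤ n := by exact_mod_cast hn
  -- The three comes from the three forms in the derivative, and the leading `n` bounds the `√n`
  -- from summing over the components of the gradient.
  refine ⟨n * (3 * bumpConst K * (2 ^ n * υ * C₀ + nearConst n)), by positivity,
    fun Ω c r θ f m hΩ hΩb hr hstar hθ hf _ => ?_⟩
  have hB : Metric.ball c r ⊆ Ω := hstar.1
  have hθB : ∀ w, θ w ≠ 0 → w ∈ Metric.ball c r := fun w hw => hθ.mem_of_ne_zero hw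
  have hΩm := hΩ.measurableSet
  -- A measurable representative cut off to `Ω`: its norm over the whole space is the norm of `f` on
  -- `Ω`, and star-shapedness leaves `P f` unchanged on `Ω`.
  set F : EuclideanSpace ℝ (Fin n) → ℝ := Ω.indicator (hf.1.mk f) with hFdef
  have hfg : ∀ᵐ y, f y = hf.1.mk f y := hf.1.ae_eq_mk
  have hF : Measurable F := hf.1.stronglyMeasurable_mk.measurable.indicator hΩm
  have hF2 : MemLp F 2 volume := (hf.ae_eq hfg).indicator hΩm
  have hFnorm : (eLpNorm F 2 volume).toReal = l2Norm Ω f := by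
    rw [l2Norm, hFdef, eLpNorm_indicator_eq_eLpNorm_restrict hΩm,
      eLpNorm_congr_ae (ae_restrict_of_ae hfg)]
  have hθi : Integrable θ := hθ.contDiff.continuous.integrable_of_hasCompactSupport
    hθ.hasCompactSupport
  have hPeq : ∀ x ∈ Ω, reducedPoincare ℓ m θ f x = reducedPoincare ℓ m θ F x := fun x hx =>
    reducedPoincare_congr hstar hθB hfg hx
  have hu : MemLp (reducedPoincare ℓ m θ f) 2 (volume.restrict Ω) := by
    refine (memLp_reducedPoincare (ℓ := ℓ) (m := m) hΩm hΩb hB hθB hθ.contDiff.continuous hθi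
      hθ.abs_le hF hF2).ae_eq ?_
    filter_upwards [ae_restrict_mem hΩm] with x hx
    exact (hPeq x hx).symm
  refine ⟨?_, ?_⟩
  · filter_upwards [ae_integrable_fullIntegrand (ℓ := ℓ) (m := m) hΩm hΩb hB hθB
      hθ.contDiff.continuous hθi hθ.abs_le hF hF2, ae_restrict_mem hΩm] with x hx hxΩ
    exact reducedPoincareConverges_congr hstar hθB hfg hxΩ hx
  · have hV := (volume_ratio_bound hr hB hΩb m).1
    obtain ⟨l, hl0, hl1, hQ⟩ := hint _ hV
    set V := (volume Ω).toReal / (volume (Metric.ball c r)).toReal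
    have hκ := one_le_kappa n ℓ hV
    set κ := kappa n ℓ V
    have hρ := diam_ball_pos (c := c) hr m
    set ρ := Metric.diam (Metric.ball c r)
    set R := Metric.diam Ω
    have hR : 0 ≤ R := Metric.diam_nonneg
    have hf0 : 0 ≤ l2Norm Ω f := ENNReal.toReal_nonneg
    set M := 3 * bumpConst K * (2 ^ n * υ * C₀ + nearConst n) * (R / ρ) * κ * l2Norm Ω f with hM
    have hκ0 : 0 < κ := by linarith
    have hM0 : 0 ≤ M := by positivity
    have hweak : ∀ j : Fin n, ∃ g : EuclideanSpace ℝ (Fin n) → ℝ,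
        MemLp g 2 (volume.restrict Ω) ∧ HasWeakPartialD Ω j (reducedPoincare ℓ m θ f) g ∧
          l2Norm Ω g ≤ M := fun j => by
      refine exists_hasWeakPartialD hΩb.measure_lt_top j hu hM0 fun φ hφ hφc hφΩ => ?_
      have e : ∫ x in Ω, reducedPoincare ℓ m θ f x * partialD j φ x =
          ∫ x in Ω, reducedPoincare ℓ m θ F x * partialD j φ x :=
        setIntegral_congr_fun hΩm fun x hx => by simp only [hPeq x hx]
      rw [e]
      refine (hθ.abs_integral_reducedPoincare_mul_partialD_le hr hB hΩm hΩb hF hF2 hφ hφc hφΩ j m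
        hl0 hl1 (by positivity) hQ).trans ?_
      rw [hFnorm]
      refine mul_le_mul_of_nonneg_right ?_ ENNReal.toReal_nonneg
      rw [hM]
      refine mul_le_mul_of_nonneg_right ?_ hf0
      rw [mul_right_comm _ (R / ρ) κ]
      refine mul_le_mul_of_nonneg_right ?_ (by positivity)
      -- The contribution near `s = 1` carries no `κ`; it is absorbed because `κ ≥ 1`.
      have h1 : nearConst n ≤ nearConst n * κ := le_mul_of_one_le_right hN.le hκ
      rw [mul_assoc (3 * bumpConst K)]
      exact mul_le_mul_of_nonneg_left (by linarith) (by positivity)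
    choose g hg2 hgw hgM using hweak
    refine ⟨g, ⟨hu, fun j => ⟨hg2 j, hgw j⟩⟩, ?_⟩
    have hsum : ∑ j, l2Norm Ω (g j) ^ 2 ≤ n * M ^ 2 := by
      calc ∑ j, l2Norm Ω (g j) ^ 2 ≤ ∑ _j : Fin n, M ^ 2 :=
            Finset.sum_le_sum fun j _ => pow_le_pow_left₀ ENNReal.toReal_nonneg (hgM j) 2
        _ = n * M ^ 2 := by simp
    calc Real.sqrt (∑ j, l2Norm Ω (g j) ^ 2) ≤ n * M := by
          refine Real.sqrt_le_iff.2 ⟨by positivity, hsum.trans ?_⟩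
          rw [mul_pow (n : ℝ) M]
          exact mul_le_mul_of_nonneg_right (le_self_pow₀ hn1 two_ne_zero) (sq_nonneg M)
      _ = _ := by rw [hM]; ring
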